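/- All operators act in $L^2(\mathbb R)$. For $V:\mathbb R\to\mathbb C$ continuous, the maximal realization of $-\partial_x^2+V$ has the domain of all $f\in L^2(\mathbb R)$ that are differentiable with locally absolutely continuous derivative and satisfy $-f''+Vf\in L^2(\mathbb R)$. For $\operatorname{Re}k>0$ let $M_k$ be the maximal realization of $-\partial_x^2+k^2e^{2x}$ (it is the only closed realization), and let $-\partial_x^2$ be the maximal realization with $V=0$. For $\ell>0$ let $M^0_{i\ell}$ and $M^\infty_{i\ell}$ be the restrictions of the maximal realization of $-\partial_x^2-\ell^2e^{2x}$ to those $\Xi$ in its domain that satisfy the boundary condition $$\lim_{x\to\infty}\mathcal W\big(H^{+}_{1/2}(\ell e^x),\Xi(x)\big)=0,\qquad\text{resp.}\qquad \lim_{x\to\infty}\mathcal W\big(H^{-}_{1/2}(\ell e^x),\Xi(x)\big)=0,$$ where $\mathcal W(\Phi,\Xi)=\Phi\Xi'-\Phi'\Xi$ and $H^{\pm}_{1/2}(r)=\mp i\big(\tfrac{2}{\pi r}\big)^{1/2}e^{\pm ir}$. Let $m\in\mathbb C$ with $\operatorname{Re}m>0$. Then $-m^2$ belongs to the resolvent sets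 of all the operators above, and the following limits hold in the weak operator topology. 1. $\displaystyle\lim_{\varepsilon\searrow0}(M_\varepsilon+m^2)^{-1}=(-\partial_x^2+m^2)^{-1}$. 2. For every $\ell>0$, $$\lim_{\varepsilon\searrow0}(M_{\varepsilon+i\ell}+m^2)^{-1}=(M^\infty_{i\ell}+m^2)^{-1},\qquad \lim_{\varepsilon\searrow0}(M_{\varepsilon-i\ell}+m^2)^{-1}=(M^0_{i\ell}+m^2)^{-1}.$$ 3. Setting $M_0:=-\partial_x^2$, $M_{i\ell}:=M^\infty_{i\ell}$ and $M_{-i\ell}:=M^0_{i\ell}$ for $\ell>0$ extends the family $k\mapsto M_k$ continuously from $\{\operatorname{Re}k>0\}$ to $\{\operatorname{Re}k\ge0\}$: for every $m$ with $\operatorname{Re}m>0$ the map $k\mapsto(M_k+m^2)^{-1}$ is continuous on $\{\operatorname{Re}k\ge0\}$ in the weak operator topology. -/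

import Mathlib

open MeasureTheory Filter Topology

noncomputable section

namespace ExpPotential

/-- The Hilbert space `L²(ℝ)` of complex-valued functions. -/
abbrev L2 : Type := Lp ℂ 2 (volume : Measure ℝ)

/-! ### Inverses of unbounded operators -/

/-- `R` is a bounded everywhere defined two-sided inverse of `A - z`. -/
def IsResolventAt (A : L2 →ₗ.[ℂ] L2) (z : ℂ) (R : L2 →L[ℂ] L2) : Prop :=
  (∀ f : L2, ∃ h : R f ∈ A.domain, A ⟨R f, h⟩ - z • R f = f) ∧
    ∀ u : A.domain, R (A u - z • (u : L2)) = u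

/-- The resolvent set: all `z` such that `A - z` has a bounded everywhere defined inverse. -/
def resolventSet (A : L2 →ₗ.[ℂ] L2) : Set ℂ := {z | ∃ R, IsResolventAt A z R}

theorem IsResolventAt.unique {A : L2 →ₗ.[ℂ] L2} {z : ℂ} {R S : L2 →L[ℂ] L2}
    (hR : IsResolventAt A z R) (hS : IsResolventAt A z S) : R = S := by
  ext1 f
  obtain ⟨h, e⟩ := hR.1 f
  have h2 := hS.2 ⟨R f, h⟩
  simp only [e] at h2
  exact h2.symm

open Classical in
/-- The resolvent `(A - z)⁻¹` for `z` in the resolvent set (and `0` otherwise). -/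
def resolvent (A : L2 →ₗ.[ℂ] L2) (z : ℂ) : L2 →L[ℂ] L2 :=
  if h : ∃ R, IsResolventAt A z R then h.choose else 0

theorem isResolventAt_resolvent {A : L2 →ₗ.[ℂ] L2} {z : ℂ} (h : z ∈ resolventSet A) :
    IsResolventAt A z (resolvent A z) := by
  have h' : ∃ R, IsResolventAt A z R := h
  rw [resolvent, dif_pos h']
  exact h'.choose_spec

theorem resolvent_eq {A : L2 →ₗ.[ℂ] L2} {z : ℂ} {R : L2 →L[ℂ] L2} (h : IsResolventAt A z R) :
    resolvent A z = R :=
  (isResolventAt_resolvent ⟨R, h⟩).unique h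

/-! ### The maximal realization of `-∂² + V` on `L²(ℝ)` -/

/-- The space `AC¹(ℝ)`: differentiable functions with a locally absolutely continuous derivative. -/
def AC1 : Submodule ℂ (ℝ → ℂ) where
  carrier := {u | Differentiable ℝ u ∧ ∀ a b : ℝ, AbsolutelyContinuousOnInterval (deriv u) a b}
  zero_mem' := by
    refine ⟨differentiable_const 0, fun a b => ?_⟩
    have : deriv (0 : ℝ → ℂ) = fun _ => 0 := by
      funext x; exact deriv_const x 0
    rw [this]
    exact (contDiff_const.contDiffOn).absolutelyContinuousOnInterval
  add_mem' := by
    rintro u v ⟨hu, hu'⟩ ⟨hv, hv'⟩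
    refine ⟨hu.add hv, fun a b => ?_⟩
    have : deriv (u + v) = deriv u + deriv v := by
      funext x; exact deriv_add (hu x) (hv x)
    rw [this]
    exact (hu' a b).add (hv' a b)
  smul_mem' := by
    rintro c u ⟨hu, hu'⟩
    refine ⟨hu.const_smul c, fun a b => ?_⟩
    have : deriv (c • u) = fun x => c • deriv u x := by
      funext x; exact deriv_const_smul c (hu x)
    rw [this]
    exact (hu' a b).const_smul c

theorem AC1.continuous {u : ℝ → ℂ} (hu : u ∈ AC1) : Continuous u := hu.1.continuous

theorem AC1.ae_differentiableAt_deriv {u : ℝ → ℂ} (hu : u ∈ AC1) :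
    ∀ᵐ x : ℝ, DifferentiableAt ℝ (deriv u) x := by
  have h : ∀ n : ℕ, ∀ᵐ x : ℝ, x ∈ Set.uIcc (-(n : ℝ)) n → DifferentiableAt ℝ (deriv u) x :=
    fun n => (hu.2 _ _).boundedVariationOn.ae_differentiableAt_of_mem_uIcc
  filter_upwards [ae_all_iff.2 h] with x hx
  obtain ⟨n, hn⟩ := exists_nat_ge |x|
  refine hx n ?_
  rw [Set.uIcc_of_le (by linarith [abs_nonneg x])]
  exact ⟨(abs_le.1 hn).1, (abs_le.1 hn).2⟩

/-- The differential expression `L u = -u'' + V u`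
(for `u ∈ AC¹` the second derivative exists almost everywhere). -/
def schr (V u : ℝ → ℂ) (x : ℝ) : ℂ := -deriv (deriv u) x + V x * u x

theorem schr_add (V : ℝ → ℂ) {u v : ℝ → ℂ} (hu : u ∈ AC1) (hv : v ∈ AC1) :
    schr V (u + v) =ᵐ[volume] schr V u + schr V v := by
  have e : deriv (u + v) = deriv u + deriv v := by
    funext x; exact deriv_add (hu.1 x) (hv.1 x)
  filter_upwards [AC1.ae_differentiableAt_deriv hu, AC1.ae_differentiableAt_deriv hv] with x h1 h2
  simp only [schr, e, Pi.add_apply, deriv_add h1 h2]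
  ring

theorem schr_smul (V : ℝ → ℂ) (c : ℂ) {u : ℝ → ℂ} (hu : u ∈ AC1) :
    schr V (c • u) =ᵐ[volume] c • schr V u := by
  have e : deriv (c • u) = c • deriv u := by
    funext x; exact deriv_const_smul c (hu.1 x)
  filter_upwards [AC1.ae_differentiableAt_deriv hu] with x h1
  simp only [schr, e, Pi.smul_apply, deriv_const_smul c h1, smul_eq_mul]
  ring

/-- `u` is the `AC¹` representative of the class `f ∈ L²(ℝ)`. -/
def IsRep (f : L2) (u : ℝ → ℂ) : Prop := u ∈ AC1 ∧ f =ᵐ[volume] u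

theorem IsRep.unique {f : L2} {u v : ℝ → ℂ} (hu : IsRep f u) (hv : IsRep f v) : u = v :=
  Measure.eq_of_ae_eq (μ := (volume : Measure ℝ)) (hu.2.symm.trans hv.2)
    (AC1.continuous hu.1) (AC1.continuous hv.1)

theorem IsRep.add {f g : L2} {u v : ℝ → ℂ} (hu : IsRep f u) (hv : IsRep g v) :
    IsRep (f + g) (u + v) :=
  ⟨AC1.add_mem hu.1 hv.1, (Lp.coeFn_add f g).trans (hu.2.add hv.2)⟩

theorem IsRep.smul {f : L2} {u : ℝ → ℂ} (c : ℂ) (hu : IsRep f u) : IsRep (c • f) (c • u) :=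
  ⟨AC1.smul_mem c hu.1, (Lp.coeFn_smul c f).trans (hu.2.const_smul c)⟩

theorem isRep_zero : IsRep 0 0 := ⟨AC1.zero_mem, Lp.coeFn_zero ℂ 2 volume⟩

open Classical in
/-- The `AC¹` representative of `f`, if there is one. -/
def rep (f : L2) : ℝ → ℂ := if h : ∃ u, IsRep f u then h.choose else 0

theorem IsRep.rep_eq {f : L2} {u : ℝ → ℂ} (hu : IsRep f u) : rep f = u := by
  have h : ∃ u, IsRep f u := ⟨u, hu⟩
  rw [rep, dif_pos h]
  exact h.choose_spec.unique hu

/-- The maximal domain `{f ∈ L² ∩ AC¹ ∣ L f ∈ L²}` of `L = -∂² + V`. -/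
def maxDomain (V : ℝ → ℂ) : Submodule ℂ L2 where
  carrier := {f | ∃ u, IsRep f u ∧ MemLp (schr V u) 2 volume}
  zero_mem' := by
    refine ⟨0, isRep_zero, ?_⟩
    have h := schr_smul V 0 AC1.zero_mem
    rw [zero_smul, zero_smul] at h
    exact MemLp.zero.ae_eq h.symm
  add_mem' := by
    rintro f g ⟨u, hu, hu'⟩ ⟨v, hv, hv'⟩
    exact ⟨u + v, hu.add hv, (hu'.add hv').ae_eq (schr_add V hu.1 hv.1).symm⟩
  smul_mem' := by
    rintro c f ⟨u, hu, hu'⟩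
    exact ⟨c • u, hu.smul c, (hu'.const_smul c).ae_eq (schr_smul V c hu.1).symm⟩

theorem isRep_rep {V : ℝ → ℂ} {f : L2} (h : f ∈ maxDomain V) : IsRep f (rep f) := by
  obtain ⟨u, hu, -⟩ := h
  rwa [hu.rep_eq]

theorem memLp_schr_rep {V : ℝ → ℂ} {f : L2} (h : f ∈ maxDomain V) :
    MemLp (schr V (rep f)) 2 volume := by
  obtain ⟨u, hu, h2⟩ := h
  rwa [hu.rep_eq]

/-- The maximal realization of `L = -∂² + V` on `L²(ℝ)`. -/
def maxRealization (V : ℝ → ℂ) : L2 →ₗ.[ℂ] L2 where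
  domain := maxDomain V
  toFun :=
    { toFun := fun f => (memLp_schr_rep f.2).toLp (schr V (rep (f : L2)))
      map_add' := by
        intro f g
        have hf := isRep_rep f.2
        have hg := isRep_rep g.2
        rw [← MemLp.toLp_add, MemLp.toLp_eq_toLp_iff, Submodule.coe_add, (hf.add hg).rep_eq]
        exact schr_add V hf.1 hg.1
      map_smul' := by
        intro c f
        have hf := isRep_rep f.2
        rw [RingHom.id_apply, ← MemLp.toLp_const_smul, MemLp.toLp_eq_toLp_iff,
          Submodule.coe_smul, (hf.smul c).rep_eq]
        exact schr_smul V c hf.1 }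

/-- The Wronskian `Φ Ξ' - Φ' Ξ`. -/
def wronskian (Φ Ξ : ℝ → ℂ) (x : ℝ) : ℂ := Φ x * deriv Ξ x - deriv Φ x * Ξ x

/-- Elements of the maximal domain of `-∂² + V` that satisfy the boundary condition at `+∞`
set by `Φ`, i.e. `lim_{x → ∞} W(Φ, Ξ)(x) = 0`. -/
def bcDomain (V Φ : ℝ → ℂ) : Submodule ℂ L2 where
  carrier := {f | f ∈ maxDomain V ∧ Tendsto (wronskian Φ (rep f)) atTop (𝓝 0)}
  zero_mem' := by
    refine ⟨(maxDomain V).zero_mem, ?_⟩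
    rw [isRep_zero.rep_eq]
    have : wronskian Φ 0 = fun _ => 0 := by
      funext x
      have h0 : deriv (0 : ℝ → ℂ) x = 0 := deriv_const x 0
      simp [wronskian, h0]
    rw [this]
    exact tendsto_const_nhds
  add_mem' := by
    rintro f g ⟨hf, hf'⟩ ⟨hg, hg'⟩
    refine ⟨(maxDomain V).add_mem hf hg, ?_⟩
    have rf := isRep_rep hf
    have rg := isRep_rep hg
    rw [(rf.add rg).rep_eq]
    have : wronskian Φ (rep f + rep g) = fun x => wronskian Φ (rep f) x + wronskian Φ (rep g) x := by
      funext x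
      simp only [wronskian, deriv_add (rf.1.1 x) (rg.1.1 x), Pi.add_apply]
      ring
    rw [this]
    simpa using hf'.add hg'
  smul_mem' := by
    rintro c f ⟨hf, hf'⟩
    refine ⟨(maxDomain V).smul_mem c hf, ?_⟩
    have rf := isRep_rep hf
    rw [(rf.smul c).rep_eq]
    have : wronskian Φ (c • rep f) = fun x => c * wronskian Φ (rep f) x := by
      funext x
      simp only [wronskian, deriv_const_smul c (rf.1.1 x), Pi.smul_apply, smul_eq_mul]
      ring
    rw [this]
    simpa using hf'.const_mul c

/-- The realization of `-∂² + V` with the boundary condition at `+∞` set by `Φ`. -/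
def bcRealization (V Φ : ℝ → ℂ) : L2 →ₗ.[ℂ] L2 :=
  (maxRealization V).domRestrict (bcDomain V Φ)

/-! ### Exponential potentials -/

/-- The free operator `-∂²` on `L²(ℝ)`. -/
def freeOp : L2 →ₗ.[ℂ] L2 := maxRealization fun _ => 0

/-- The exponential potential `k² e^{2x}`. -/
def expPot (k : ℂ) (x : ℝ) : ℂ := k ^ 2 * Complex.exp (2 * x)

/-- The operator `M_k = -∂² + k² e^{2x}` on its maximal domain
(for `Re k > 0` this is its only closed realization). -/
def M (k : ℂ) : L2 →ₗ.[ℂ] L2 := maxRealization (expPot k)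

/-- The Hankel function `H⁺_{1/2}(r) = -i (2 / (π r))^{1/2} e^{ir}`, `r > 0`. -/
def hankelHalfPlus (r : ℝ) : ℂ :=
  -Complex.I * (√(2 / (Real.pi * r)) : ℝ) * Complex.exp (Complex.I * r)

/-- The Hankel function `H⁻_{1/2}(r) = i (2 / (π r))^{1/2} e^{-ir}`, `r > 0`. -/
def hankelHalfMinus (r : ℝ) : ℂ :=
  Complex.I * (√(2 / (Real.pi * r)) : ℝ) * Complex.exp (-(Complex.I * r))

/-- `M⁰_{iℓ}`: the realization of `-∂² - ℓ² e^{2x}` with the boundary condition at `+∞` set by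
`H⁺_{1/2}(ℓ eˣ)`. -/
def MZero (ℓ : ℝ) : L2 →ₗ.[ℂ] L2 :=
  bcRealization (expPot (Complex.I * ℓ)) fun x => hankelHalfPlus (ℓ * Real.exp x)

/-- `M^∞_{iℓ}`: the realization of `-∂² - ℓ² e^{2x}` with the boundary condition at `+∞` set by
`H⁻_{1/2}(ℓ eˣ)`. -/
def MInfty (ℓ : ℝ) : L2 →ₗ.[ℂ] L2 :=
  bcRealization (expPot (Complex.I * ℓ)) fun x => hankelHalfMinus (ℓ * Real.exp x)

open Classical in
/-- The family `M_k` extended to `Re k ≥ 0` by `M_0 := -∂²`, `M_{iℓ} := M^∞_{iℓ}` and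
`M_{-iℓ} := M⁰_{iℓ}` for `ℓ > 0` (used only for `Re k ≥ 0`). -/
def extendedM (k : ℂ) : L2 →ₗ.[ℂ] L2 :=
  if 0 < k.re then M k
  else if 0 < k.im then MInfty k.im
  else if k.im < 0 then MZero (-k.im)
  else freeOp

/-! ### Weak convergence -/

/-- Convergence of bounded operators in the weak operator topology. -/
def WeakTendsto {ι : Type*} (R : ι → L2 →L[ℂ] L2) (l : Filter ι) (S : L2 →L[ℂ] L2) : Prop :=
  Tendsto (fun i => ContinuousLinearMapWOT.ofCLM (R i)) l (𝓝 (ContinuousLinearMapWOT.ofCLM S))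

end ExpPotential

end

/-!
The resolvents of all the operators in question are given by one explicit integral kernel that
depends continuously on `k` in the closed half-plane `Re k ≥ 0`.

Put `z = k eˣ`. The equation `u'' = (k² e^{2x} + m²) u` is the modified Bessel equation of order `m`
in the variable `z`. Two of its solutions are `U = e^{mx} P(z)` and `V = e^{-mx} e^{-z} F(z)`
(`solU`, `solV`), where `P(z)`, a multiple of `z^{-m} I_m(z)`, is the Beta type integral `besselP`,
and `F(z)`, a multiple of `z^m e^z K_m(z)`, is the Laplace integral `laplaceF`. For `Re m > 0` both
make sense and are continuous for all `Re z ≥ 0`, including `z = 0`, so that at `k = 0` they reduce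
to multiples of `e^{mx}` and `e^{-mx}`. Their Wronskian is a nonzero constant independent of `k`
(`wronskian_sol`).

The kernel `U(min) V(max) / w` is bounded by `C e^{-δ|x-y|}` with `C` and `δ` independent of `k`
(`exists_norm_solU_mul_norm_solV_le`). For `V` this rests on the Laplace integral, and for `U` on a
differential inequality for an energy that survives on the imaginary axis (`exists_norm_solU_le`).
The Schur test then makes the kernel a bounded operator on `L²(ℝ)`, the Green operator.

The Green operator is the resolvent at `-m²` of the realization whose boundary condition at `+∞` is
set by `V` (`GreenPair.isResolventAt_op`). By the Lagrange identity this comes down to the vanishing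
of Wronskians at `±∞`. Where a Wronskian is known to converge and involves a function bounded
together with its derivative, its limit is `0`, since the derivative can be moved off the `L²`
function by averaging over unit intervals (`wronskian_limit_eq_zero`).

The boundary condition set by `V` is the prescribed one (`extendedM_eq_bcRealization`). For
`Re k > 0` and for `k = 0` the functions `V, V'` are bounded at `+∞`, and the condition is void. For
imaginary `k ≠ 0` the function `V` differs from a multiple of a Hankel function by a function that
is bounded with its derivative, so that both set the same condition (`bcRealization_congr`).

Finally, dominated convergence, with the uniform kernel bound as majorant, gives the weak continuity
of the resolvent in `k` on `Re k ≥ 0` (`weakTendsto_resolvent_extendedM`), and the three limits are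
instances of it.
-/

noncomputable section

namespace ExpPotential

/-! ### Absolutely continuous functions -/

/-- Absolute continuity passes to a function whose increments are dominated by those of an
absolutely continuous function. -/
theorem absolutelyContinuousOnInterval_of_dist_le {X Y : Type*} [PseudoMetricSpace X]
    [PseudoMetricSpace Y] {f : ℝ → X} {G : ℝ → Y}
    {a b : ℝ} (hG : AbsolutelyContinuousOnInterval G a b)
    (h : ∀ x ∈ Set.uIcc a b, ∀ y ∈ Set.uIcc a b, dist (f x) (f y) ≤ dist (G x) (G y)) :
    AbsolutelyContinuousOnInterval f a b := by
  rw [absolutelyContinuousOnInterval_iff] at hG ⊢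
  intro ε hε
  obtain ⟨d, hd, H⟩ := hG ε hε
  refine ⟨d, hd, fun E hE hE' => lt_of_le_of_lt (Finset.sum_le_sum fun i hi => ?_) (H E hE hE')⟩
  have := hE.1 i hi
  exact h _ this.1 _ this.2

theorem absolutelyContinuousOnInterval_primitive {g : ℝ → ℂ} (hg : LocallyIntegrable g volume)
    (c a b : ℝ) : AbsolutelyContinuousOnInterval (fun x => ∫ t in c..x, g t) a b := by
  have hi : ∀ x y : ℝ, IntervalIntegrable g volume x y := fun x y =>
    (hg.integrableOn_isCompact isCompact_uIcc).intervalIntegrable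
  have h1 := ((hi a b).norm).absolutelyContinuousOnInterval_intervalIntegral
    (c := a) Set.left_mem_uIcc
  refine absolutelyContinuousOnInterval_of_dist_le h1 fun x hx y hy => ?_
  rw [dist_eq_norm, dist_eq_norm, intervalIntegral.integral_interval_sub_left (hi _ _) (hi _ _),
    intervalIntegral.integral_interval_sub_left (hi _ _).norm (hi _ _).norm, Real.norm_eq_abs]
  exact intervalIntegral.norm_integral_le_abs_integral_norm

/-- The fundamental theorem of calculus for complex-valued absolutely continuous functions. -/
theorem integral_eq_sub_of_ae_hasDerivAt {f g : ℝ → ℂ}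
    (hf : ∀ a b, AbsolutelyContinuousOnInterval f a b) (hg : LocallyIntegrable g volume)
    (hd : ∀ᵐ x : ℝ, HasDerivAt f (g x) x) (a b : ℝ) :
    ∫ t in a..b, g t = f b - f a := by
  have h1 := (hf a b).sub (absolutelyContinuousOnInterval_primitive hg a a b)
  obtain ⟨C, hC⟩ := h1.const_of_ae_hasDerivAt_zero (by
    filter_upwards [hd, LocallyIntegrable.ae_hasDerivAt_integral hg] with x hx hx' _
    simpa using! hx.sub (hx' a))
  have e1 := hC a Set.left_mem_uIcc
  have e2 := hC b Set.right_mem_uIcc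
  simp only [Pi.sub_apply, intervalIntegral.integral_same, sub_zero] at e1 e2
  rw [← e1] at e2
  rw [← sub_eq_zero]
  linear_combination -e2

/-- An absolutely continuous function whose almost everywhere derivative is continuous is
differentiable everywhere. -/
theorem hasDerivAt_of_ae_hasDerivAt_of_continuous {f g : ℝ → ℂ}
    (hf : ∀ a b, AbsolutelyContinuousOnInterval f a b) (hg : Continuous g)
    (hd : ∀ᵐ x : ℝ, HasDerivAt f (g x) x) (x : ℝ) : HasDerivAt f (g x) x := by
  have h1 : f = fun y => f 0 + ∫ t in (0 : ℝ)..y, g t := by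
    funext y
    rw [integral_eq_sub_of_ae_hasDerivAt hf hg.locallyIntegrable hd]; ring
  have h2 : HasDerivAt (fun y => f 0 + ∫ t in (0 : ℝ)..y, g t) (g x) x :=
    (hg.integral_hasStrictDerivAt 0 x).hasDerivAt.const_add _
  rwa [← h1] at h2

theorem absolutelyContinuousOnInterval_of_hasDerivAt {f f' : ℝ → ℂ}
    (h : ∀ x, HasDerivAt f (f' x) x) (hc : Continuous f') (a b : ℝ) :
    AbsolutelyContinuousOnInterval f a b := by
  have : ContDiff ℝ 1 f := by
    rw [contDiff_one_iff_deriv]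
    refine ⟨fun x => (h x).differentiableAt, ?_⟩
    rwa [show deriv f = f' from funext fun x => (h x).deriv]
  exact this.contDiffOn.absolutelyContinuousOnInterval

theorem continuous_of_absolutelyContinuous {f : ℝ → ℂ}
    (hf : ∀ a b, AbsolutelyContinuousOnInterval f a b) : Continuous f := by
  rw [continuous_iff_continuousAt]
  intro x
  have h := (hf (x - 1) (x + 1)).continuousOn
  rw [Set.uIcc_of_le (by linarith)] at h
  exact h.continuousAt (Icc_mem_nhds (by linarith) (by linarith))

theorem continuous_deriv_of_mem_AC1 {u : ℝ → ℂ} (hu : u ∈ AC1) : Continuous (deriv u) :=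
  continuous_of_absolutelyContinuous hu.2

theorem locallyIntegrable_of_memLp {f : ℝ → ℂ} (hf : MemLp f 2 volume) :
    LocallyIntegrable f volume := hf.locallyIntegrable (by norm_num)

/-! ### Wronskians -/

/-- The Lagrange identity: if `φ'' = p`, the Wronskian of `φ` with an `AC¹` function `u` is the
integral of `φ u'' - p u`. -/
theorem integral_wronskian {φ φ' p u g : ℝ → ℂ} (hφ : ∀ x, HasDerivAt φ (φ' x) x)
    (hφ' : ∀ x, HasDerivAt φ' (p x) x) (hp : Continuous p) (hu : u ∈ AC1)
    (hg : LocallyIntegrable g volume)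
    (hgu : ∀ᵐ x : ℝ, φ x * deriv (deriv u) x - p x * u x = g x) (a b : ℝ) :
    ∫ t in a..b, g t
      = (φ b * deriv u b - φ' b * u b) - (φ a * deriv u a - φ' a * u a) := by
  have c1 : Continuous φ' := continuous_iff_continuousAt.2 fun x => (hφ' x).continuousAt
  have cu' := continuous_deriv_of_mem_AC1 hu
  refine integral_eq_sub_of_ae_hasDerivAt
    (f := fun x => φ x * deriv u x - φ' x * u x) (fun a b => ?_) hg ?_ a b
  · exact ((absolutelyContinuousOnInterval_of_hasDerivAt hφ c1 a b).smul (hu.2 a b)).sub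
      ((absolutelyContinuousOnInterval_of_hasDerivAt hφ' hp a b).smul
      (absolutelyContinuousOnInterval_of_hasDerivAt (fun x => (hu.1 x).hasDerivAt) cu' a b))
  · filter_upwards [AC1.ae_differentiableAt_deriv hu, hgu] with x hx hx'
    have := ((hφ x).mul hx.hasDerivAt).sub ((hφ' x).mul (hu.1 x).hasDerivAt)
    convert! this using 1
    rw [← hx']; ring

theorem tendsto_integral_unit_interval_atTop {F : ℝ → ℝ} (hF : Integrable F volume) :
    Tendsto (fun c : ℝ => ∫ t in c..(c + 1), F t) atTop (𝓝 0) := by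
  have h := intervalIntegral_tendsto_integral_Ioi (0 : ℝ) hF.integrableOn tendsto_id
  have h2 := intervalIntegral_tendsto_integral_Ioi (0 : ℝ) hF.integrableOn
    (tendsto_atTop_add_const_right atTop (1 : ℝ) tendsto_id)
  have h3 := h2.sub h
  rw [sub_self] at h3
  refine h3.congr fun c => ?_
  exact intervalIntegral.integral_interval_sub_left hF.intervalIntegrable hF.intervalIntegrable

theorem tendsto_integral_unit_interval_atBot {F : ℝ → ℝ} (hF : Integrable F volume) :
    Tendsto (fun c : ℝ => ∫ t in c..(c + 1), F t) atBot (𝓝 0) := by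
  have h := intervalIntegral_tendsto_integral_Iic (0 : ℝ) hF.integrableOn tendsto_id
  have h2 := intervalIntegral_tendsto_integral_Iic (0 : ℝ) hF.integrableOn
    (tendsto_atBot_add_const_right atBot (1 : ℝ) tendsto_id)
  have h3 := h.sub h2
  rw [sub_self] at h3
  refine h3.congr fun c => ?_
  have := intervalIntegral.integral_add_adjacent_intervals (μ := volume)
    (hF.intervalIntegrable (a := c) (b := c + 1)) (hF.intervalIntegrable (a := c + 1) (b := 0))
  simp only [id]
  linarith

/-- Averaging a Wronskian against the bump `(x - c) (c + 1 - x)` moves the derivative off `u`. -/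
theorem norm_integral_bump_wronskian_le {φ φ' u u' : ℝ → ℂ} {K c : ℝ}
    (hφ : ∀ x, HasDerivAt φ (φ' x) x) (hφ' : Continuous φ')
    (hu : ∀ x, HasDerivAt u (u' x) x) (hu' : Continuous u')
    (hK : ∀ x ∈ Set.Icc c (c + 1), ‖φ x‖ ≤ K ∧ ‖φ' x‖ ≤ K) :
    ‖∫ x in c..(c + 1), (((x - c) * (c + 1 - x) : ℝ) : ℂ) * (φ x * u' x - φ' x * u x)‖
      ≤ 3 * K * ∫ x in c..(c + 1), ‖u x‖ := by
  have cφ : Continuous φ := continuous_iff_continuousAt.2 fun x => (hφ x).continuousAt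
  have cu : Continuous u := continuous_iff_continuousAt.2 fun x => (hu x).continuousAt
  have hχ : ∀ x : ℝ, HasDerivAt (fun x : ℝ => (((x - c) * (c + 1 - x) : ℝ) : ℂ))
      (((2 * c + 1 - 2 * x : ℝ)) : ℂ) x := by
    intro x
    have h1 : HasDerivAt (fun x : ℝ => (x - c) * (c + 1 - x)) (2 * c + 1 - 2 * x) x := by
      have := ((hasDerivAt_id x).sub_const c).mul ((hasDerivAt_id x).const_sub (c + 1))
      convert! this using 1
      simp; ring
    exact h1.ofReal_comp
  have h0 : ∫ x in c..(c + 1), ((((2 * c + 1 - 2 * x : ℝ)) : ℂ) * (φ x * u x)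
      + (((x - c) * (c + 1 - x) : ℝ) : ℂ) * (φ' x * u x + φ x * u' x)) = 0 := by
    rw [intervalIntegral.integral_eq_sub_of_hasDerivAt
      (f := fun x => (((x - c) * (c + 1 - x) : ℝ) : ℂ) * (φ x * u x))
      (fun x _ => (hχ x).mul ((hφ x).mul (hu x)))
      (by apply Continuous.intervalIntegrable; fun_prop)]
    simp
  have h1 : ∫ x in c..(c + 1), (((x - c) * (c + 1 - x) : ℝ) : ℂ) * (φ x * u' x - φ' x * u x)
      = -∫ x in c..(c + 1), ((((2 * c + 1 - 2 * x : ℝ)) : ℂ) * φ x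
        + 2 * (((x - c) * (c + 1 - x) : ℝ) : ℂ) * φ' x) * u x := by
    rw [← sub_eq_zero, sub_neg_eq_add, ← intervalIntegral.integral_add, ← h0]
    · congr 1; funext x; ring
    · apply Continuous.intervalIntegrable; fun_prop
    · apply Continuous.intervalIntegrable; fun_prop
  rw [h1, norm_neg, ← intervalIntegral.integral_const_mul]
  refine intervalIntegral.norm_integral_le_of_norm_le (by linarith) (ae_of_all _ fun x hx => ?_)
    (by apply Continuous.intervalIntegrable; fun_prop)
  have hx' : x ∈ Set.Icc c (c + 1) := ⟨hx.1.le, hx.2⟩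
  obtain ⟨k1, k2⟩ := hK x hx'
  rw [norm_mul]
  refine mul_le_mul_of_nonneg_right ?_ (norm_nonneg _)
  refine (norm_add_le _ _).trans ?_
  rw [norm_mul, norm_mul, norm_mul, Complex.norm_real, Complex.norm_real, Complex.norm_two]
  have hK0 : 0 ≤ K := (norm_nonneg _).trans k1
  have b1 : ‖2 * c + 1 - 2 * x‖ ≤ 1 := by
    rw [Real.norm_eq_abs, abs_le]; constructor <;> linarith [hx'.1, hx'.2]
  have b2 : ‖(x - c) * (c + 1 - x)‖ ≤ 1 := by
    rw [Real.norm_eq_abs, abs_le]; constructor <;> nlinarith [hx'.1, hx'.2]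
  nlinarith [mul_le_mul b1 k1 (norm_nonneg _) zero_le_one,
    mul_le_mul b2 k2 (norm_nonneg _) zero_le_one]

/-- If `φ, φ'` are bounded near an end of the line, then the Wronskian of `φ` with an `L²` function
can have no other limit there than `0`. The filter `l` is `atTop` or `atBot`. -/
theorem wronskian_limit_eq_zero {φ φ' u u' : ℝ → ℂ} {K : ℝ} {l : Filter ℝ} [l.NeBot] {L : ℂ}
    (hl : ∀ p : ℝ → Prop, (∀ᶠ x in l, p x) → ∀ᶠ c in l, ∀ x ∈ Set.Icc c (c + 1), p x)
    (hφ : ∀ x, HasDerivAt φ (φ' x) x) (hφ' : Continuous φ')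
    (hu : ∀ x, HasDerivAt u (u' x) x) (hu' : Continuous u')
    (hK : ∀ᶠ x in l, ‖φ x‖ ≤ K ∧ ‖φ' x‖ ≤ K)
    (hu2 : Tendsto (fun c : ℝ => ∫ t in c..(c + 1), ‖u t‖ ^ 2) l (𝓝 0))
    (hL : Tendsto (fun x => φ x * u' x - φ' x * u x) l (𝓝 L)) : L = 0 := by
  have cφ : Continuous φ := continuous_iff_continuousAt.2 fun x => (hφ x).continuousAt
  have cu : Continuous u := continuous_iff_continuousAt.2 fun x => (hu x).continuousAt
  have hK0 : 0 ≤ K := by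
    obtain ⟨x, hx⟩ := hK.exists
    exact (norm_nonneg _).trans hx.1
  have hχ : ∀ c : ℝ, ∫ x in c..(c + 1), (((x - c) * (c + 1 - x) : ℝ) : ℂ) = 1 / 6 := by
    intro c
    rw [intervalIntegral.integral_ofReal]
    have : ∫ x in c..(c + 1), (x - c) * (c + 1 - x) = 1 / 6 := by
      have hd : ∀ x : ℝ, HasDerivAt (fun x : ℝ => (x - c) ^ 2 / 2 - (x - c) ^ 3 / 3)
          ((x - c) * (c + 1 - x)) x := by
        intro x
        have h1 := ((((hasDerivAt_id x).sub_const c).pow 2).div_const 2).sub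
          ((((hasDerivAt_id x).sub_const c).pow 3).div_const 3)
        convert! h1 using 1
        simp; ring
      rw [intervalIntegral.integral_eq_sub_of_hasDerivAt (fun x _ => hd x)
        (by apply Continuous.intervalIntegrable; fun_prop)]
      norm_num
    rw [this]; norm_num
  by_contra hne
  have hpos : 0 < ‖L‖ := norm_pos_iff.2 hne
  -- `|u| ≤ η + |u|² / η` turns the bound on the mean of `|u|²` into one on the mean of `|u|`.
  set η : ℝ := ‖L‖ / (100 * (K + 1)) with hη
  have hη0 : 0 < η := by positivity
  have e1 : ∀ᶠ c in l, ∀ x ∈ Set.Icc c (c + 1), ‖φ x * u' x - φ' x * u x - L‖ ≤ ‖L‖ / 20 := by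
    refine hl _ ?_
    have := (tendsto_iff_norm_sub_tendsto_zero.1 hL).eventually_lt_const
      (show (0 : ℝ) < ‖L‖ / 20 by positivity)
    exact this.mono fun x hx => hx.le
  have e2 : ∀ᶠ c in l, ∫ t in c..(c + 1), ‖u t‖ ^ 2 < η ^ 2 :=
    hu2.eventually_lt_const (by positivity)
  obtain ⟨c, h1, h2, h3⟩ := (e1.and (e2.and (hl _ hK))).exists
  have b1 := norm_integral_bump_wronskian_le hφ hφ' hu hu' h3
  have b2 : ∫ x in c..(c + 1), ‖u x‖ ≤ 2 * η := by
    have : ∫ x in c..(c + 1), ‖u x‖ ≤ ∫ x in c..(c + 1), (η + ‖u x‖ ^ 2 / η) := by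
      refine intervalIntegral.integral_mono_on (by linarith)
        (by apply Continuous.intervalIntegrable; fun_prop)
        (by apply Continuous.intervalIntegrable; fun_prop) fun x _ => ?_
      rw [← sub_nonneg]
      have : η + ‖u x‖ ^ 2 / η - ‖u x‖ = ((η - ‖u x‖ / 2) ^ 2 + 3 / 4 * ‖u x‖ ^ 2) / η := by
        field_simp; ring
      rw [this]; positivity
    refine this.trans ?_
    rw [intervalIntegral.integral_add (by simp)
      (by apply Continuous.intervalIntegrable; fun_prop), intervalIntegral.integral_const,
      add_sub_cancel_left, one_smul, intervalIntegral.integral_div]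
    have : (∫ x in c..(c + 1), ‖u x‖ ^ 2) / η ≤ η := by
      rw [div_le_iff₀ hη0]; nlinarith
    linarith
  have b3 : ‖(∫ x in c..(c + 1), (((x - c) * (c + 1 - x) : ℝ) : ℂ) * (φ x * u' x - φ' x * u x))
      - L / 6‖ ≤ ‖L‖ / 20 := by
    have : L / 6 = ∫ x in c..(c + 1), (((x - c) * (c + 1 - x) : ℝ) : ℂ) * L := by
      rw [intervalIntegral.integral_mul_const, hχ]; ring
    rw [this, ← intervalIntegral.integral_sub (by apply Continuous.intervalIntegrable; fun_prop)
      (by apply Continuous.intervalIntegrable; fun_prop)]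
    have := intervalIntegral.norm_integral_le_of_norm_le_const (a := c) (b := c + 1)
      (C := ‖L‖ / 20) (f := fun x => (((x - c) * (c + 1 - x) : ℝ) : ℂ) * (φ x * u' x - φ' x * u x)
        - (((x - c) * (c + 1 - x) : ℝ) : ℂ) * L) (fun x hx => by
          rw [Set.uIoc_of_le (by linarith)] at hx
          have hx' : x ∈ Set.Icc c (c + 1) := ⟨hx.1.le, hx.2⟩
          rw [← mul_sub, norm_mul, Complex.norm_real]
          have b2 : ‖(x - c) * (c + 1 - x)‖ ≤ 1 := by
            rw [Real.norm_eq_abs, abs_le]; constructor <;> nlinarith [hx'.1, hx'.2]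
          calc _ ≤ 1 * (‖L‖ / 20) := mul_le_mul b2 (h1 x hx') (norm_nonneg _) zero_le_one
            _ = _ := one_mul _)
    simpa using this
  have b4 : 3 * K * (2 * η) ≤ ‖L‖ * (6 / 100) := by
    have : η * (K + 1) = ‖L‖ / 100 := by rw [hη]; field_simp
    nlinarith
  have b5 : ‖L / 6‖ ≤ ‖L‖ / 20 + ‖L‖ * (6 / 100) := by
    have := norm_sub_le_of_le b1 b3
    rw [sub_sub_cancel] at this
    have h6 := mul_le_mul_of_nonneg_left b2 (show 0 ≤ 3 * K by positivity)
    linarith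
  rw [norm_div] at b5
  norm_num at b5
  linarith

theorem eventually_unit_interval_atTop (p : ℝ → Prop) (h : ∀ᶠ x in atTop, p x) :
    ∀ᶠ c in atTop, ∀ x ∈ Set.Icc c (c + 1), p x := by
  obtain ⟨a, ha⟩ := eventually_atTop.1 h
  exact eventually_atTop.2 ⟨a, fun c hc x hx => ha x (hc.trans hx.1)⟩

theorem eventually_unit_interval_atBot (p : ℝ → Prop) (h : ∀ᶠ x in atBot, p x) :
    ∀ᶠ c in atBot, ∀ x ∈ Set.Icc c (c + 1), p x := by
  obtain ⟨a, ha⟩ := eventually_atBot.1 h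
  exact eventually_atBot.2 ⟨a - 1, fun c hc x hx => ha x (hx.2.trans (by linarith))⟩

/-! ### The Schur test for the kernel `e^{-δ|x-y|}` -/

theorem integrable_exp_neg_mul_abs {δ : ℝ} (hδ : 0 < δ) :
    Integrable (fun t : ℝ => Real.exp (-δ * |t|)) volume := by
  rw [← integrableOn_univ, ← Set.Iic_union_Ioi (a := (0 : ℝ)), integrableOn_union]
  constructor
  · refine (integrableOn_exp_mul_Iic hδ 0).congr_fun (fun t ht => ?_) measurableSet_Iic
    simp only
    rw [abs_of_nonpos ht, neg_mul_neg]
  · refine (integrableOn_exp_mul_Ioi (neg_lt_zero.2 hδ) 0).congr_fun (fun t ht => ?_)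
      measurableSet_Ioi
    simp only
    rw [abs_of_pos ht]

theorem memLp_two_exp_neg_mul_abs_sub {δ : ℝ} (hδ : 0 < δ) (x : ℝ) :
    MemLp (fun y : ℝ => Real.exp (-δ * |x - y|)) 2 volume := by
  rw [memLp_two_iff_integrable_sq (by fun_prop)]
  have h := (integrable_exp_neg_mul_abs (show 0 < 2 * δ by linarith)).comp_sub_left x
  refine h.congr (ae_of_all _ fun y => ?_)
  simp only
  rw [← Real.exp_nat_mul]
  congr 1; push_cast; ring

/-- The average of `|f|` against the kernel `e^{-δ|x-y|}`; it dominates all Green operators. -/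
def expAvg (δ : ℝ) (f : ℝ → ℂ) (x : ℝ) : ℝ := ∫ y, Real.exp (-δ * |x - y|) * ‖f y‖

theorem integrable_expAvg {δ : ℝ} (hδ : 0 < δ) (f : L2) (x : ℝ) :
    Integrable (fun y => Real.exp (-δ * |x - y|) * ‖f y‖) volume :=
  (memLp_two_exp_neg_mul_abs_sub hδ x).integrable_mul (Lp.memLp f).norm

theorem expAvg_nonneg (δ : ℝ) (f : ℝ → ℂ) (x : ℝ) : 0 ≤ expAvg δ f x :=
  integral_nonneg fun _ => mul_nonneg (Real.exp_pos _).le (norm_nonneg _)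

theorem aestronglyMeasurable_expAvg (δ : ℝ) (f : L2) :
    AEStronglyMeasurable (expAvg δ f) volume := by
  have h : StronglyMeasurable (fun p : ℝ × ℝ => Real.exp (-δ * |p.1 - p.2|) * ‖f p.2‖) := by
    refine StronglyMeasurable.mul (Continuous.stronglyMeasurable (by fun_prop)) ?_
    exact ((Lp.stronglyMeasurable f).comp_measurable measurable_snd).norm
  exact h.integral_prod_right.aestronglyMeasurable

/-- The total mass of the kernel `e^{-δ|t|}`. -/
def expMass (δ : ℝ) : ENNReal := ∫⁻ t : ℝ, ENNReal.ofReal (Real.exp (-δ * |t|))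

theorem expMass_ne_top {δ : ℝ} (hδ : 0 < δ) : expMass δ ≠ ⊤ :=
  (integrable_exp_neg_mul_abs hδ).lintegral_lt_top.ne

theorem eLpNorm_expAvg_le {δ : ℝ} (hδ : 0 < δ) (f : L2) :
    eLpNorm (expAvg δ f) 2 volume ≤ expMass δ * eLpNorm f 2 volume := by
  have hK : Measurable (fun p : ℝ × ℝ => ENNReal.ofReal (Real.exp (-δ * |p.1 - p.2|))) :=
    ENNReal.measurable_ofReal.comp (Continuous.measurable (by fun_prop))
  have hf : Measurable (fun y => ‖f y‖ₑ) := (Lp.stronglyMeasurable f).enorm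
  have e2 : ∀ g : ℝ → ℂ, eLpNorm g 2 volume ^ 2 = ∫⁻ x, ‖g x‖ₑ ^ 2 := by
    intro g
    simpa using! eLpNorm_nnreal_pow_eq_lintegral (f := g) (μ := (volume : Measure ℝ))
      (p := 2) two_ne_zero
  have e2' : ∀ g : ℝ → ℝ, eLpNorm g 2 volume ^ 2 = ∫⁻ x, ‖g x‖ₑ ^ 2 := by
    intro g
    simpa using! eLpNorm_nnreal_pow_eq_lintegral (f := g) (μ := (volume : Measure ℝ))
      (p := 2) two_ne_zero
  have hsub : ∀ x, ∫⁻ y, ENNReal.ofReal (Real.exp (-δ * |x - y|)) = expMass δ := fun x =>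
    lintegral_sub_left_eq_self (fun t => ENNReal.ofReal (Real.exp (-δ * |t|))) x
  have hsub' : ∀ y, ∫⁻ x, ENNReal.ofReal (Real.exp (-δ * |x - y|)) = expMass δ := fun y =>
    lintegral_sub_right_eq_self (fun t => ENNReal.ofReal (Real.exp (-δ * |t|))) y
  -- Cauchy–Schwarz with respect to the measure `e^{-δ|x-y|} dy`
  have hx : ∀ x, ‖expAvg δ f x‖ₑ ^ 2
      ≤ expMass δ * ∫⁻ y, ENNReal.ofReal (Real.exp (-δ * |x - y|)) * ‖f y‖ₑ ^ 2 := by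
    intro x
    have h1 : ‖expAvg δ f x‖ₑ ≤ ∫⁻ y, ENNReal.ofReal (Real.exp (-(δ / 2) * |x - y|)) *
        (ENNReal.ofReal (Real.exp (-(δ / 2) * |x - y|)) * ‖f y‖ₑ) := by
      refine (enorm_integral_le_lintegral_enorm _).trans (le_of_eq ?_)
      congr 1; funext y
      rw [enorm_mul, enorm_norm, Real.enorm_eq_ofReal (Real.exp_pos _).le, ← mul_assoc,
        ← ENNReal.ofReal_mul (Real.exp_pos _).le, ← Real.exp_add]
      congr 3; ring
    have hm : Measurable (fun y => ENNReal.ofReal (Real.exp (-(δ / 2) * |x - y|))) :=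
      ENNReal.measurable_ofReal.comp (Continuous.measurable (by fun_prop))
    have h2 := ENNReal.lintegral_mul_le_Lp_mul_Lq volume Real.HolderConjugate.two_two
      hm.aemeasurable (hm.mul hf).aemeasurable
    have h3 : ∀ y, ENNReal.ofReal (Real.exp (-(δ / 2) * |x - y|)) ^ 2
        = ENNReal.ofReal (Real.exp (-δ * |x - y|)) := by
      intro y
      rw [← ENNReal.ofReal_pow (Real.exp_pos _).le, ← Real.exp_nat_mul]
      congr 2; push_cast; ring
    have h4 := pow_le_pow_left' (h1.trans h2) 2
    refine h4.trans (le_of_eq ?_)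
    have h5 : ∀ a : ENNReal, (a ^ (1 / (2 : ℝ))) ^ 2 = a := fun a => by
      rw [← ENNReal.rpow_natCast, ← ENNReal.rpow_mul]; norm_num
    simp only [Pi.mul_apply, mul_pow, h5, ENNReal.rpow_two, h3, hsub]
  have h6 : eLpNorm (expAvg δ f) 2 volume ^ 2 ≤ (expMass δ * eLpNorm f 2 volume) ^ 2 := by
    rw [e2', mul_pow, e2]
    calc _ ≤ ∫⁻ x, expMass δ * ∫⁻ y, ENNReal.ofReal (Real.exp (-δ * |x - y|)) * ‖f y‖ₑ ^ 2 :=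
          lintegral_mono hx
      _ = expMass δ * ∫⁻ y, ∫⁻ x, ENNReal.ofReal (Real.exp (-δ * |x - y|)) * ‖f y‖ₑ ^ 2 := by
          rw [lintegral_const_mul' _ _ (expMass_ne_top hδ), lintegral_lintegral_swap]
          exact (hK.mul ((hf.comp measurable_snd).pow_const 2)).aemeasurable
      _ = expMass δ ^ 2 * ∫⁻ y, ‖f y‖ₑ ^ 2 := by
          have : ∀ y, ∫⁻ x, ENNReal.ofReal (Real.exp (-δ * |x - y|)) * ‖f y‖ₑ ^ 2
              = expMass δ * ‖f y‖ₑ ^ 2 := by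
            intro y
            rw [lintegral_mul_const' _ _ (by simp), hsub']
          simp only [this]
          rw [lintegral_const_mul' _ _ (expMass_ne_top hδ), sq, mul_assoc]
  exact (ENNReal.pow_right_strictMono two_ne_zero).le_iff_le.1 h6

theorem memLp_expAvg {δ : ℝ} (hδ : 0 < δ) (f : L2) : MemLp (expAvg δ f) 2 volume :=
  ⟨aestronglyMeasurable_expAvg δ f, (eLpNorm_expAvg_le hδ f).trans_lt
    (ENNReal.mul_lt_top (expMass_ne_top hδ).lt_top (Lp.memLp f).2)⟩

/-! ### Green operators -/

/-- A fundamental system `U, V` (with derivatives `U', V'`) of `u'' = (q + m²) u` on the line, with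
Wronskian `U' V - U V' = w ≠ 0`, where `U` is the solution that is square integrable at `-∞`, `V` one
that is square integrable at `+∞`, and `U(x) V(y)`, `x ≤ y`, decays exponentially in `y - x`. -/
structure GreenPair (q U U' V V' : ℝ → ℂ) (m w : ℂ) (C δ : ℝ) : Prop where
  continuous_q : Continuous q
  hasDerivAt_U : ∀ x, HasDerivAt U (U' x) x
  hasDerivAt_U' : ∀ x, HasDerivAt U' ((q x + m ^ 2) * U x) x
  hasDerivAt_V : ∀ x, HasDerivAt V (V' x) x
  hasDerivAt_V' : ∀ x, HasDerivAt V' ((q x + m ^ 2) * V x) x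
  wronskian_eq : ∀ x, U' x * V x - U x * V' x = w
  w_ne_zero : w ≠ 0
  δ_pos : 0 < δ
  norm_mul_le : ∀ x y, x ≤ y → ‖U x‖ * ‖V y‖ ≤ C * Real.exp (-δ * (y - x))
  memLp_U : ∀ x, MemLp U 2 (volume.restrict (Set.Iic x))
  memLp_V : ∀ x, MemLp V 2 (volume.restrict (Set.Ioi x))
  bounded_U : ∃ K, ∀ᶠ x in atBot, ‖U x‖ ≤ K ∧ ‖U' x‖ ≤ K

/-- The function `x ↦ ∫ G(x,y) f(y) dy` with the Green kernel `G(x,y) = U(min) V(max) / w`. -/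
def greenFun (U V : ℝ → ℂ) (w : ℂ) (f : ℝ → ℂ) (x : ℝ) : ℂ :=
  w⁻¹ * (V x * (∫ y in Set.Iic x, U y * f y) + U x * ∫ y in Set.Ioi x, V y * f y)

/-- The derivative of `greenFun U V w f`. -/
def greenFunDeriv (U U' V V' : ℝ → ℂ) (w : ℂ) (f : ℝ → ℂ) (x : ℝ) : ℂ :=
  w⁻¹ * (V' x * (∫ y in Set.Iic x, U y * f y) + U' x * ∫ y in Set.Ioi x, V y * f y)

namespace GreenPair

variable {q U U' V V' : ℝ → ℂ} {m w : ℂ} {C δ : ℝ}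

theorem continuous_U (h : GreenPair q U U' V V' m w C δ) : Continuous U :=
  continuous_iff_continuousAt.2 fun x => (h.hasDerivAt_U x).continuousAt

theorem continuous_U' (h : GreenPair q U U' V V' m w C δ) : Continuous U' :=
  continuous_iff_continuousAt.2 fun x => (h.hasDerivAt_U' x).continuousAt

theorem continuous_V (h : GreenPair q U U' V V' m w C δ) : Continuous V :=
  continuous_iff_continuousAt.2 fun x => (h.hasDerivAt_V x).continuousAt

theorem continuous_V' (h : GreenPair q U U' V V' m w C δ) : Continuous V' :=
  continuous_iff_continuousAt.2 fun x => (h.hasDerivAt_V' x).continuousAt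

theorem integrableOn_U_mul (h : GreenPair q U U' V V' m w C δ) {f : ℝ → ℂ}
    (hf : MemLp f 2 volume) (x : ℝ) : IntegrableOn (fun y => U y * f y) (Set.Iic x) volume :=
  (h.memLp_U x).integrable_mul (hf.restrict _)

theorem integrableOn_V_mul (h : GreenPair q U U' V V' m w C δ) {f : ℝ → ℂ}
    (hf : MemLp f 2 volume) (x : ℝ) : IntegrableOn (fun y => V y * f y) (Set.Ioi x) volume :=
  (h.memLp_V x).integrable_mul (hf.restrict _)

theorem C_nonneg (h : GreenPair q U U' V V' m w C δ) : 0 ≤ C := by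
  have := (mul_nonneg (norm_nonneg _) (norm_nonneg _)).trans (h.norm_mul_le 0 0 le_rfl)
  simpa using this

theorem norm_greenFun_le (h : GreenPair q U U' V V' m w C δ) (f : L2) (x : ℝ) :
    ‖greenFun U V w f x‖ ≤ ‖w⁻¹‖ * C * expAvg δ f x := by
  have hi := integrable_expAvg h.δ_pos f x
  have h1 : ‖V x * ∫ y in Set.Iic x, U y * f y‖
      ≤ ∫ y in Set.Iic x, C * (Real.exp (-δ * |x - y|) * ‖f y‖) := by
    rw [← integral_const_mul]
    refine norm_integral_le_of_norm_le (hi.const_mul C).integrableOn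
      ((ae_restrict_iff' measurableSet_Iic).2 (ae_of_all _ fun y hy => ?_))
    have := h.norm_mul_le y x hy
    rw [norm_mul, norm_mul, ← mul_assoc, ← mul_assoc, mul_comm ‖V x‖,
      abs_of_nonneg (sub_nonneg.2 hy)]
    exact mul_le_mul_of_nonneg_right this (norm_nonneg _)
  have h2 : ‖U x * ∫ y in Set.Ioi x, V y * f y‖
      ≤ ∫ y in Set.Ioi x, C * (Real.exp (-δ * |x - y|) * ‖f y‖) := by
    rw [← integral_const_mul]
    refine norm_integral_le_of_norm_le (hi.const_mul C).integrableOn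
      ((ae_restrict_iff' measurableSet_Ioi).2 (ae_of_all _ fun y hy => ?_))
    have hy' : x ≤ y := le_of_lt hy
    have := h.norm_mul_le x y hy'
    rw [norm_mul, norm_mul, ← mul_assoc, ← mul_assoc, abs_sub_comm,
      abs_of_nonneg (sub_nonneg.2 hy')]
    exact mul_le_mul_of_nonneg_right this (norm_nonneg _)
  have h3 : (∫ y in Set.Iic x, C * (Real.exp (-δ * |x - y|) * ‖f y‖))
      + (∫ y in Set.Ioi x, C * (Real.exp (-δ * |x - y|) * ‖f y‖)) = C * expAvg δ f x := by
    rw [expAvg, ← integral_const_mul]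
    exact intervalIntegral.integral_Iic_add_Ioi (hi.const_mul C).integrableOn
      (hi.const_mul C).integrableOn
  rw [greenFun, norm_mul, mul_assoc]
  refine mul_le_mul_of_nonneg_left ?_ (norm_nonneg _)
  exact (norm_add_le _ _).trans ((add_le_add h1 h2).trans h3.le)

theorem integral_Iic_eq (h : GreenPair q U U' V V' m w C δ) {f : ℝ → ℂ}
    (hf : MemLp f 2 volume) (x : ℝ) : ∫ y in Set.Iic x, U y * f y
      = (∫ y in Set.Iic 0, U y * f y) + ∫ y in (0 : ℝ)..x, U y * f y := by
  rw [← intervalIntegral.integral_Iic_sub_Iic (h.integrableOn_U_mul hf 0)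
    (h.integrableOn_U_mul hf x)]
  ring

theorem integral_Ioi_eq (h : GreenPair q U U' V V' m w C δ) {f : ℝ → ℂ}
    (hf : MemLp f 2 volume) (x : ℝ) : ∫ y in Set.Ioi x, V y * f y
      = (∫ y in Set.Ioi 0, V y * f y) - ∫ y in (0 : ℝ)..x, V y * f y := by
  rw [← intervalIntegral.integral_Ioi_sub_Ioi' (h.integrableOn_V_mul hf 0)
    (h.integrableOn_V_mul hf x)]
  ring

theorem locallyIntegrable_mul {φ f : ℝ → ℂ} (hφ : Continuous φ) (hf : MemLp f 2 volume) :
    LocallyIntegrable (fun y => φ y * f y) volume :=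
  (locallyIntegrable_of_memLp hf).continuous_smul hφ

theorem absolutelyContinuous_Iic (h : GreenPair q U U' V V' m w C δ) {f : ℝ → ℂ}
    (hf : MemLp f 2 volume) (a b : ℝ) :
    AbsolutelyContinuousOnInterval (fun x => ∫ y in Set.Iic x, U y * f y) a b := by
  rw [show (fun x => ∫ y in Set.Iic x, U y * f y) = fun x => (∫ y in Set.Iic 0, U y * f y)
    + ∫ y in (0 : ℝ)..x, U y * f y from funext (h.integral_Iic_eq hf)]
  refine absolutelyContinuousOnInterval_of_dist_le (absolutelyContinuousOnInterval_primitive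
    (locallyIntegrable_mul h.continuous_U hf) 0 a b) fun x _ y _ => ?_
  rw [dist_add_left]

theorem absolutelyContinuous_Ioi (h : GreenPair q U U' V V' m w C δ) {f : ℝ → ℂ}
    (hf : MemLp f 2 volume) (a b : ℝ) :
    AbsolutelyContinuousOnInterval (fun x => ∫ y in Set.Ioi x, V y * f y) a b := by
  rw [show (fun x => ∫ y in Set.Ioi x, V y * f y) = fun x => (∫ y in Set.Ioi 0, V y * f y)
    - ∫ y in (0 : ℝ)..x, V y * f y from funext (h.integral_Ioi_eq hf)]
  refine absolutelyContinuousOnInterval_of_dist_le (absolutelyContinuousOnInterval_primitive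
    (locallyIntegrable_mul h.continuous_V hf) 0 a b) fun x _ y _ => ?_
  rw [dist_sub_left]

theorem ae_hasDerivAt_Iic (h : GreenPair q U U' V V' m w C δ) {f : ℝ → ℂ}
    (hf : MemLp f 2 volume) :
    ∀ᵐ x : ℝ, HasDerivAt (fun x => ∫ y in Set.Iic x, U y * f y) (U x * f x) x := by
  rw [show (fun x => ∫ y in Set.Iic x, U y * f y) = fun x => (∫ y in Set.Iic 0, U y * f y)
    + ∫ y in (0 : ℝ)..x, U y * f y from funext (h.integral_Iic_eq hf)]
  filter_upwards [LocallyIntegrable.ae_hasDerivAt_integral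
    (locallyIntegrable_mul h.continuous_U hf)] with x hx
  exact (hx 0).const_add _

theorem ae_hasDerivAt_Ioi (h : GreenPair q U U' V V' m w C δ) {f : ℝ → ℂ}
    (hf : MemLp f 2 volume) :
    ∀ᵐ x : ℝ, HasDerivAt (fun x => ∫ y in Set.Ioi x, V y * f y) (-(V x * f x)) x := by
  rw [show (fun x => ∫ y in Set.Ioi x, V y * f y) = fun x => (∫ y in Set.Ioi 0, V y * f y)
    - ∫ y in (0 : ℝ)..x, V y * f y from funext (h.integral_Ioi_eq hf)]
  filter_upwards [LocallyIntegrable.ae_hasDerivAt_integral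
    (locallyIntegrable_mul h.continuous_V hf)] with x hx
  exact (hx 0).const_sub _

/-- Both `V A + U B` and `V' A + U' B`, with `A, B` the two integrals in the Green function, are
absolutely continuous, as products of such functions. -/
theorem absolutelyContinuous_combination (h : GreenPair q U U' V V' m w C δ) {f : ℝ → ℂ}
    (hf : MemLp f 2 volume) {φ ψ φ' ψ' : ℝ → ℂ} (hφ : ∀ x, HasDerivAt φ (φ' x) x)
    (hψ : ∀ x, HasDerivAt ψ (ψ' x) x) (cφ : Continuous φ') (cψ : Continuous ψ') (a b : ℝ) :
    AbsolutelyContinuousOnInterval (fun x => w⁻¹ * (φ x * (∫ y in Set.Iic x, U y * f y)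
      + ψ x * ∫ y in Set.Ioi x, V y * f y)) a b :=
  (((absolutelyContinuousOnInterval_of_hasDerivAt hφ cφ a b).smul
    (h.absolutelyContinuous_Iic hf a b)).add
    ((absolutelyContinuousOnInterval_of_hasDerivAt hψ cψ a b).smul
    (h.absolutelyContinuous_Ioi hf a b))).const_smul w⁻¹

theorem hasDerivAt_greenFun (h : GreenPair q U U' V V' m w C δ) {f : ℝ → ℂ}
    (hf : MemLp f 2 volume) (x : ℝ) :
    HasDerivAt (greenFun U V w f) (greenFunDeriv U U' V V' w f x) x := by
  have cq := h.continuous_q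
  have cU := h.continuous_U
  have cV := h.continuous_V
  refine hasDerivAt_of_ae_hasDerivAt_of_continuous
    (h.absolutelyContinuous_combination hf h.hasDerivAt_V h.hasDerivAt_U h.continuous_V'
      h.continuous_U')
    (continuous_of_absolutelyContinuous (h.absolutelyContinuous_combination hf h.hasDerivAt_V'
      h.hasDerivAt_U' (by fun_prop) (by fun_prop))) ?_ x
  filter_upwards [h.ae_hasDerivAt_Iic hf, h.ae_hasDerivAt_Ioi hf] with x hA hB
  have := (((h.hasDerivAt_V x).mul hA).add ((h.hasDerivAt_U x).mul hB)).const_mul w⁻¹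
  refine this.congr_deriv ?_
  ring

theorem deriv_greenFun (h : GreenPair q U U' V V' m w C δ) {f : ℝ → ℂ}
    (hf : MemLp f 2 volume) : deriv (greenFun U V w f) = greenFunDeriv U U' V V' w f :=
  funext fun x => (h.hasDerivAt_greenFun hf x).deriv

theorem greenFun_mem_AC1 (h : GreenPair q U U' V V' m w C δ) {f : ℝ → ℂ}
    (hf : MemLp f 2 volume) : greenFun U V w f ∈ AC1 := by
  have cq := h.continuous_q
  have cU := h.continuous_U
  have cV := h.continuous_V
  refine ⟨fun x => (h.hasDerivAt_greenFun hf x).differentiableAt, fun a b => ?_⟩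
  rw [h.deriv_greenFun hf]
  exact h.absolutelyContinuous_combination hf h.hasDerivAt_V' h.hasDerivAt_U' (by fun_prop)
    (by fun_prop) a b

/-- The Green function solves `-u'' + q u + m² u = f`. -/
theorem schr_greenFun (h : GreenPair q U U' V V' m w C δ) {f : ℝ → ℂ}
    (hf : MemLp f 2 volume) :
    schr q (greenFun U V w f) =ᵐ[volume] f - m ^ 2 • greenFun U V w f := by
  filter_upwards [h.ae_hasDerivAt_Iic hf, h.ae_hasDerivAt_Ioi hf] with x hA hB
  have := (((h.hasDerivAt_V' x).mul hA).add ((h.hasDerivAt_U' x).mul hB)).const_mul w⁻¹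
  have hd : deriv (greenFunDeriv U U' V V' w f) x = _ := this.deriv
  have e := inv_mul_cancel₀ h.w_ne_zero
  rw [schr, h.deriv_greenFun hf, hd]
  simp only [greenFun, Pi.sub_apply, Pi.smul_apply, smul_eq_mul]
  rw [← h.wronskian_eq x] at e ⊢
  linear_combination f x * e

theorem memLp_greenFun (h : GreenPair q U U' V V' m w C δ) (f : L2) :
    MemLp (greenFun U V w f) 2 volume :=
  (memLp_expAvg h.δ_pos f).of_le_mul
    (AC1.continuous (h.greenFun_mem_AC1 (Lp.memLp f))).aestronglyMeasurable
    (ae_of_all _ fun x => by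
      rw [Real.norm_of_nonneg (expAvg_nonneg _ _ _)]
      exact h.norm_greenFun_le f x)

theorem greenFun_add (h : GreenPair q U U' V V' m w C δ) (f g : L2) :
    greenFun U V w ((f + g : L2) : ℝ → ℂ) = greenFun U V w f + greenFun U V w g := by
  funext x
  have e1 : ∫ y in Set.Iic x, U y * (f + g : L2) y
      = (∫ y in Set.Iic x, U y * f y) + ∫ y in Set.Iic x, U y * g y := by
    rw [← integral_add (h.integrableOn_U_mul (Lp.memLp f) x) (h.integrableOn_U_mul (Lp.memLp g) x)]
    refine integral_congr_ae (ae_restrict_of_ae ?_)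
    filter_upwards [Lp.coeFn_add f g] with y hy
    rw [hy, Pi.add_apply, mul_add]
  have e2 : ∫ y in Set.Ioi x, V y * (f + g : L2) y
      = (∫ y in Set.Ioi x, V y * f y) + ∫ y in Set.Ioi x, V y * g y := by
    rw [← integral_add (h.integrableOn_V_mul (Lp.memLp f) x) (h.integrableOn_V_mul (Lp.memLp g) x)]
    refine integral_congr_ae (ae_restrict_of_ae ?_)
    filter_upwards [Lp.coeFn_add f g] with y hy
    rw [hy, Pi.add_apply, mul_add]
  simp only [greenFun, Pi.add_apply, e1, e2]
  ring

theorem greenFun_smul (c : ℂ) (f : L2) :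
    greenFun U V w ((c • f : L2) : ℝ → ℂ) = c • greenFun U V w f := by
  funext x
  have e : ∀ (s : Set ℝ) (φ : ℝ → ℂ), ∫ y in s, φ y * (c • f : L2) y
      = c * ∫ y in s, φ y * f y := by
    intro s φ
    rw [← integral_const_mul]
    refine integral_congr_ae (ae_restrict_of_ae ?_)
    filter_upwards [Lp.coeFn_smul c f] with y hy
    rw [hy, Pi.smul_apply, smul_eq_mul]; ring
  simp only [greenFun, Pi.smul_apply, e, smul_eq_mul]
  ring

/-- The Green operator on `L²(ℝ)`, bounded by the Schur test. -/
def op (h : GreenPair q U U' V V' m w C δ) : L2 →L[ℂ] L2 :=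
  LinearMap.mkContinuous
    { toFun := fun f => (h.memLp_greenFun f).toLp _
      map_add' := fun f g => by
        rw [← MemLp.toLp_add, MemLp.toLp_eq_toLp_iff, h.greenFun_add]
      map_smul' := fun c f => by
        rw [RingHom.id_apply, ← MemLp.toLp_const_smul, MemLp.toLp_eq_toLp_iff, greenFun_smul] }
    (‖w⁻¹‖ * C * (expMass δ).toReal) fun f => by
      have hC := h.C_nonneg
      have h1 : eLpNorm (greenFun U V w f) 2 volume
          ≤ ENNReal.ofReal (‖w⁻¹‖ * C) * eLpNorm (expAvg δ f) 2 volume :=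
        eLpNorm_le_mul_eLpNorm_of_ae_le_mul (ae_of_all _ fun x => by
          rw [Real.norm_of_nonneg (expAvg_nonneg _ _ _)]
          exact h.norm_greenFun_le f x) 2
      have h2 := h1.trans (mul_le_mul_right (eLpNorm_expAvg_le h.δ_pos f) _)
      simp only [LinearMap.coe_mk, AddHom.coe_mk, Lp.norm_def]
      rw [eLpNorm_congr_ae (h.memLp_greenFun f).coeFn_toLp]
      refine (ENNReal.toReal_mono (ENNReal.mul_ne_top ENNReal.ofReal_ne_top
        (ENNReal.mul_ne_top (expMass_ne_top h.δ_pos) (Lp.memLp f).2.ne)) h2).trans (le_of_eq ?_)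
      rw [ENNReal.toReal_mul, ENNReal.toReal_mul, ENNReal.toReal_ofReal (by positivity)]
      ring

theorem isRep_op (h : GreenPair q U U' V V' m w C δ) (f : L2) :
    IsRep (h.op f) (greenFun U V w f) :=
  ⟨h.greenFun_mem_AC1 (Lp.memLp f), (h.memLp_greenFun f).coeFn_toLp⟩

theorem op_mem_maxDomain (h : GreenPair q U U' V V' m w C δ) (f : L2) :
    h.op f ∈ maxDomain q :=
  ⟨_, h.isRep_op f, ((Lp.memLp f).sub ((h.memLp_greenFun f).const_smul _)).ae_eq
    (h.schr_greenFun (Lp.memLp f)).symm⟩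

theorem maxRealization_op (h : GreenPair q U U' V V' m w C δ) (f : L2) :
    maxRealization q ⟨h.op f, h.op_mem_maxDomain f⟩ - (-m ^ 2) • h.op f = f := by
  have h1 : (maxRealization q ⟨h.op f, h.op_mem_maxDomain f⟩ : L2)
      =ᵐ[volume] schr q (rep (h.op f)) :=
    MemLp.coeFn_toLp (memLp_schr_rep (h.op_mem_maxDomain f))
  rw [(h.isRep_op f).rep_eq] at h1
  apply Lp.ext
  filter_upwards [Lp.coeFn_sub (maxRealization q ⟨h.op f, h.op_mem_maxDomain f⟩)
    ((-m ^ 2) • h.op f), h1, Lp.coeFn_smul (-m ^ 2) (h.op f), (h.isRep_op f).2,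
    h.schr_greenFun (Lp.memLp f)] with x e1 e2 e3 e4 e5
  rw [e1, Pi.sub_apply, e2, e3, Pi.smul_apply, e4, e5]
  simp

/-- `W(V, R f) → 0` at `+∞` for the Green operator `R`. -/
theorem tendsto_wronskian_greenFun (h : GreenPair q U U' V V' m w C δ) {f : ℝ → ℂ}
    (hf : MemLp f 2 volume) : Tendsto (wronskian V (greenFun U V w f)) atTop (𝓝 0) := by
  have e : wronskian V (greenFun U V w f) = fun x => ∫ y in Set.Ioi x, V y * f y := by
    funext x
    have e := inv_mul_cancel₀ h.w_ne_zero
    rw [wronskian, h.deriv_greenFun hf, (h.hasDerivAt_V x).deriv, greenFunDeriv, greenFun]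
    rw [← h.wronskian_eq x] at e ⊢
    linear_combination (∫ y in Set.Ioi x, V y * f y) * e
  rw [e]
  have h1 := (intervalIntegral_tendsto_integral_Ioi 0 (h.integrableOn_V_mul hf 0)
    tendsto_id).const_sub (∫ y in Set.Ioi 0, V y * f y)
  rw [sub_self] at h1
  refine h1.congr fun x => ?_
  rw [h.integral_Ioi_eq hf x]; rfl

end GreenPair

/-- For `f` in the maximal domain, `-u'' + q u = T f` almost everywhere, for the representative
`u` of `f`. -/
theorem ae_schr_rep {q : ℝ → ℂ} (f : (maxRealization q).domain) :
    (maxRealization q f : L2) =ᵐ[volume] schr q (rep (f : L2)) :=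
  MemLp.coeFn_toLp (memLp_schr_rep f.2)

theorem integrable_norm_sq_rep {q : ℝ → ℂ} {f : L2} (hf : f ∈ maxDomain q) :
    Integrable (fun x => ‖rep f x‖ ^ 2) volume := by
  have h : MemLp (rep f) 2 volume := (Lp.memLp f).ae_eq (isRep_rep hf).2
  exact (memLp_two_iff_integrable_sq_norm h.1).1 h

/-- An element of the maximal domain has vanishing Wronskian at `+∞` with every function that is
bounded there together with its derivative, as soon as the Wronskian converges. -/
theorem wronskian_limit_atTop_eq_zero {q φ φ' : ℝ → ℂ} {K : ℝ} {L : ℂ} {f : L2}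
    (hf : f ∈ maxDomain q)
    (hφ : ∀ x, HasDerivAt φ (φ' x) x) (hφ' : Continuous φ')
    (hK : ∀ᶠ x in atTop, ‖φ x‖ ≤ K ∧ ‖φ' x‖ ≤ K)
    (hL : Tendsto (fun x => φ x * deriv (rep f) x - φ' x * rep f x) atTop (𝓝 L)) : L = 0 :=
  wronskian_limit_eq_zero eventually_unit_interval_atTop hφ hφ'
    (fun x => ((isRep_rep hf).1.1 x).hasDerivAt) (continuous_deriv_of_mem_AC1 (isRep_rep hf).1) hK
    (tendsto_integral_unit_interval_atTop (integrable_norm_sq_rep hf)) hL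

theorem wronskian_limit_atBot_eq_zero {q φ φ' : ℝ → ℂ} {K : ℝ} {L : ℂ} {f : L2}
    (hf : f ∈ maxDomain q)
    (hφ : ∀ x, HasDerivAt φ (φ' x) x) (hφ' : Continuous φ')
    (hK : ∀ᶠ x in atBot, ‖φ x‖ ≤ K ∧ ‖φ' x‖ ≤ K)
    (hL : Tendsto (fun x => φ x * deriv (rep f) x - φ' x * rep f x) atBot (𝓝 L)) : L = 0 :=
  wronskian_limit_eq_zero eventually_unit_interval_atBot hφ hφ'
    (fun x => ((isRep_rep hf).1.1 x).hasDerivAt) (continuous_deriv_of_mem_AC1 (isRep_rep hf).1) hK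
    (tendsto_integral_unit_interval_atBot (integrable_norm_sq_rep hf)) hL

/-- The Lagrange identity for a solution `φ` of the homogeneous equation. -/
theorem integral_mul_maxRealization {q φ φ' : ℝ → ℂ} {m : ℂ} (hq : Continuous q)
    (hφ : ∀ x, HasDerivAt φ (φ' x) x) (hφ' : ∀ x, HasDerivAt φ' ((q x + m ^ 2) * φ x) x)
    (f : (maxRealization q).domain) (a b : ℝ) :
    ∫ t in a..b, φ t * (maxRealization q f - (-m ^ 2) • (f : L2) : L2) t
      = (φ a * deriv (rep (f : L2)) a - φ' a * rep (f : L2) a)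
        - (φ b * deriv (rep (f : L2)) b - φ' b * rep (f : L2) b) := by
  have cφ : Continuous φ := continuous_iff_continuousAt.2 fun x => (hφ x).continuousAt
  have hr := isRep_rep f.2
  have := integral_wronskian hφ hφ' (by fun_prop) hr.1
    (g := fun t => -(φ t * (maxRealization q f - (-m ^ 2) • (f : L2) : L2) t))
    ((GreenPair.locallyIntegrable_mul cφ (Lp.memLp _)).neg) (by
      filter_upwards [Lp.coeFn_sub (maxRealization q f) ((-m ^ 2) • (f : L2)), ae_schr_rep f,
        Lp.coeFn_smul (-m ^ 2) (f : L2), hr.2] with x e1 e2 e3 e4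
      rw [e1, Pi.sub_apply, e2, e3, Pi.smul_apply, e4, schr, smul_eq_mul]
      ring) a b
  rw [intervalIntegral.integral_neg] at this
  linear_combination -this

namespace GreenPair

variable {q U U' V V' : ℝ → ℂ} {m w : ℂ} {C δ : ℝ}

/-- The Green operator is a left inverse on the elements of the maximal domain that satisfy the
boundary condition set by `V`: both boundary terms in the Lagrange identity vanish. -/
theorem op_maxRealization (h : GreenPair q U U' V V' m w C δ) (f : (maxRealization q).domain)
    (hbc : Tendsto (wronskian V (rep (f : L2))) atTop (𝓝 0)) :
    h.op (maxRealization q f - (-m ^ 2) • (f : L2)) = f := by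
  set g : L2 := maxRealization q f - (-m ^ 2) • (f : L2) with hg
  have hgL := Lp.memLp g
  have hW : ∀ x, wronskian V (rep (f : L2)) x
      = V x * deriv (rep (f : L2)) x - V' x * rep (f : L2) x := fun x => by
    rw [wronskian, (h.hasDerivAt_V x).deriv]
  have hB : ∀ x, ∫ y in Set.Ioi x, V y * g y
      = V x * deriv (rep (f : L2)) x - V' x * rep (f : L2) x := by
    intro x
    refine tendsto_nhds_unique
      (intervalIntegral_tendsto_integral_Ioi x (h.integrableOn_V_mul hgL x) tendsto_id) ?_
    have h1 := hbc.const_sub (V x * deriv (rep (f : L2)) x - V' x * rep (f : L2) x)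
    rw [sub_zero] at h1
    refine h1.congr fun b => ?_
    rw [id, integral_mul_maxRealization h.continuous_q h.hasDerivAt_V h.hasDerivAt_V' f x b, hW]
  obtain ⟨K, hK⟩ := h.bounded_U
  have hA : ∀ x, ∫ y in Set.Iic x, U y * g y
      = -(U x * deriv (rep (f : L2)) x - U' x * rep (f : L2) x) := by
    intro x
    have h1 := intervalIntegral_tendsto_integral_Iic x (h.integrableOn_U_mul hgL x) tendsto_id
    have h2 := (h1.add_const (U x * deriv (rep (f : L2)) x - U' x * rep (f : L2) x))
    have h3 := wronskian_limit_atBot_eq_zero f.2 h.hasDerivAt_U h.continuous_U' hK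
      (h2.congr fun a => by
        rw [id, integral_mul_maxRealization h.continuous_q h.hasDerivAt_U h.hasDerivAt_U' f a x,
          sub_add_cancel])
    linear_combination h3
  apply Lp.ext
  filter_upwards [(h.isRep_op g).2, (isRep_rep f.2).2] with x e1 e2
  have e := inv_mul_cancel₀ h.w_ne_zero
  rw [e1, e2, greenFun, hA, hB]
  rw [← h.wronskian_eq x] at e ⊢
  linear_combination rep (f : L2) x * e

/-- The Green operator is the resolvent at `-m²` of the realization with the boundary condition set
by `V`. -/
theorem isResolventAt_op (h : GreenPair q U U' V V' m w C δ) :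
    IsResolventAt (bcRealization q V) (-m ^ 2) h.op := by
  constructor
  · intro f
    have hb : h.op f ∈ bcDomain q V := ⟨h.op_mem_maxDomain f, by
      rw [(h.isRep_op f).rep_eq]
      exact h.tendsto_wronskian_greenFun (Lp.memLp f)⟩
    refine ⟨⟨hb, h.op_mem_maxDomain f⟩, ?_⟩
    have e : bcRealization q V ⟨h.op f, ⟨hb, h.op_mem_maxDomain f⟩⟩
      = maxRealization q ⟨h.op f, h.op_mem_maxDomain f⟩ := LinearPMap.domRestrict_apply rfl
    rw [e]
    exact h.maxRealization_op f
  · intro u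
    have hu : (u : L2) ∈ bcDomain q V := u.2.1
    have e : bcRealization q V u = maxRealization q ⟨(u : L2), hu.1⟩ :=
      LinearPMap.domRestrict_apply rfl
    rw [e]
    exact h.op_maxRealization ⟨(u : L2), hu.1⟩ hu.2

/-- If `V` and `V'` are bounded at `+∞`, the boundary condition set by `V` is void. -/
theorem bcRealization_eq_maxRealization (h : GreenPair q U U' V V' m w C δ) {K : ℝ}
    (hK : ∀ᶠ x in atTop, ‖V x‖ ≤ K ∧ ‖V' x‖ ≤ K) : bcRealization q V = maxRealization q := by
  have hd : ∀ f ∈ maxDomain q, f ∈ bcDomain q V := by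
    intro f hf
    refine ⟨hf, ?_⟩
    set f' : (maxRealization q).domain := ⟨f, hf⟩
    set g : L2 := maxRealization q f' - (-m ^ 2) • (f' : L2) with hg
    have h1 := (intervalIntegral_tendsto_integral_Ioi 0 (h.integrableOn_V_mul (Lp.memLp g) 0)
      tendsto_id).const_sub (V 0 * deriv (rep f) 0 - V' 0 * rep f 0)
    have h2 := h1.congr (f₂ := fun b => V b * deriv (rep f) b - V' b * rep f b) fun b => by
      rw [id, integral_mul_maxRealization h.continuous_q h.hasDerivAt_V h.hasDerivAt_V' f' 0 b]
      ring
    rw [wronskian_limit_atTop_eq_zero hf h.hasDerivAt_V h.continuous_V' hK h2] at h2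
    refine h2.congr fun x => ?_
    rw [wronskian, (h.hasDerivAt_V x).deriv]
  refine LinearPMap.ext (le_antisymm inf_le_right fun f hf => ⟨hd f hf, hf⟩) ?_
  intro x hx hx'
  exact LinearPMap.domRestrict_apply rfl

/-- If `V` differs from a multiple of `H` by a function `E` that is bounded at `+∞` together with
its derivative, where `H` is square integrable at `+∞` and solves the homogeneous equation up to a
multiple of itself, then `V` and `H` set the same boundary condition. -/
theorem bcRealization_congr (h : GreenPair q U U' V V' m w C δ) {H H' : ℝ → ℂ} {c d : ℂ} {K : ℝ}
    (hc : c ≠ 0)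
    (hH : ∀ x, HasDerivAt H (H' x) x) (hH' : ∀ x, HasDerivAt H' ((q x + d) * H x) x)
    (hH2 : MemLp H 2 (volume.restrict (Set.Ioi 0)))
    (hK : ∀ᶠ x in atTop, ‖V x - c * H x‖ ≤ K ∧ ‖V' x - c * H' x‖ ≤ K) :
    bcRealization q V = bcRealization q H := by
  have cq := h.continuous_q
  have cV := h.continuous_V
  have cV' := h.continuous_V'
  have cH : Continuous H := continuous_iff_continuousAt.2 fun x => (hH x).continuousAt
  have cH' : Continuous H' := continuous_iff_continuousAt.2 fun x => (hH' x).continuousAt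
  have key : ∀ f ∈ maxDomain q, Tendsto
      (fun x => wronskian V (rep f) x - c * wronskian H (rep f) x) atTop (𝓝 0) := by
    intro f hf
    set f' : (maxRealization q).domain := ⟨f, hf⟩
    have hr := isRep_rep hf
    have hrL : MemLp (rep f) 2 volume := (Lp.memLp f).ae_eq hr.2
    set g : L2 := maxRealization q f' - (-m ^ 2) • (f' : L2) with hg
    -- the derivative of `W(V - c H, u)`, in which the growing potential has cancelled
    set G : ℝ → ℂ := fun t => -(V t * g t) + c * (H t * g t) + c * (d - m ^ 2) * (H t * rep f t)
      with hG
    have hGloc : LocallyIntegrable G volume :=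
      ((GreenPair.locallyIntegrable_mul cV (Lp.memLp g)).neg.add
        ((GreenPair.locallyIntegrable_mul cH (Lp.memLp g)).smul c)).add
        ((GreenPair.locallyIntegrable_mul cH hrL).smul (c * (d - m ^ 2)))
    have hGint : IntegrableOn G (Set.Ioi 0) volume :=
      ((h.integrableOn_V_mul (Lp.memLp g) 0).neg.add
        (Integrable.const_mul (hH2.integrable_mul ((Lp.memLp g).restrict _)) c)).add
        (Integrable.const_mul (hH2.integrable_mul (hrL.restrict _)) (c * (d - m ^ 2)))
    have hE : ∀ x, HasDerivAt (fun x => V x - c * H x) (V' x - c * H' x) x := fun x =>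
      (h.hasDerivAt_V x).sub ((hH x).const_mul c)
    have hE' : ∀ x, HasDerivAt (fun x => V' x - c * H' x)
        ((q x + m ^ 2) * V x - c * ((q x + d) * H x)) x := fun x =>
      (h.hasDerivAt_V' x).sub ((hH' x).const_mul c)
    have hint := integral_wronskian hE hE' (by fun_prop) hr.1 hGloc (by
      filter_upwards [Lp.coeFn_sub (maxRealization q f') ((-m ^ 2) • (f' : L2)), ae_schr_rep f',
        Lp.coeFn_smul (-m ^ 2) (f' : L2), hr.2] with x e1 e2 e3 e4
      have eg : g x = schr q (rep f) x + m ^ 2 * rep f x := by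
        rw [hg, e1, Pi.sub_apply, e2, e3, Pi.smul_apply, e4, smul_eq_mul]; ring
      rw [hG]
      simp only [eg, schr]
      ring)
    have h1 := (intervalIntegral_tendsto_integral_Ioi 0 hGint tendsto_id).add_const
      ((V 0 - c * H 0) * deriv (rep f) 0 - (V' 0 - c * H' 0) * rep f 0)
    have h2 := h1.congr (f₂ := fun b => (V b - c * H b) * deriv (rep f) b
      - (V' b - c * H' b) * rep f b) fun b => by rw [id, hint]; ring
    rw [wronskian_limit_atTop_eq_zero hf hE (by fun_prop) hK h2] at h2
    refine h2.congr fun x => ?_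
    rw [wronskian, wronskian, (h.hasDerivAt_V x).deriv, (hH x).deriv]
    ring
  have hdom : bcDomain q V = bcDomain q H := by
    ext f
    refine and_congr_right fun hf => ⟨fun hV => ?_, fun hHt => ?_⟩
    · have := (hV.sub (key f hf)).const_mul c⁻¹
      rw [sub_zero, mul_zero] at this
      refine this.congr fun x => ?_
      field_simp
      ring
    · have := (hHt.const_mul c).add (key f hf)
      rw [mul_zero, add_zero] at this
      exact this.congr fun x => by ring
  rw [bcRealization, bcRealization, hdom]

end GreenPair

/-! ### Complex powers on the closed right half-plane -/

theorem norm_cpow_le_exp_mul_rpow {w : ℂ} (hw : w ≠ 0) (b : ℂ) :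
    ‖w ^ b‖ ≤ Real.exp (Real.pi * |b.im|) * ‖w‖ ^ b.re := by
  rw [Complex.norm_cpow_of_ne_zero hw, div_eq_mul_inv, ← Real.exp_neg, mul_comm]
  refine mul_le_mul_of_nonneg_right (Real.exp_le_exp.2 ?_) (Real.rpow_nonneg (norm_nonneg _) _)
  have h1 := Complex.abs_arg_le_pi w
  have h2 : |Complex.arg w * b.im| ≤ Real.pi * |b.im| := by
    rw [abs_mul]; exact mul_le_mul_of_nonneg_right h1 (abs_nonneg _)
  exact (neg_le_abs _).trans h2

theorem norm_le_norm_add_ofReal {z : ℂ} (hz : 0 ≤ z.re) {s : ℝ} (hs : 0 ≤ s) :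
    ‖z‖ ≤ ‖z + (s : ℂ)‖ := by
  rw [← sq_le_sq₀ (norm_nonneg _) (norm_nonneg _), ← Complex.normSq_eq_norm_sq,
    ← Complex.normSq_eq_norm_sq, Complex.normSq_apply, Complex.normSq_apply]
  simp only [Complex.add_re, Complex.ofReal_re, Complex.add_im, Complex.ofReal_im, add_zero]
  nlinarith [mul_nonneg hz hs]

theorem le_norm_add_ofReal {z : ℂ} (hz : 0 ≤ z.re) {s : ℝ} : s ≤ ‖z + (s : ℂ)‖ :=
  calc s ≤ (z + (s : ℂ)).re := by simpa using hz
    _ ≤ _ := Complex.re_le_norm _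

theorem add_ofReal_ne_zero {z : ℂ} (hz : 0 ≤ z.re) {s : ℝ} (hs : 0 < s) : z + (s : ℂ) ≠ 0 :=
  norm_pos_iff.1 (hs.trans_le (le_norm_add_ofReal hz))

theorem add_ofReal_mem_slitPlane {z : ℂ} (hz : 0 ≤ z.re) {s : ℝ} (hs : 0 < s) :
    z + (s : ℂ) ∈ Complex.slitPlane := by
  left; simpa using add_pos_of_nonneg_of_pos hz hs

theorem mem_slitPlane_of_re_nonneg {z : ℂ} (hz : 0 ≤ z.re) (hz0 : z ≠ 0) :
    z ∈ Complex.slitPlane := by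
  rw [Complex.mem_slitPlane_iff]
  rcases hz.lt_or_eq with h | h
  · exact Or.inl h
  · exact Or.inr fun hi => hz0 (Complex.ext h.symm hi)

theorem hasDerivAt_cpow_const_of_real {f : ℝ → ℂ} {f' : ℂ} {x : ℝ} (hf : HasDerivAt f f' x)
    (hx : f x ∈ Complex.slitPlane) (c : ℂ) :
    HasDerivAt (fun t => f t ^ c) (c * f x ^ (c - 1) * f') x := by
  have h : HasDerivAt (fun w : ℂ => w ^ c) (c * f x ^ (c - 1)) (f x) := by
    simpa using (hasDerivAt_id (f x)).cpow_const (c := c) hx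
  exact h.comp x hf

/-- On the closed right half-plane, `(z + s)^b` is comparable to `z^b`, with a polynomial loss
in `s / |z|`. -/
theorem norm_add_cpow_le {z : ℂ} (hz : 0 ≤ z.re) (hz0 : z ≠ 0) {s : ℝ} (hs : 0 ≤ s) (b : ℂ) :
    ‖(z + (s : ℂ)) ^ b‖
      ≤ Real.exp (Real.pi * |b.im|) * (‖z‖ ^ b.re * (1 + s / ‖z‖) ^ |b.re|) := by
  have hzp : 0 < ‖z‖ := norm_pos_iff.2 hz0
  have h1 := norm_le_norm_add_ofReal hz hs
  have hw : z + (s : ℂ) ≠ 0 := norm_pos_iff.1 (hzp.trans_le h1)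
  refine (norm_cpow_le_exp_mul_rpow hw b).trans
    (mul_le_mul_of_nonneg_left ?_ (Real.exp_pos _).le)
  have h2 : ‖z + (s : ℂ)‖ ≤ ‖z‖ + s := by
    refine (norm_add_le _ _).trans ?_
    rw [Complex.norm_real, Real.norm_of_nonneg hs]
  have h3 : ‖z + (s : ℂ)‖ = ‖z‖ * (‖z + (s : ℂ)‖ / ‖z‖) := by field_simp
  have h4 : 1 ≤ ‖z + (s : ℂ)‖ / ‖z‖ := (one_le_div hzp).2 h1
  have h5 : ‖z + (s : ℂ)‖ / ‖z‖ ≤ 1 + s / ‖z‖ := by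
    rw [div_le_iff₀ hzp]; field_simp; linarith
  rw [h3, Real.mul_rpow hzp.le (by linarith)]
  refine mul_le_mul_of_nonneg_left ?_ (Real.rpow_nonneg hzp.le _)
  exact (Real.rpow_le_rpow_of_exponent_le h4 (le_abs_self _)).trans
    (Real.rpow_le_rpow (by linarith) h5 (abs_nonneg _))

/-! ### The Laplace integral of Macdonald's function -/

/-- The weight `e^{-t} t^a` of the Gamma integral. -/
def gammaWeight (a : ℂ) (t : ℝ) : ℂ := ((-t).exp : ℝ) * (t : ℂ) ^ a

theorem norm_gammaWeight {a : ℂ} {t : ℝ} (ht : 0 < t) :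
    ‖gammaWeight a t‖ = (-t).exp * t ^ a.re := by
  rw [gammaWeight, norm_mul, Complex.norm_real, Real.norm_of_nonneg (Real.exp_pos _).le,
    Complex.norm_cpow_eq_rpow_re_of_pos ht]

theorem continuousOn_gammaWeight (a : ℂ) : ContinuousOn (gammaWeight a) (Set.Ioi 0) := by
  intro t ht
  refine ContinuousAt.continuousWithinAt (ContinuousAt.mul (by fun_prop) ?_)
  exact Complex.continuousAt_ofReal_cpow_const t a (Or.inr (ne_of_gt ht))

theorem integrableOn_exp_mul_rpow {σ : ℝ} (hσ : -1 < σ) :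
    IntegrableOn (fun t : ℝ => (-t).exp * t ^ σ) (Set.Ioi 0) volume := by
  have := Real.GammaIntegral_convergent (s := σ + 1) (by linarith)
  simpa using this

theorem integrableOn_exp_mul_rpow_mul {σ N : ℝ} (hσ : -1 < σ) (hN : 0 ≤ N) :
    IntegrableOn (fun t : ℝ => (-t).exp * t ^ σ * (1 + t) ^ N) (Set.Ioi 0) volume := by
  have h : IntegrableOn (fun t : ℝ => 2 ^ N * ((-t).exp * t ^ σ + (-t).exp * t ^ (σ + N)))
      (Set.Ioi 0) volume :=
    ((integrableOn_exp_mul_rpow hσ).add (integrableOn_exp_mul_rpow (by linarith))).const_mul _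
  refine Integrable.mono' h ?_ ((ae_restrict_iff' measurableSet_Ioi).2 (ae_of_all _ ?_))
  · refine ContinuousOn.aestronglyMeasurable (fun t ht => ?_) measurableSet_Ioi
    have ht' : 0 < t := ht
    refine ContinuousAt.continuousWithinAt ?_
    exact ((by fun_prop : ContinuousAt (fun t : ℝ => (-t).exp) t).mul
      (Real.continuousAt_rpow_const _ _ (Or.inl ht'.ne'))).mul
      ((by fun_prop : ContinuousAt (fun t : ℝ => 1 + t) t).rpow_const (Or.inr hN))
  · intro t ht
    have ht' : 0 < t := ht
    have h1 : (1 + t) ^ N ≤ 2 ^ N * (1 + t ^ N) := by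
      rcases le_total t 1 with h | h
      · calc (1 + t) ^ N ≤ 2 ^ N := Real.rpow_le_rpow (by linarith) (by linarith) hN
          _ ≤ 2 ^ N * (1 + t ^ N) := le_mul_of_one_le_right (by positivity)
            (by linarith [Real.rpow_nonneg ht'.le N])
      · calc (1 + t) ^ N ≤ (2 * t) ^ N := Real.rpow_le_rpow (by linarith) (by linarith) hN
          _ = 2 ^ N * t ^ N := Real.mul_rpow (by norm_num) ht'.le
          _ ≤ 2 ^ N * (1 + t ^ N) := by gcongr; linarith
    rw [Real.norm_of_nonneg (by positivity), Real.rpow_add ht']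
    calc (-t).exp * t ^ σ * (1 + t) ^ N ≤ (-t).exp * t ^ σ * (2 ^ N * (1 + t ^ N)) := by gcongr
      _ = _ := by ring

/-- The Laplace integral `∫₀^∞ e^{-t} t^a (z + t/2)^b dt`. For `a = b = m - 1/2` it equals
`Γ(m + 1/2) (2/π)^{1/2} z^m e^z K_m(z)`. -/
def laplaceF (a b z : ℂ) : ℂ :=
  ∫ t in Set.Ioi (0 : ℝ), gammaWeight a t * (z + ((t / 2 : ℝ) : ℂ)) ^ b

theorem continuousOn_laplace_integrand {z : ℂ} (hz : 0 ≤ z.re) (a b : ℂ) :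
    ContinuousOn (fun t : ℝ => gammaWeight a t * (z + ((t / 2 : ℝ) : ℂ)) ^ b) (Set.Ioi 0) := by
  refine (continuousOn_gammaWeight a).mul fun t ht => ?_
  have ht' : 0 < t / 2 := half_pos ht
  exact ((by fun_prop : ContinuousAt (fun t : ℝ => z + ((t / 2 : ℝ) : ℂ)) t).cpow
    continuousAt_const (add_ofReal_mem_slitPlane hz ht')).continuousWithinAt

theorem aestronglyMeasurable_laplace_integrand {z : ℂ} (hz : 0 ≤ z.re) (a b : ℂ) :
    AEStronglyMeasurable (fun t : ℝ => gammaWeight a t * (z + ((t / 2 : ℝ) : ℂ)) ^ b)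
      (volume.restrict (Set.Ioi 0)) :=
  (continuousOn_laplace_integrand hz a b).aestronglyMeasurable measurableSet_Ioi

/-- The factor depending on `b` and `z` in the pointwise bound of the Laplace integrand. -/
def laplaceConst (b z : ℂ) : ℝ :=
  Real.exp (Real.pi * |b.im|) * (‖z‖ ^ b.re * (1 + 1 / ‖z‖) ^ |b.re|)

theorem norm_laplace_integrand_le {z : ℂ} (hz : 0 ≤ z.re) (hz0 : z ≠ 0) (a b : ℂ) {t : ℝ}
    (ht : 0 < t) : ‖gammaWeight a t * (z + ((t / 2 : ℝ) : ℂ)) ^ b‖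
      ≤ laplaceConst b z * ((-t).exp * t ^ a.re * (1 + t) ^ |b.re|) := by
  have hzp : 0 < ‖z‖ := norm_pos_iff.2 hz0
  have h1 := norm_add_cpow_le hz hz0 (half_pos ht).le b
  have h2 : (1 + t / 2 / ‖z‖) ^ |b.re| ≤ (1 + 1 / ‖z‖) ^ |b.re| * (1 + t) ^ |b.re| := by
    rw [← Real.mul_rpow (by positivity) (by positivity)]
    refine Real.rpow_le_rpow (by positivity) ?_ (abs_nonneg _)
    have : 0 ≤ t / 2 / ‖z‖ := by positivity
    have : 0 ≤ 1 / ‖z‖ := by positivity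
    have e : (1 + 1 / ‖z‖) * (1 + t) = 1 + t / 2 / ‖z‖ + (t + 1 / ‖z‖ + t / 2 / ‖z‖) := by
      field_simp; ring
    rw [e]; linarith
  rw [norm_mul, norm_gammaWeight ht, laplaceConst]
  calc _ ≤ (-t).exp * t ^ a.re * (Real.exp (Real.pi * |b.im|) * (‖z‖ ^ b.re *
        ((1 + 1 / ‖z‖) ^ |b.re| * (1 + t) ^ |b.re|))) := by
        refine mul_le_mul_of_nonneg_left (h1.trans ?_) (by positivity)
        gcongr
    _ = _ := by ring

theorem integrableOn_laplace {z : ℂ} (hz : 0 ≤ z.re) (hz0 : z ≠ 0) {a : ℂ} (ha : -1 < a.re)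
    (b : ℂ) : IntegrableOn (fun t : ℝ => gammaWeight a t * (z + ((t / 2 : ℝ) : ℂ)) ^ b)
      (Set.Ioi 0) volume :=
  Integrable.mono' ((integrableOn_exp_mul_rpow_mul ha (abs_nonneg b.re)).const_mul
    (laplaceConst b z)) (aestronglyMeasurable_laplace_integrand hz a b)
    ((ae_restrict_iff' measurableSet_Ioi).2 (ae_of_all _ fun _ ht =>
      norm_laplace_integrand_le hz hz0 a b ht))

/-- For `|z| ≥ 1`, the Laplace integral is `O(|z|^{Re b})`. -/
theorem exists_norm_laplaceF_le {a : ℂ} (ha : -1 < a.re) (b : ℂ) :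
    ∃ C, 0 ≤ C ∧ ∀ z : ℂ, 0 ≤ z.re → 1 ≤ ‖z‖ → ‖laplaceF a b z‖ ≤ C * ‖z‖ ^ b.re := by
  set J := ∫ t in Set.Ioi (0 : ℝ), (-t).exp * t ^ a.re * (1 + t) ^ |b.re| with hJ
  have hJ0 : 0 ≤ J := setIntegral_nonneg measurableSet_Ioi fun t ht => by
    have : (0 : ℝ) < t := ht
    positivity
  refine ⟨Real.exp (Real.pi * |b.im|) * 2 ^ |b.re| * J, by positivity, fun z hz hz1 => ?_⟩
  have hzp : 0 < ‖z‖ := by linarith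
  have hz0 : z ≠ 0 := norm_pos_iff.1 hzp
  have h1 : ‖laplaceF a b z‖ ≤ laplaceConst b z * J := by
    rw [hJ, ← integral_const_mul]
    exact norm_integral_le_of_norm_le ((integrableOn_exp_mul_rpow_mul ha (abs_nonneg b.re)).const_mul
      (laplaceConst b z)) ((ae_restrict_iff' measurableSet_Ioi).2 (ae_of_all _ fun _ ht =>
      norm_laplace_integrand_le hz hz0 a b ht))
  have h2 : (1 + 1 / ‖z‖) ^ |b.re| ≤ 2 ^ |b.re| := by
    refine Real.rpow_le_rpow (by positivity) ?_ (abs_nonneg _)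
    have : 1 / ‖z‖ ≤ 1 := (div_le_one hzp).2 hz1
    linarith
  calc _ ≤ laplaceConst b z * J := h1
    _ ≤ Real.exp (Real.pi * |b.im|) * (‖z‖ ^ b.re * 2 ^ |b.re|) * J := by
        unfold laplaceConst; gcongr
    _ = _ := by ring

/-- The leading term `Γ(a+1) z^b` of the Laplace integral at infinity. -/
theorem exists_norm_laplaceF_sub_le {a : ℂ} (ha : -1 < a.re) (b : ℂ) :
    ∃ C, 0 ≤ C ∧ ∀ z : ℂ, 0 ≤ z.re → 1 ≤ ‖z‖ →
      ‖laplaceF a b z - Complex.Gamma (a + 1) * z ^ b‖ ≤ C * ‖z‖ ^ (b.re - 1) := by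
  set N := |(b - 1).re| with hN
  set J := ∫ t in Set.Ioi (0 : ℝ), (-t).exp * t ^ a.re * (1 + t) ^ (N + 1) with hJ
  have hJ0 : 0 ≤ J := setIntegral_nonneg measurableSet_Ioi fun t ht => by
    have : (0 : ℝ) < t := ht
    positivity
  set D := ‖b‖ * Real.exp (Real.pi * |(b - 1).im|) with hD
  refine ⟨D * J, by positivity, fun z hz hz1 => ?_⟩
  have hzp : 0 < ‖z‖ := by linarith
  have hz0 : z ≠ 0 := norm_pos_iff.1 hzp
  have hΓ : Complex.Gamma (a + 1) = ∫ t in Set.Ioi (0 : ℝ), gammaWeight a t := by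
    rw [Complex.Gamma_eq_integral (by simpa using by linarith), Complex.GammaIntegral]
    simp [gammaWeight]
  have hΓi : IntegrableOn (gammaWeight a) (Set.Ioi 0) volume := by
    have := Complex.GammaIntegral_convergent (s := a + 1) (by simpa using by linarith)
    simp only [add_sub_cancel_right] at this
    exact this
  rw [hΓ, ← integral_mul_const, laplaceF, ← integral_sub (integrableOn_laplace hz hz0 ha b)
    (hΓi.mul_const _)]
  have hint := (integrableOn_exp_mul_rpow_mul (N := N + 1) ha (by positivity)).const_mul
    (D * ‖z‖ ^ (b.re - 1))
  have e : D * J * ‖z‖ ^ (b.re - 1) = ∫ t in Set.Ioi (0 : ℝ),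
      D * ‖z‖ ^ (b.re - 1) * ((-t).exp * t ^ a.re * (1 + t) ^ (N + 1)) := by
    rw [integral_const_mul]; ring
  rw [e]
  refine norm_integral_le_of_norm_le hint
    ((ae_restrict_iff' measurableSet_Ioi).2 (ae_of_all _ fun t ht => ?_))
  have ht' : (0 : ℝ) < t := ht
  rw [← mul_sub, norm_mul, norm_gammaWeight ht']
  -- the mean value inequality for `s ↦ (z + s)^b` on `[0, t/2]`
  have hmv := norm_image_sub_le_of_norm_deriv_le_segment' (a := 0) (b := t / 2)
    (f := fun s : ℝ => (z + (s : ℂ)) ^ b) (f' := fun s : ℝ => b * (z + (s : ℂ)) ^ (b - 1))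
    (C := D * ‖z‖ ^ (b.re - 1) * (1 + t) ^ N) (fun s hs => by
      have hmem : z + (s : ℂ) ∈ Complex.slitPlane := by
        refine mem_slitPlane_of_re_nonneg (by simpa using add_nonneg hz hs.1) ?_
        exact norm_pos_iff.1 (hzp.trans_le (norm_le_norm_add_ofReal hz hs.1))
      have h1 : HasDerivAt (fun s : ℝ => z + (s : ℂ)) 1 s :=
        (hasDerivAt_id s).ofReal_comp.const_add z
      have := hasDerivAt_cpow_const_of_real h1 hmem b
      simpa using this.hasDerivWithinAt) (fun s hs => by
      rw [norm_mul, hD, mul_assoc, mul_assoc]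
      refine mul_le_mul_of_nonneg_left ?_ (norm_nonneg _)
      refine (norm_add_cpow_le hz hz0 hs.1 (b - 1)).trans ?_
      refine mul_le_mul_of_nonneg_left ?_ (Real.exp_pos _).le
      refine mul_le_mul (le_of_eq (by simp)) (Real.rpow_le_rpow (by have := hs.1; positivity) ?_
        (abs_nonneg _)) (by have := hs.1; positivity) (by positivity)
      have : s / ‖z‖ ≤ s := div_le_self hs.1 hz1
      linarith [hs.2]) (t / 2) ⟨by positivity, le_rfl⟩
  simp only [Complex.ofReal_zero, add_zero, sub_zero] at hmv
  have h6 : (1 + t) ^ (N + 1) = (1 + t) ^ N * (1 + t) := by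
    rw [Real.rpow_add (by positivity), Real.rpow_one]
  have h7 : D * ‖z‖ ^ (b.re - 1) * (1 + t) ^ N * (t / 2)
      ≤ D * ‖z‖ ^ (b.re - 1) * (1 + t) ^ N * (1 + t) := by
    gcongr; linarith
  calc _ ≤ (-t).exp * t ^ a.re * (D * ‖z‖ ^ (b.re - 1) * (1 + t) ^ N * (1 + t)) :=
        mul_le_mul_of_nonneg_left (hmv.trans h7) (by positivity)
    _ = _ := by rw [h6]; ring

/-- Domination of the Laplace integrand with `a = b` that is uniform down to `z = 0`. -/
def laplaceDom (a : ℂ) (R t : ℝ) : ℝ :=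
  Real.exp (Real.pi * |a.im|) * (R ^ |a.re| * ((-t).exp * t ^ a.re * (1 + t) ^ |a.re|)
    + 2 ^ (-a.re) * ((-t).exp * t ^ (2 * a.re)))

theorem integrableOn_laplaceDom {a : ℂ} (ha : -(1 / 2) < a.re) (R : ℝ) :
    IntegrableOn (laplaceDom a R) (Set.Ioi 0) volume :=
  (((integrableOn_exp_mul_rpow_mul (by linarith) (abs_nonneg _)).const_mul _).add
    ((integrableOn_exp_mul_rpow (by linarith)).const_mul _)).const_mul _

theorem norm_laplace_integrand_le_dom {a z : ℂ} (hz : 0 ≤ z.re) {R t : ℝ} (hR : 1 ≤ R)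
    (hzR : ‖z‖ ≤ R) (ht : 0 < t) :
    ‖gammaWeight a t * (z + ((t / 2 : ℝ) : ℂ)) ^ a‖ ≤ laplaceDom a R t := by
  have ht2 : 0 < t / 2 := half_pos ht
  have h1 := norm_cpow_le_exp_mul_rpow (add_ofReal_ne_zero hz ht2) a
  have h2 : ‖z + ((t / 2 : ℝ) : ℂ)‖ ^ a.re
      ≤ R ^ |a.re| * (1 + t) ^ |a.re| + 2 ^ (-a.re) * t ^ a.re := by
    rcases le_or_gt 0 a.re with h | h
    · have : ‖z + ((t / 2 : ℝ) : ℂ)‖ ^ a.re ≤ R ^ |a.re| * (1 + t) ^ |a.re| := by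
        rw [abs_of_nonneg h, ← Real.mul_rpow (by positivity) (by positivity)]
        refine Real.rpow_le_rpow (norm_nonneg _) ?_ h
        refine (norm_add_le _ _).trans ?_
        rw [Complex.norm_real, Real.norm_of_nonneg ht2.le]
        nlinarith
      refine this.trans (le_add_of_nonneg_right (by positivity))
    · have : ‖z + ((t / 2 : ℝ) : ℂ)‖ ^ a.re ≤ 2 ^ (-a.re) * t ^ a.re := by
        have e : (2 : ℝ) ^ (-a.re) * t ^ a.re = (t / 2) ^ a.re := by
          rw [Real.div_rpow ht.le (by norm_num), Real.rpow_neg (by norm_num)]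
          field_simp
        rw [e]
        exact Real.rpow_le_rpow_of_nonpos ht2 (le_norm_add_ofReal hz) h.le
      refine this.trans (le_add_of_nonneg_left (by positivity))
  rw [norm_mul, norm_gammaWeight ht, laplaceDom]
  calc _ ≤ (-t).exp * t ^ a.re * (Real.exp (Real.pi * |a.im|) *
        (R ^ |a.re| * (1 + t) ^ |a.re| + 2 ^ (-a.re) * t ^ a.re)) := by
        refine mul_le_mul_of_nonneg_left (h1.trans ?_) (by positivity)
        gcongr
    _ = _ := by rw [two_mul, Real.rpow_add ht]; ring

theorem exists_norm_laplaceF_self_le {a : ℂ} (ha : -(1 / 2) < a.re) :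
    ∃ C, 0 ≤ C ∧ ∀ z : ℂ, 0 ≤ z.re → ‖z‖ ≤ 1 → ‖laplaceF a a z‖ ≤ C := by
  have h : ∀ z : ℂ, 0 ≤ z.re → ‖z‖ ≤ 1 →
      ‖laplaceF a a z‖ ≤ ∫ t in Set.Ioi (0 : ℝ), laplaceDom a 1 t := fun z hz hz1 =>
    norm_integral_le_of_norm_le (integrableOn_laplaceDom ha 1)
      ((ae_restrict_iff' measurableSet_Ioi).2 (ae_of_all _ fun _ ht =>
      norm_laplace_integrand_le_dom hz le_rfl hz1 ht))
  exact ⟨_, (norm_nonneg _).trans (h 0 (by simp) (by simp)), h⟩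

theorem continuousOn_laplaceF_self {a : ℂ} (ha : -(1 / 2) < a.re) :
    ContinuousOn (laplaceF a a) {z | 0 ≤ z.re} := by
  intro z₀ hz₀
  refine tendsto_integral_filter_of_dominated_convergence (laplaceDom a (‖z₀‖ + 1)) ?_ ?_
    (integrableOn_laplaceDom ha _) ?_
  · filter_upwards [self_mem_nhdsWithin] with z hz
    exact aestronglyMeasurable_laplace_integrand hz a a
  · have : ∀ᶠ z : ℂ in 𝓝[{z | 0 ≤ z.re}] z₀, ‖z‖ ≤ ‖z₀‖ + 1 := by
      refine nhdsWithin_le_nhds ?_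
      have := (continuous_norm (E := ℂ)).continuousAt (x := z₀)
      exact (this.eventually_lt_const (lt_add_one ‖z₀‖)).mono fun _ h => h.le
    filter_upwards [self_mem_nhdsWithin, this] with z hz hz1
    exact (ae_restrict_iff' measurableSet_Ioi).2 (ae_of_all _ fun _ ht =>
      norm_laplace_integrand_le_dom hz (by linarith [norm_nonneg z₀]) hz1 ht)
  · refine (ae_restrict_iff' measurableSet_Ioi).2 (ae_of_all _ fun t ht => ?_)
    have ht2 : 0 < t / 2 := half_pos ht
    have : ContinuousAt (fun z : ℂ => gammaWeight a t * (z + ((t / 2 : ℝ) : ℂ)) ^ a) z₀ :=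
      continuousAt_const.mul ((continuousAt_id.add continuousAt_const).cpow continuousAt_const
        (add_ofReal_mem_slitPlane hz₀ ht2))
    exact this.tendsto.mono_left nhdsWithin_le_nhds

theorem laplaceF_zero_ne_zero {a : ℂ} (ha : -(1 / 2) < a.re) : laplaceF a a 0 ≠ 0 := by
  have e : laplaceF a a 0 = (1 / 2 : ℂ) ^ a * Complex.Gamma (2 * a + 1) := by
    rw [Complex.Gamma_eq_integral (by simpa using by linarith), Complex.GammaIntegral,
      ← integral_const_mul, laplaceF]
    refine setIntegral_congr_fun measurableSet_Ioi fun t ht => ?_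
    have ht' : (0 : ℝ) < t := ht
    have ht0 : (t : ℂ) ≠ 0 := Complex.ofReal_ne_zero.2 ht'.ne'
    have h2 : ((1 / 2 * t : ℝ) : ℂ) ^ a = (1 / 2 : ℂ) ^ a * (t : ℂ) ^ a := by
      rw [Complex.ofReal_mul, Complex.mul_cpow_ofReal_nonneg (by norm_num) ht'.le]
      norm_num
    have h3 : t / 2 = 1 / 2 * t := by ring
    simp only [gammaWeight, zero_add, add_sub_cancel_right]
    rw [h3, h2, two_mul, Complex.cpow_add _ _ ht0]
    ring
  rw [e]
  refine mul_ne_zero ?_ (Complex.Gamma_ne_zero_of_re_pos (by simpa using by linarith))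
  rw [Complex.cpow_ne_zero_iff]
  left; norm_num

/-- `z (d/dz) F(z) → 0` as `z → 0` in the right half-plane, for the Laplace integral `F`. -/
theorem tendsto_mul_laplaceF_sub_one {a : ℂ} (ha : -(1 / 2) < a.re) {ι : Type*} {l : Filter ι}
    [l.IsCountablyGenerated] {z : ι → ℂ} (hz : Tendsto z l (𝓝 0)) (hre : ∀ᶠ i in l, 0 ≤ (z i).re) :
    Tendsto (fun i => z i * laplaceF a (a - 1) (z i)) l (𝓝 0) := by
  simp only [laplaceF, ← integral_const_mul]
  have e0 : (0 : ℂ) = ∫ t in Set.Ioi (0 : ℝ), (0 : ℂ) := by simp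
  rw [e0]
  have key : ∀ (w : ℂ) (t : ℝ), 0 ≤ w.re → 0 < t →
      w * (gammaWeight a t * (w + ((t / 2 : ℝ) : ℂ)) ^ (a - 1))
        = (gammaWeight a t * (w + ((t / 2 : ℝ) : ℂ)) ^ a) * (w / (w + ((t / 2 : ℝ) : ℂ))) := by
    intro w t hw ht
    have h0 := add_ofReal_ne_zero hw (half_pos ht)
    rw [Complex.cpow_sub _ _ h0, Complex.cpow_one]
    field_simp
  refine tendsto_integral_filter_of_dominated_convergence (laplaceDom a 1) ?_ ?_
    (integrableOn_laplaceDom ha _) ?_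
  · filter_upwards [hre] with i hi
    exact (aestronglyMeasurable_laplace_integrand hi a (a - 1)).const_mul _
  · have hz1 : ∀ᶠ i in l, ‖z i‖ ≤ 1 := by
      have := hz.norm
      rw [norm_zero] at this
      exact (this.eventually_lt_const one_pos).mono fun _ h => h.le
    filter_upwards [hre, hz1] with i hi hi1
    refine (ae_restrict_iff' measurableSet_Ioi).2 (ae_of_all _ fun t ht => ?_)
    have ht' : (0 : ℝ) < t := ht
    rw [key _ _ hi ht', norm_mul]
    refine (mul_le_of_le_one_right (norm_nonneg _) ?_).trans
      (norm_laplace_integrand_le_dom hi le_rfl hi1 ht')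
    rw [norm_div]
    exact div_le_one_of_le₀ (norm_le_norm_add_ofReal hi (half_pos ht').le) (norm_nonneg _)
  · refine (ae_restrict_iff' measurableSet_Ioi).2 (ae_of_all _ fun t ht => ?_)
    have ht' : (0 : ℝ) < t := ht
    have hc : ContinuousAt (fun w : ℂ => w * (gammaWeight a t *
        (w + ((t / 2 : ℝ) : ℂ)) ^ (a - 1))) 0 :=
      continuousAt_id.mul (continuousAt_const.mul ((continuousAt_id.add continuousAt_const).cpow
        continuousAt_const (add_ofReal_mem_slitPlane (by simp) (half_pos ht'))))
    have := hc.tendsto.comp hz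
    rw [zero_mul] at this
    exact this

/-- The three-term recurrence of the Laplace integrals, which is the differential equation of
`laplaceF a a`: the integrand of the combination is `-d/dt (e^{-t} t^{a+1} (z + t/2)^{a-1})`. -/
theorem laplaceF_recurrence {a z : ℂ} (ha : -(1 / 2) < a.re) (hz : 0 ≤ z.re) (hz0 : z ≠ 0) :
    2 * laplaceF a a z - (2 * a + 2 * z) * laplaceF a (a - 1) z
      + (a - 1) * z * laplaceF a (a - 2) z = 0 := by
  have ha1 : -1 < a.re := by linarith
  have i0 := integrableOn_laplace hz hz0 ha1 a
  have i1 := integrableOn_laplace hz hz0 ha1 (a - 1)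
  have i2 := integrableOn_laplace hz hz0 ha1 (a - 2)
  set g : ℝ → ℂ := fun t => 2 * (gammaWeight a t * (z + ((t / 2 : ℝ) : ℂ)) ^ a)
    - (2 * a + 2 * z) * (gammaWeight a t * (z + ((t / 2 : ℝ) : ℂ)) ^ (a - 1))
    + (a - 1) * z * (gammaWeight a t * (z + ((t / 2 : ℝ) : ℂ)) ^ (a - 2)) with hg
  have hgi : IntegrableOn g (Set.Ioi 0) volume :=
    ((i0.const_mul _).sub (i1.const_mul _)).add (i2.const_mul _)
  have e : 2 * laplaceF a a z - (2 * a + 2 * z) * laplaceF a (a - 1) z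
      + (a - 1) * z * laplaceF a (a - 2) z = ∫ t in Set.Ioi (0 : ℝ), g t := by
    simp only [laplaceF, ← integral_const_mul]
    rw [← integral_sub (i0.const_mul _) (i1.const_mul _)]
    have i01 : IntegrableOn (fun t : ℝ => 2 * (gammaWeight a t * (z + ((t / 2 : ℝ) : ℂ)) ^ a)
        - (2 * a + 2 * z) * (gammaWeight a t * (z + ((t / 2 : ℝ) : ℂ)) ^ (a - 1)))
        (Set.Ioi 0) volume := (i0.const_mul _).sub (i1.const_mul _)
    rw [← integral_add i01 (i2.const_mul _)]
  rw [e]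
  set h : ℝ → ℂ := fun t => -(gammaWeight (a + 1) t * (z + ((t / 2 : ℝ) : ℂ)) ^ (a - 1)) with hh
  have hd : ∀ t ∈ Set.Ioi (0 : ℝ), HasDerivAt h (g t) t := by
    intro t ht
    have ht' : (0 : ℝ) < t := ht
    have ht0 : (t : ℂ) ≠ 0 := Complex.ofReal_ne_zero.2 ht'.ne'
    have hw := add_ofReal_ne_zero hz (half_pos ht')
    have d1 : HasDerivAt (fun t : ℝ => (((-t).exp : ℝ) : ℂ)) (((-t).exp * (-1) : ℝ) : ℂ) t :=
      ((hasDerivAt_neg t).exp).ofReal_comp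
    have d2 := hasDerivAt_cpow_const_of_real ((hasDerivAt_id t).ofReal_comp)
      (Or.inl (by simpa using ht')) (a + 1)
    have d3 : HasDerivAt (fun t : ℝ => z + ((t / 2 : ℝ) : ℂ)) (((1 / 2 : ℝ)) : ℂ) t :=
      (((hasDerivAt_id t).div_const 2).ofReal_comp).const_add z
    have d4 := hasDerivAt_cpow_const_of_real d3 (add_ofReal_mem_slitPlane hz (half_pos ht')) (a - 1)
    have := ((d1.mul d2).mul d4).neg
    refine this.congr_deriv ?_
    have e1 : (t : ℂ) ^ (a + 1) = (t : ℂ) ^ a * t := by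
      rw [Complex.cpow_add _ _ ht0, Complex.cpow_one]
    have e2 : (z + ((t / 2 : ℝ) : ℂ)) ^ a = (z + ((t / 2 : ℝ) : ℂ)) ^ (a - 2)
        * (z + ((t / 2 : ℝ) : ℂ)) ^ 2 := by
      rw [← Complex.cpow_natCast, ← Complex.cpow_add _ _ hw]; congr 1; push_cast; ring
    have e3 : (z + ((t / 2 : ℝ) : ℂ)) ^ (a - 1) = (z + ((t / 2 : ℝ) : ℂ)) ^ (a - 2)
        * (z + ((t / 2 : ℝ) : ℂ)) := by
      rw [show a - 1 = a - 2 + 1 by ring, Complex.cpow_add _ _ hw, Complex.cpow_one]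
    have e4 : a - 1 - 1 = a - 2 := by ring
    simp only [hg, gammaWeight, Pi.mul_apply, e4, add_sub_cancel_right, id, Complex.ofReal_one]
    rw [e1, e2, e3]
    push_cast
    ring
  have hi : IntegrableOn h (Set.Ioi 0) volume := by
    have hN := (integrableOn_laplace hz hz0 (a := a + 1) (by simpa using by linarith) (a - 1))
    exact hN.neg
  have h0 : h 0 = 0 := by
    have : a + 1 ≠ 0 := by
      intro h; have := congrArg Complex.re h; simp at this; linarith
    simp [hh, gammaWeight, Complex.zero_cpow this]
  have hc : ContinuousWithinAt h (Set.Ici 0) 0 := by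
    rw [ContinuousWithinAt, h0]
    -- near `t = 0` the factor `(z + t/2)^{a-1}` stays bounded and `t^{a+1} → 0`
    have c1 : ContinuousAt (fun t : ℝ => gammaWeight (a + 1) t) 0 :=
      ContinuousAt.mul (by fun_prop)
        (Complex.continuousAt_ofReal_cpow_const 0 (a + 1) (Or.inl (by simpa using by linarith)))
    have c2 : ContinuousAt (fun t : ℝ => (z + ((t / 2 : ℝ) : ℂ)) ^ (a - 1)) 0 := by
      refine ContinuousAt.cpow (by fun_prop) continuousAt_const ?_
      simpa using mem_slitPlane_of_re_nonneg hz hz0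
    have := (c1.mul c2).neg.tendsto
    have h0' : -(gammaWeight (a + 1) 0 * (z + ((0 / 2 : ℝ) : ℂ)) ^ (a - 1)) = 0 := h0
    simp only [Pi.neg_apply, Pi.mul_apply] at this
    rw [h0'] at this
    exact this.mono_left nhdsWithin_le_nhds
  rw [integral_Ioi_of_hasDerivAt_of_tendsto hc hd hgi
    (tendsto_zero_of_hasDerivAt_of_integrableOn_Ioi hd hgi hi), h0, sub_zero]

/-! ### The finite Laplace integral of the modified Bessel function -/

/-- The weight `(s (1 - s))^{m - 1/2}` of the Beta integral. -/
def betaWeight (m : ℂ) (s : ℝ) : ℂ :=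
  (s : ℂ) ^ (m + 1 / 2 - 1) * (1 - (s : ℂ)) ^ (m + 1 / 2 - 1)

theorem intervalIntegrable_betaWeight {m : ℂ} (hm : 0 < m.re) :
    IntervalIntegrable (betaWeight m) volume 0 1 :=
  Complex.betaIntegral_convergent (by simpa using by linarith) (by simpa using by linarith)

/-- The integral `∫₀¹ (2s-1)^j e^{z(2s-1)} (s(1-s))^{m-1/2} ds`, the `j`-th derivative of the entire
function of `z` that for `j = 0` is a multiple of `z^{-m} I_m(z)`. -/
def besselP (m : ℂ) (j : ℕ) (z : ℂ) : ℂ :=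
  ∫ s in (0 : ℝ)..1, (2 * (s : ℂ) - 1) ^ j * Complex.exp (z * (2 * s - 1)) * betaWeight m s

theorem intervalIntegrable_besselP {m : ℂ} (hm : 0 < m.re) (j : ℕ) (z : ℂ) :
    IntervalIntegrable (fun s : ℝ => (2 * (s : ℂ) - 1) ^ j * Complex.exp (z * (2 * s - 1))
      * betaWeight m s) volume 0 1 :=
  (intervalIntegrable_betaWeight hm).continuousOn_mul (Continuous.continuousOn (by fun_prop))

theorem norm_two_mul_sub_one_le {s : ℝ} (hs : s ∈ Set.uIoc (0 : ℝ) 1) :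
    ‖(2 * (s : ℂ) - 1)‖ ≤ 1 := by
  rw [Set.uIoc_of_le zero_le_one] at hs
  have : (2 * (s : ℂ) - 1) = ((2 * s - 1 : ℝ) : ℂ) := by push_cast; ring
  rw [this, Complex.norm_real, Real.norm_eq_abs, abs_le]
  constructor <;> linarith [hs.1, hs.2]

theorem norm_besselP_integrand_le {m z : ℂ} (j : ℕ) {s : ℝ} (hs : s ∈ Set.uIoc (0 : ℝ) 1) :
    ‖(2 * (s : ℂ) - 1) ^ j * Complex.exp (z * (2 * s - 1)) * betaWeight m s‖
      ≤ Real.exp ‖z‖ * ‖betaWeight m s‖ := by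
  have h1 := norm_two_mul_sub_one_le hs
  rw [norm_mul, norm_mul, norm_pow]
  refine mul_le_mul_of_nonneg_right ?_ (norm_nonneg _)
  have h2 : ‖Complex.exp (z * (2 * s - 1))‖ ≤ Real.exp ‖z‖ := by
    refine (Complex.norm_exp_le_exp_norm _).trans (Real.exp_le_exp.2 ?_)
    rw [norm_mul]
    exact mul_le_of_le_one_right (norm_nonneg _) h1
  calc _ ≤ 1 * Real.exp ‖z‖ := mul_le_mul (pow_le_one₀ (norm_nonneg _) h1) h2 (norm_nonneg _)
        zero_le_one
    _ = _ := one_mul _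

theorem exists_norm_besselP_le {m : ℂ} (hm : 0 < m.re) :
    ∃ B, 0 ≤ B ∧ ∀ (j : ℕ) (z : ℂ), ‖besselP m j z‖ ≤ B * Real.exp ‖z‖ := by
  refine ⟨∫ s in (0 : ℝ)..1, ‖betaWeight m s‖,
    intervalIntegral.integral_nonneg zero_le_one fun _ _ => norm_nonneg _, fun j z => ?_⟩
  rw [mul_comm, ← intervalIntegral.integral_const_mul]
  refine intervalIntegral.norm_integral_le_of_norm_le zero_le_one (ae_of_all _ fun s hs => ?_)
    ((intervalIntegrable_betaWeight hm).norm.const_mul _)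
  exact norm_besselP_integrand_le j (by rwa [Set.uIoc_of_le zero_le_one])

theorem hasDerivAt_besselP {m : ℂ} (hm : 0 < m.re) (j : ℕ) (z : ℂ) :
    HasDerivAt (besselP m j) (besselP m (j + 1) z) z := by
  have hmeas : ∀ (i : ℕ) (w : ℂ), AEStronglyMeasurable (fun s : ℝ => (2 * (s : ℂ) - 1) ^ i
      * Complex.exp (w * (2 * s - 1)) * betaWeight m s) (volume.restrict (Set.uIoc 0 1)) :=
    fun i w => (intervalIntegrable_iff.1 (intervalIntegrable_besselP hm i w)).1
  refine (intervalIntegral.hasDerivAt_integral_of_dominated_loc_of_deriv_le (𝕜 := ℂ)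
    (F := fun w s => (2 * (s : ℂ) - 1) ^ j * Complex.exp (w * (2 * s - 1)) * betaWeight m s)
    (F' := fun w s => (2 * (s : ℂ) - 1) ^ (j + 1) * Complex.exp (w * (2 * s - 1)) * betaWeight m s)
    (bound := fun s => Real.exp (‖z‖ + 1) * ‖betaWeight m s‖)
    (Metric.ball_mem_nhds z one_pos) (Eventually.of_forall fun w => hmeas j w)
    (intervalIntegrable_besselP hm j z) (hmeas (j + 1) z) (ae_of_all _ fun s hs w hw => ?_)
    ((intervalIntegrable_betaWeight hm).norm.const_mul _)
    (ae_of_all _ fun s hs w hw => ?_)).2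
  · refine (norm_besselP_integrand_le (j + 1) hs).trans
      (mul_le_mul_of_nonneg_right (Real.exp_le_exp.2 ?_) (norm_nonneg _))
    have h1 : ‖w - z‖ < 1 := by simpa [dist_eq_norm] using hw
    have h2 := norm_add_le (w - z) z
    rw [sub_add_cancel] at h2
    linarith
  · have h1 : HasDerivAt (fun w : ℂ => w * (2 * (s : ℂ) - 1)) (1 * (2 * (s : ℂ) - 1)) w :=
      (hasDerivAt_id w).mul_const _
    have := ((h1.cexp).const_mul ((2 * (s : ℂ) - 1) ^ j)).mul_const (betaWeight m s)
    refine this.congr_deriv ?_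
    ring

theorem continuous_besselP {m : ℂ} (hm : 0 < m.re) (j : ℕ) : Continuous (besselP m j) :=
  continuous_iff_continuousAt.2 fun z => (hasDerivAt_besselP hm j z).continuousAt

theorem besselP_zero_zero_ne_zero {m : ℂ} (hm : 0 < m.re) : besselP m 0 0 ≠ 0 := by
  have h1 : 0 < (m + 1 / 2).re := by simpa using by linarith
  have e : besselP m 0 0 = Complex.betaIntegral (m + 1 / 2) (m + 1 / 2) := by
    simp [besselP, Complex.betaIntegral, betaWeight]
  have h2 := Complex.Gamma_mul_Gamma_eq_betaIntegral h1 h1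
  rw [e]
  intro h
  rw [h, mul_zero] at h2
  exact mul_ne_zero (Complex.Gamma_ne_zero_of_re_pos h1) (Complex.Gamma_ne_zero_of_re_pos h1) h2

/-- The differential equation `z P'' + (2m+1) P' = z P` of `P(z) = z^{-m} I_m(z)`: the integrand of
the combination is the derivative of `-2 e^{z(2s-1)} (s(1-s))^{m+1/2}`. -/
theorem besselP_recurrence {m : ℂ} (hm : 0 < m.re) (z : ℂ) :
    z * besselP m 2 z + (2 * m + 1) * besselP m 1 z - z * besselP m 0 z = 0 := by
  have i0 := intervalIntegrable_besselP hm 0 z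
  have i1 := intervalIntegrable_besselP hm 1 z
  have i2 := intervalIntegrable_besselP hm 2 z
  set g : ℝ → ℂ := fun s =>
    z * ((2 * (s : ℂ) - 1) ^ 2 * Complex.exp (z * (2 * s - 1)) * betaWeight m s)
    + (2 * m + 1) * ((2 * (s : ℂ) - 1) ^ 1 * Complex.exp (z * (2 * s - 1)) * betaWeight m s)
    - z * ((2 * (s : ℂ) - 1) ^ 0 * Complex.exp (z * (2 * s - 1)) * betaWeight m s) with hg
  have i12 : IntervalIntegrable (fun s : ℝ =>
      z * ((2 * (s : ℂ) - 1) ^ 2 * Complex.exp (z * (2 * s - 1)) * betaWeight m s)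
      + (2 * m + 1) * ((2 * (s : ℂ) - 1) ^ 1 * Complex.exp (z * (2 * s - 1)) * betaWeight m s))
      volume 0 1 := (i2.const_mul _).add (i1.const_mul _)
  have hgi : IntervalIntegrable g volume 0 1 := i12.sub (i0.const_mul _)
  have e : z * besselP m 2 z + (2 * m + 1) * besselP m 1 z - z * besselP m 0 z
      = ∫ s in (0 : ℝ)..1, g s := by
    simp only [besselP, ← intervalIntegral.integral_const_mul]
    rw [← intervalIntegral.integral_add (i2.const_mul _) (i1.const_mul _),
      ← intervalIntegral.integral_sub i12 (i0.const_mul _)]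
  rw [e]
  have hmre : 0 < (m + 1 / 2).re := by simpa using by linarith
  have hmne : m + 1 / 2 ≠ 0 := fun h => by rw [h] at hmre; simp at hmre
  set h : ℝ → ℂ := fun s => -2 * (Complex.exp (z * (2 * s - 1)) *
    ((s : ℂ) ^ (m + 1 / 2) * (1 - (s : ℂ)) ^ (m + 1 / 2))) with hh
  have hc : Continuous h := by
    have c1 := Complex.continuous_ofReal_cpow_const hmre
    have c2 : Continuous fun s : ℝ => (1 - (s : ℂ)) ^ (m + 1 / 2) := by
      have := c1.comp (continuous_const.sub continuous_id : Continuous fun s : ℝ => 1 - s)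
      refine this.congr fun s => ?_
      simp
    fun_prop
  have hd : ∀ s ∈ Set.Ioo (0 : ℝ) 1, HasDerivAt h (g s) s := by
    intro s hs
    have hs0 : (s : ℂ) ≠ 0 := Complex.ofReal_ne_zero.2 hs.1.ne'
    have hs1 : (1 - (s : ℂ)) ≠ 0 := by
      have : ((1 - s : ℝ) : ℂ) ≠ 0 := Complex.ofReal_ne_zero.2 (by linarith [hs.2])
      simpa using this
    have d0 : HasDerivAt (fun s : ℝ => (s : ℂ)) 1 s := (hasDerivAt_id s).ofReal_comp
    have d1 := (((d0.const_mul 2).sub_const 1).const_mul z).cexp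
    have d2 := hasDerivAt_cpow_const_of_real d0 (Or.inl (by simpa using hs.1)) (m + 1 / 2)
    have d3 := hasDerivAt_cpow_const_of_real (d0.const_sub 1) (Or.inl (by simpa using hs.2))
      (m + 1 / 2)
    have := (d1.mul (d2.mul d3)).const_mul (-2)
    refine this.congr_deriv ?_
    have e1 : (s : ℂ) ^ (m + 1 / 2) = (s : ℂ) ^ (m + 1 / 2 - 1) * s := by
      conv_lhs => rw [show m + 1 / 2 = m + 1 / 2 - 1 + 1 by ring, Complex.cpow_add _ _ hs0,
        Complex.cpow_one]
    have e2 : (1 - (s : ℂ)) ^ (m + 1 / 2) = (1 - (s : ℂ)) ^ (m + 1 / 2 - 1) * (1 - s) := by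
      conv_lhs => rw [show m + 1 / 2 = m + 1 / 2 - 1 + 1 by ring, Complex.cpow_add _ _ hs1,
        Complex.cpow_one]
    simp only [hg, betaWeight, Pi.mul_apply]
    rw [e1, e2]
    ring
  rw [intervalIntegral.integral_eq_sub_of_hasDerivAt_of_le zero_le_one hc.continuousOn hd hgi]
  rw [one_div] at hmne
  simp [hh, Complex.zero_cpow hmne]

/-! ### Solutions along the rays `z = k eˣ` -/

/-- The point `k eˣ`. -/
def ray (k : ℂ) (x : ℝ) : ℂ := k * (Real.exp x : ℝ)

theorem ray_re_nonneg {k : ℂ} (hk : 0 ≤ k.re) (x : ℝ) : 0 ≤ (ray k x).re := by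
  simpa [ray, -Complex.ofReal_exp] using mul_nonneg hk (Real.exp_pos x).le

theorem ray_re (k : ℂ) (x : ℝ) : (ray k x).re = k.re * Real.exp x := by
  simp [ray, -Complex.ofReal_exp]

theorem norm_ray (k : ℂ) (x : ℝ) : ‖ray k x‖ = ‖k‖ * Real.exp x := by
  rw [ray, norm_mul, Complex.norm_real, Real.norm_of_nonneg (Real.exp_pos x).le]

theorem ray_ne_zero {k : ℂ} (hk : k ≠ 0) (x : ℝ) : ray k x ≠ 0 :=
  mul_ne_zero hk (Complex.ofReal_ne_zero.2 (Real.exp_pos x).ne')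

theorem hasDerivAt_ray (k : ℂ) (x : ℝ) : HasDerivAt (ray k) (ray k x) x :=
  ((Real.hasDerivAt_exp x).ofReal_comp).const_mul k

theorem continuous_ray (k : ℂ) : Continuous (ray k) := by unfold ray; fun_prop

theorem ray_zero (x : ℝ) : ray 0 x = 0 := zero_mul _

theorem tendsto_ray_atBot (k : ℂ) : Tendsto (ray k) atBot (𝓝 0) := by
  have : Tendsto (fun x => k * (Real.exp x : ℂ)) atBot (𝓝 (k * ((0 : ℝ) : ℂ))) :=
    ((Complex.continuous_ofReal.tendsto _).comp Real.tendsto_exp_atBot).const_mul k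
  rw [Complex.ofReal_zero, mul_zero] at this
  exact this

theorem expPot_eq_ray_sq (k : ℂ) (x : ℝ) : expPot k x = ray k x ^ 2 := by
  rw [expPot, ray, mul_pow, Complex.ofReal_exp, ← Complex.exp_nat_mul]
  norm_num

theorem hasDerivAt_besselP_ray {m : ℂ} (hm : 0 < m.re) (j : ℕ) (k : ℂ) (x : ℝ) :
    HasDerivAt (fun x => besselP m j (ray k x)) (besselP m (j + 1) (ray k x) * ray k x) x :=
  (hasDerivAt_besselP hm j (ray k x)).comp x (hasDerivAt_ray k x)

theorem hasDerivAt_laplaceF_ray {a k : ℂ} (ha : -1 < a.re) (hk : 0 ≤ k.re) (hk0 : k ≠ 0) (b : ℂ)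
    (x : ℝ) : HasDerivAt (fun x => laplaceF a b (ray k x))
      (b * ray k x * laplaceF a (b - 1) (ray k x)) x := by
  -- a bound, uniform near `x`, of the constant in front of the dominating function
  have hcont : Continuous fun y : ℝ => ‖b * ray k y‖ * laplaceConst (b - 1) (ray k y) := by
    have c1 : Continuous fun y : ℝ => ‖ray k y‖ := (continuous_ray k).norm
    have hpos : ∀ y, ‖ray k y‖ ≠ 0 := fun y => norm_ne_zero_iff.2 (ray_ne_zero hk0 y)
    unfold laplaceConst
    refine ((continuous_const.mul (continuous_ray k)).norm).mul (continuous_const.mul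
      ((c1.rpow_const fun y => Or.inl (hpos y)).mul ?_))
    exact (continuous_const.add (continuous_const.div c1 hpos)).rpow_const
      fun y => Or.inr (abs_nonneg _)
  obtain ⟨D, hD⟩ := (isCompact_closedBall x 1).exists_bound_of_continuousOn hcont.continuousOn
  have := (hasDerivAt_integral_of_dominated_loc_of_deriv_le (𝕜 := ℝ) (x₀ := x)
    (μ := volume.restrict (Set.Ioi (0 : ℝ)))
    (F := fun y t => gammaWeight a t * (ray k y + ((t / 2 : ℝ) : ℂ)) ^ b)
    (F' := fun y t => b * ray k y * (gammaWeight a t * (ray k y + ((t / 2 : ℝ) : ℂ)) ^ (b - 1)))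
    (bound := fun t => D * ((-t).exp * t ^ a.re * (1 + t) ^ |(b - 1).re|))
    (Metric.closedBall_mem_nhds x one_pos)
    (Eventually.of_forall fun y => aestronglyMeasurable_laplace_integrand (ray_re_nonneg hk y) a b)
    (integrableOn_laplace (ray_re_nonneg hk x) (ray_ne_zero hk0 x) ha b)
    ((aestronglyMeasurable_laplace_integrand (ray_re_nonneg hk x) a (b - 1)).const_mul _)
    ((ae_restrict_iff' measurableSet_Ioi).2 (ae_of_all _ fun t ht y hy => by
      have ht' : (0 : ℝ) < t := ht
      have h1 := norm_laplace_integrand_le (ray_re_nonneg hk y) (ray_ne_zero hk0 y) a (b - 1) ht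
      have h2 := (le_abs_self _).trans (hD y hy)
      rw [norm_mul]
      calc _ ≤ ‖b * ray k y‖ * (laplaceConst (b - 1) (ray k y) *
            ((-t).exp * t ^ a.re * (1 + t) ^ |(b - 1).re|)) :=
            mul_le_mul_of_nonneg_left h1 (norm_nonneg _)
        _ = ‖b * ray k y‖ * laplaceConst (b - 1) (ray k y) *
            ((-t).exp * t ^ a.re * (1 + t) ^ |(b - 1).re|) := by ring
        _ ≤ _ := mul_le_mul_of_nonneg_right h2 (by positivity)))
    ((integrableOn_exp_mul_rpow_mul ha (abs_nonneg _)).const_mul D)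
    ((ae_restrict_iff' measurableSet_Ioi).2 (ae_of_all _ fun t ht y hy => by
      have ht' : (0 : ℝ) < t := ht
      have := (hasDerivAt_cpow_const_of_real ((hasDerivAt_ray k y).add_const ((t / 2 : ℝ) : ℂ))
        (add_ofReal_mem_slitPlane (ray_re_nonneg hk y) (half_pos ht')) b).const_mul
        (gammaWeight a t)
      refine this.congr_deriv ?_
      ring))).2
  refine this.congr_deriv ?_
  rw [integral_const_mul, laplaceF]

/-- The solution `e^{mx} P(k eˣ)`, a multiple of `k^{-m} I_m(k eˣ)`. -/
def solU (m k : ℂ) (x : ℝ) : ℂ := Complex.exp (m * x) * besselP m 0 (ray k x)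

/-- The derivative of `solU`. -/
def solU' (m k : ℂ) (x : ℝ) : ℂ :=
  Complex.exp (m * x) * (m * besselP m 0 (ray k x) + ray k x * besselP m 1 (ray k x))

/-- The solution `e^{-mx} e^{-z} F(z)`, `z = k eˣ`, a multiple of `k^m K_m(k eˣ)`. -/
def solV (m k : ℂ) (x : ℝ) : ℂ :=
  Complex.exp (-m * x - ray k x) * laplaceF (m - 1 / 2) (m - 1 / 2) (ray k x)

/-- The derivative of `solV`. -/
def solV' (m k : ℂ) (x : ℝ) : ℂ :=
  Complex.exp (-m * x - ray k x) * ((-m - ray k x) * laplaceF (m - 1 / 2) (m - 1 / 2) (ray k x)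
    + (m - 1 / 2) * ray k x * laplaceF (m - 1 / 2) (m - 1 / 2 - 1) (ray k x))

theorem hasDerivAt_cexp_mul (m : ℂ) (x : ℝ) :
    HasDerivAt (fun x : ℝ => Complex.exp (m * x)) (Complex.exp (m * x) * m) x := by
  have : HasDerivAt (fun x : ℝ => m * (x : ℂ)) (m * 1) x :=
    ((hasDerivAt_id x).ofReal_comp).const_mul m
  simpa using this.cexp

theorem hasDerivAt_solU {m : ℂ} (hm : 0 < m.re) (k : ℂ) (x : ℝ) :
    HasDerivAt (solU m k) (solU' m k x) x := by
  refine ((hasDerivAt_cexp_mul m x).mul (hasDerivAt_besselP_ray hm 0 k x)).congr_deriv ?_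
  rw [solU']; ring

theorem hasDerivAt_solU' {m : ℂ} (hm : 0 < m.re) (k : ℂ) (x : ℝ) :
    HasDerivAt (solU' m k) ((expPot k x + m ^ 2) * solU m k x) x := by
  refine ((hasDerivAt_cexp_mul m x).mul (((hasDerivAt_besselP_ray hm 0 k x).const_mul m).add
    ((hasDerivAt_ray k x).mul (hasDerivAt_besselP_ray hm 1 k x)))).congr_deriv ?_
  rw [solU, expPot_eq_ray_sq]
  simp only [Pi.add_apply, Pi.mul_apply]
  linear_combination Complex.exp (m * x) * ray k x * besselP_recurrence hm (ray k x)

theorem hasDerivAt_cexp_neg_mul_sub_ray (m k : ℂ) (x : ℝ) :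
    HasDerivAt (fun x : ℝ => Complex.exp (-m * x - ray k x))
      (Complex.exp (-m * x - ray k x) * (-m - ray k x)) x := by
  have : HasDerivAt (fun x : ℝ => -m * (x : ℂ)) (-m * 1) x :=
    ((hasDerivAt_id x).ofReal_comp).const_mul (-m)
  simpa using (this.sub (hasDerivAt_ray k x)).cexp

theorem hasDerivAt_solV {m k : ℂ} (hm : 0 < m.re) (hk : 0 ≤ k.re) (x : ℝ) :
    HasDerivAt (solV m k) (solV' m k x) x := by
  have ha : -1 < (m - 1 / 2).re := by simpa using by linarith
  have hF : HasDerivAt (fun x => laplaceF (m - 1 / 2) (m - 1 / 2) (ray k x))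
      ((m - 1 / 2) * ray k x * laplaceF (m - 1 / 2) (m - 1 / 2 - 1) (ray k x)) x := by
    rcases eq_or_ne k 0 with rfl | hk0
    · simp only [ray_zero, mul_zero, zero_mul]
      exact hasDerivAt_const _ _
    · exact hasDerivAt_laplaceF_ray ha hk hk0 _ x
  refine ((hasDerivAt_cexp_neg_mul_sub_ray m k x).mul hF).congr_deriv ?_
  rw [solV']; ring

theorem hasDerivAt_solV' {m k : ℂ} (hm : 0 < m.re) (hk : 0 ≤ k.re) (x : ℝ) :
    HasDerivAt (solV' m k) ((expPot k x + m ^ 2) * solV m k x) x := by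
  have ha : -(1 / 2) < (m - 1 / 2).re := by simpa using hm
  have ha1 : -1 < (m - 1 / 2).re := by linarith
  rcases eq_or_ne k 0 with rfl | hk0
  · unfold solV' solV
    simp only [ray_zero, mul_zero, zero_mul, sub_zero, add_zero]
    refine ((hasDerivAt_cexp_mul (-m) x).mul_const _).congr_deriv ?_
    rw [expPot]; ring
  · have h1 := hasDerivAt_laplaceF_ray ha1 hk hk0 (m - 1 / 2) x
    have h2 := hasDerivAt_laplaceF_ray ha1 hk hk0 (m - 1 / 2 - 1) x
    have hr := hasDerivAt_ray k x
    refine ((hasDerivAt_cexp_neg_mul_sub_ray m k x).mul (((hr.const_sub (-m)).mul h1).add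
      ((hr.const_mul (m - 1 / 2)).mul h2))).congr_deriv ?_
    have e := laplaceF_recurrence ha (ray_re_nonneg hk x) (ray_ne_zero hk0 x)
    rw [show m - 1 / 2 - 2 = m - 1 / 2 - 1 - 1 by ring] at e
    rw [solV, expPot_eq_ray_sq]
    simp only [Pi.add_apply, Pi.mul_apply]
    linear_combination Complex.exp (-m * x - ray k x) * ray k x * (m - 1 / 2) * e

/-- The Wronskian of the two solutions, read off at `x → -∞`. -/
def solW (m : ℂ) : ℂ := 2 * m * besselP m 0 0 * laplaceF (m - 1 / 2) (m - 1 / 2) 0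

theorem solW_ne_zero {m : ℂ} (hm : 0 < m.re) : solW m ≠ 0 := by
  have hm0 : m ≠ 0 := fun h => by rw [h] at hm; simp at hm
  exact mul_ne_zero (mul_ne_zero (mul_ne_zero two_ne_zero hm0) (besselP_zero_zero_ne_zero hm))
    (laplaceF_zero_ne_zero (by simpa using hm))

theorem wronskian_sol {m k : ℂ} (hm : 0 < m.re) (hk : 0 ≤ k.re) (x : ℝ) :
    solU' m k x * solV m k x - solU m k x * solV' m k x = solW m := by
  have ha : -(1 / 2) < (m - 1 / 2).re := by simpa using hm
  set a := m - 1 / 2 with hadef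
  set w : ℝ → ℂ := fun x => solU' m k x * solV m k x - solU m k x * solV' m k x with hw
  have hd : ∀ x, HasDerivAt w 0 x := fun x => by
    refine (((hasDerivAt_solU' hm k x).mul (hasDerivAt_solV hm hk x)).sub
      ((hasDerivAt_solU hm k x).mul (hasDerivAt_solV' hm hk x))).congr_deriv ?_
    ring
  have hconst : ∀ y, w y = w x := fun y =>
    is_const_of_deriv_eq_zero (fun y => (hd y).differentiableAt) (fun y => (hd y).deriv) y x
  have hray := tendsto_ray_atBot k
  have hP : ∀ j, Tendsto (fun y => besselP m j (ray k y)) atBot (𝓝 (besselP m j 0)) := fun j =>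
    ((continuous_besselP hm j).tendsto 0).comp hray
  have hF : Tendsto (fun y => laplaceF a a (ray k y)) atBot (𝓝 (laplaceF a a 0)) :=
    ((continuousOn_laplaceF_self ha) 0 (by simp)).tendsto.comp
      (tendsto_nhdsWithin_iff.2 ⟨hray, Eventually.of_forall fun y => ray_re_nonneg hk y⟩)
  have hF' : Tendsto (fun y => ray k y * laplaceF a (a - 1) (ray k y)) atBot (𝓝 0) :=
    tendsto_mul_laplaceF_sub_one ha hray (Eventually.of_forall fun y => ray_re_nonneg hk y)
  have hE : Tendsto (fun y => Complex.exp (-ray k y)) atBot (𝓝 1) := by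
    have := (Complex.continuous_exp.tendsto _).comp hray.neg
    simpa using! this
  have e : ∀ y, w y = Complex.exp (-ray k y) *
      ((m * besselP m 0 (ray k y) + ray k y * besselP m 1 (ray k y)) * laplaceF a a (ray k y)
      - besselP m 0 (ray k y) * ((-m - ray k y) * laplaceF a a (ray k y)
        + a * (ray k y * laplaceF a (a - 1) (ray k y)))) := by
    intro y
    have : Complex.exp (m * y) * Complex.exp (-m * y - ray k y) = Complex.exp (-ray k y) := by
      rw [← Complex.exp_add]; congr 1; ring
    rw [← this, hw]
    simp only [solU, solU', solV, solV', ← hadef]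
    ring
  have hlim := hE.mul ((((hP 0).const_mul m).add (hray.mul (hP 1))).mul hF |>.sub
    ((hP 0).mul (((hray.const_sub (-m)).mul hF).add (hF'.const_mul a))))
  have h1 : Tendsto w atBot (𝓝 (solW m)) := by
    refine (hlim.congr fun y => (e y).symm).trans (le_of_eq ?_)
    rw [solW, ← hadef]
    congr 1; ring
  exact tendsto_nhds_unique ((tendsto_const_nhds (x := w x)).congr fun y => (hconst y).symm) h1

/-! ### The modified Bessel function at infinity -/

/-- The differential inequality behind the growth bound of `solU`. With `e = e^{-z-x/2}`, the
quantities `A, B = e (U' + U/2 ± z U)` satisfy `A' = c e U`, `B' = c e U - 2 z B` and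
`A - B = 2 z e U`, where `c = m² - 1/4`; hence `|A|² + |B|²` stays bounded although `z` may be
purely imaginary. -/
theorem exists_norm_solU_le {m : ℂ} (hm : 0 < m.re) :
    ∃ C, 0 ≤ C ∧ ∀ k : ℂ, ‖k‖ = 1 → 0 ≤ k.re → ∀ x : ℝ, 0 ≤ x →
      ‖solU m k x‖ ≤ C * Real.exp (k.re * Real.exp x - x / 2) := by
  obtain ⟨b, hb0, hb⟩ := exists_norm_besselP_le hm
  set c : ℂ := m ^ 2 - 1 / 4 with hc
  set D : ℝ := (‖m‖ + 3) * (b * Real.exp 1) with hD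
  have hD0 : 0 ≤ D := by positivity
  refine ⟨2 * D * Real.exp ‖c‖, by positivity, fun k hk1 hk x hx => ?_⟩
  have hk0 : k ≠ 0 := fun h => by rw [h, norm_zero] at hk1; exact zero_ne_one hk1
  set e : ℝ → ℂ := fun x => Complex.exp (-(x / 2 : ℂ) - ray k x) with he
  set A : ℝ → ℂ := fun x => e x * (solU' m k x + solU m k x / 2 + ray k x * solU m k x) with hA
  set B : ℝ → ℂ := fun x => e x * (solU' m k x + solU m k x / 2 - ray k x * solU m k x) with hB
  have de : ∀ x, HasDerivAt e (e x * (-(1 / 2) - ray k x)) x := fun x => by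
    have h1 : HasDerivAt (fun x : ℝ => -((x : ℂ) / 2)) (-((1 : ℂ) / 2)) x :=
      (((hasDerivAt_id x).ofReal_comp).div_const 2).neg
    exact (h1.sub (hasDerivAt_ray k x)).cexp
  have dU := hasDerivAt_solU hm k
  have dU' := hasDerivAt_solU' hm k
  have dz := hasDerivAt_ray k
  have dA : ∀ x, HasDerivAt A (c * (e x * solU m k x)) x := fun x => by
    refine ((de x).mul (((dU' x).add ((dU x).div_const 2)).add ((dz x).mul (dU x)))).congr_deriv ?_
    simp only [Pi.add_apply, Pi.mul_apply, expPot_eq_ray_sq, hc]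
    ring
  have dB : ∀ x, HasDerivAt B (c * (e x * solU m k x) - 2 * ray k x * B x) x := fun x => by
    refine ((de x).mul (((dU' x).add ((dU x).div_const 2)).sub ((dz x).mul (dU x)))).congr_deriv ?_
    simp only [Pi.add_apply, Pi.mul_apply, Pi.sub_apply, expPot_eq_ray_sq, hc, hB]
    ring
  have hAB : ∀ x, ‖e x * solU m k x‖ = ‖A x - B x‖ / (2 * Real.exp x) := fun x => by
    have : A x - B x = 2 * ray k x * (e x * solU m k x) := by rw [hA, hB]; ring
    rw [this, norm_mul (2 * ray k x), norm_mul 2, norm_ray, hk1, Complex.norm_two, one_mul]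
    field_simp
  set N : ℝ → ℝ := fun x => ‖A x‖ ^ 2 + ‖B x‖ ^ 2 with hN
  set G : ℝ → ℝ := fun x => N x * Real.exp (2 * ‖c‖ * Real.exp (-x)) with hG
  have dG : ∀ x, HasDerivAt G ((2 * inner ℝ (A x) (c * (e x * solU m k x))
      + 2 * inner ℝ (B x) (c * (e x * solU m k x) - 2 * ray k x * B x))
        * Real.exp (2 * ‖c‖ * Real.exp (-x))
      + N x * (Real.exp (2 * ‖c‖ * Real.exp (-x)) * (2 * ‖c‖ * (Real.exp (-x) * (-1))))) x :=
    fun x => (((dA x).norm_sq).add ((dB x).norm_sq)).mul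
      ((((hasDerivAt_neg x).exp).const_mul (2 * ‖c‖)).exp)
  -- The factor `e^{2|c| e^{-x}}` absorbs the right-hand side of `N' ≤ 2 |c| e^{-x} N`.
  have hanti : Antitone G := by
    refine antitone_of_hasDerivAt_nonpos dG fun x => ?_
    have i1 : inner ℝ (A x) (c * (e x * solU m k x)) ≤ ‖A x‖ * (‖c‖ * ‖e x * solU m k x‖) := by
      rw [← norm_mul]; exact real_inner_le_norm _ _
    have i2 : inner ℝ (B x) (c * (e x * solU m k x) - 2 * ray k x * B x)
        ≤ ‖B x‖ * (‖c‖ * ‖e x * solU m k x‖) := by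
      rw [inner_sub_right]
      have j1 : inner ℝ (B x) (c * (e x * solU m k x)) ≤ ‖B x‖ * (‖c‖ * ‖e x * solU m k x‖) := by
        rw [← norm_mul]; exact real_inner_le_norm _ _
      have j2 : 0 ≤ inner ℝ (B x) (2 * ray k x * B x) := by
        have hre := ray_re_nonneg hk x
        rw [Complex.inner]
        simp only [Complex.mul_re, Complex.mul_im, Complex.conj_re, Complex.conj_im, Complex.re_ofNat,
          Complex.im_ofNat]
        nlinarith [mul_nonneg hre (sq_nonneg (B x).re), mul_nonneg hre (sq_nonneg (B x).im)]
      linarith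
    have i3 : ‖e x * solU m k x‖ ≤ (‖A x‖ + ‖B x‖) / 2 * Real.exp (-x) := by
      rw [hAB, Real.exp_neg, div_le_iff₀ (by positivity)]
      have := norm_sub_le (A x) (B x)
      field_simp
      exact this
    have i4 : (‖A x‖ + ‖B x‖) * (‖c‖ * ‖e x * solU m k x‖) ≤ ‖c‖ * Real.exp (-x) * N x := by
      have : (‖A x‖ + ‖B x‖) * ((‖A x‖ + ‖B x‖) / 2) ≤ N x := by
        rw [hN]; nlinarith [sq_nonneg (‖A x‖ - ‖B x‖)]
      calc (‖A x‖ + ‖B x‖) * (‖c‖ * ‖e x * solU m k x‖)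
          ≤ (‖A x‖ + ‖B x‖) * (‖c‖ * ((‖A x‖ + ‖B x‖) / 2 * Real.exp (-x))) := by gcongr
        _ = ‖c‖ * Real.exp (-x) * ((‖A x‖ + ‖B x‖) * ((‖A x‖ + ‖B x‖) / 2)) := by ring
        _ ≤ _ := by gcongr
    have hpos := Real.exp_pos (2 * ‖c‖ * Real.exp (-x))
    have : 2 * inner ℝ (A x) (c * (e x * solU m k x))
      + 2 * inner ℝ (B x) (c * (e x * solU m k x) - 2 * ray k x * B x)
      - 2 * ‖c‖ * Real.exp (-x) * N x ≤ 0 := by nlinarith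
    have h7 := mul_nonpos_of_nonpos_of_nonneg this hpos.le
    refine le_trans (le_of_eq ?_) h7
    ring
  have hN0 : N 0 ≤ 2 * D ^ 2 := by
    have hz : ‖ray k 0‖ = 1 := by rw [norm_ray, hk1, Real.exp_zero, one_mul]
    have p : ∀ j, ‖besselP m j (ray k 0)‖ ≤ b * Real.exp 1 := fun j => by
      have := hb j (ray k 0); rwa [hz] at this
    have u0 : ‖solU m k 0‖ ≤ b * Real.exp 1 := by simpa [solU] using p 0
    have u1 : ‖solU' m k 0‖ ≤ (‖m‖ + 1) * (b * Real.exp 1) := by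
      have : solU' m k 0 = m * besselP m 0 (ray k 0) + ray k 0 * besselP m 1 (ray k 0) := by
        simp [solU']
      rw [this]
      refine (norm_add_le _ _).trans ?_
      rw [norm_mul, norm_mul, hz]
      nlinarith [mul_le_mul_of_nonneg_left (p 0) (norm_nonneg m), p 1]
    have e0 : ‖e 0‖ ≤ 1 := by
      rw [he]
      simp only [Complex.norm_exp]
      refine Real.exp_le_one_iff.2 ?_
      have := ray_re_nonneg hk 0
      simpa using this
    have z0 : ‖ray k 0 * solU m k 0‖ ≤ b * Real.exp 1 := by rw [norm_mul, hz, one_mul]; exact u0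
    have h2 : ‖solU m k 0 / 2‖ ≤ b * Real.exp 1 := by
      rw [norm_div, Complex.norm_two]; linarith [norm_nonneg (solU m k 0)]
    have a0 : ‖A 0‖ ≤ D := by
      rw [hA, hD]
      simp only [norm_mul]
      refine (mul_le_of_le_one_left (norm_nonneg _) e0).trans ?_
      have := norm_add₃_le (a := solU' m k 0) (b := solU m k 0 / 2) (c := ray k 0 * solU m k 0)
      linarith
    have b0 : ‖B 0‖ ≤ D := by
      rw [hB, hD]
      simp only [norm_mul]
      refine (mul_le_of_le_one_left (norm_nonneg _) e0).trans ?_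
      have h3 := norm_sub_le (solU' m k 0 + solU m k 0 / 2) (ray k 0 * solU m k 0)
      have h4 := norm_add_le (solU' m k 0) (solU m k 0 / 2)
      linarith
    rw [hN]
    have := pow_le_pow_left₀ (norm_nonneg _) a0 2
    have := pow_le_pow_left₀ (norm_nonneg _) b0 2
    simp only
    linarith
  have hNx : N x ≤ (2 * D * Real.exp ‖c‖) ^ 2 := by
    have h1 : N x ≤ G x := by
      refine le_mul_of_one_le_right (by positivity) (Real.one_le_exp (by positivity))
    have h2 : G 0 ≤ 2 * D ^ 2 * Real.exp (2 * ‖c‖) := by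
      simp only [hG, neg_zero, Real.exp_zero, mul_one]
      gcongr
    have h3 : Real.exp (2 * ‖c‖) = Real.exp ‖c‖ ^ 2 := by rw [← Real.exp_nat_mul]; norm_num
    have h4 := hanti hx
    rw [h3] at h2
    nlinarith [sq_nonneg (D * Real.exp ‖c‖)]
  have hAx : ‖A x‖ ≤ 2 * D * Real.exp ‖c‖ := by
    refine abs_le_of_sq_le_sq' ?_ (by positivity) |>.2
    exact le_trans (le_add_of_nonneg_right (sq_nonneg ‖B x‖)) hNx
  have hBx : ‖B x‖ ≤ 2 * D * Real.exp ‖c‖ := by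
    refine abs_le_of_sq_le_sq' ?_ (by positivity) |>.2
    exact le_trans (le_add_of_nonneg_left (sq_nonneg ‖A x‖)) hNx
  have hexp : ‖e x‖ = Real.exp (-(x / 2) - k.re * Real.exp x) := by
    rw [he]
    simp only [Complex.norm_exp, Complex.sub_re, ray_re, Complex.neg_re]
    norm_num
  have h5 := hAB x
  rw [norm_mul, hexp] at h5
  have h6 : ‖solU m k x‖ = ‖A x - B x‖ / 2 * Real.exp (k.re * Real.exp x - x / 2) := by
    have : Real.exp (k.re * Real.exp x - x / 2)
        = Real.exp (-x) * (Real.exp (-(x / 2) - k.re * Real.exp x))⁻¹ := by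
      rw [← Real.exp_neg, ← Real.exp_add]; congr 1; ring
    rw [this, Real.exp_neg]
    field_simp at h5 ⊢
    linarith
  rw [h6]
  refine mul_le_mul_of_nonneg_right ?_ (Real.exp_pos _).le
  have := norm_sub_le (A x) (B x)
  linarith

theorem ray_log_norm_add {k : ℂ} (hk : k ≠ 0) (x : ℝ) :
    ray (k / ‖k‖) (Real.log ‖k‖ + x) = ray k x := by
  have h : 0 < ‖k‖ := norm_pos_iff.2 hk
  rw [ray, ray, Real.exp_add, Real.exp_log h]
  have : (‖k‖ : ℂ) ≠ 0 := Complex.ofReal_ne_zero.2 h.ne'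
  push_cast
  field_simp

/-- The growth bound of `P` at `z = k eˣ`, uniform in `k`: the energy bound for `|k| = 1`, moved to
all `k ≠ 0` by the translation `x ↦ x + log |k|`. -/
theorem exists_norm_besselP_ray_le {m : ℂ} (hm : 0 < m.re) :
    ∃ C, 0 ≤ C ∧ ∀ (k : ℂ) (x : ℝ), 0 ≤ k.re →
      (‖ray k x‖ ≤ 1 → ‖besselP m 0 (ray k x)‖ ≤ C) ∧
      (k ≠ 0 → 0 ≤ Real.log ‖k‖ + x → ‖besselP m 0 (ray k x)‖
        ≤ C * Real.exp ((ray k x).re - (m.re + 1 / 2) * (Real.log ‖k‖ + x))) := by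
  obtain ⟨b, hb0, hb⟩ := exists_norm_besselP_le hm
  obtain ⟨C, hC0, hC⟩ := exists_norm_solU_le hm
  refine ⟨b * Real.exp 1 + C, by positivity, fun k x hk => ⟨fun hz => ?_, fun hk0 hξ => ?_⟩⟩
  · refine (hb 0 _).trans ?_
    have : b * Real.exp ‖ray k x‖ ≤ b * Real.exp 1 := by gcongr
    linarith
  · have hkp : 0 < ‖k‖ := norm_pos_iff.2 hk0
    have h1 : ‖k / (‖k‖ : ℂ)‖ = 1 := by
      rw [norm_div, Complex.norm_real, norm_norm, div_self hkp.ne']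
    have h2 : 0 ≤ (k / (‖k‖ : ℂ)).re := by
      rw [Complex.div_ofReal_re]; positivity
    have h3 := hC _ h1 h2 _ hξ
    rw [← ray_re, solU, ray_log_norm_add hk0, norm_mul, Complex.norm_exp] at h3
    have h4 : (m * ((Real.log ‖k‖ + x : ℝ) : ℂ)).re = m.re * (Real.log ‖k‖ + x) := by
      rw [Complex.re_mul_ofReal]
    rw [h4] at h3
    have h5 : Real.exp ((ray k x).re - (m.re + 1 / 2) * (Real.log ‖k‖ + x))
        = Real.exp ((ray k x).re - (Real.log ‖k‖ + x) / 2)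
          * (Real.exp (m.re * (Real.log ‖k‖ + x)))⁻¹ := by
      rw [← Real.exp_neg, ← Real.exp_add]; congr 1; ring
    rw [h5, ← mul_assoc, ← div_eq_mul_inv, le_div_iff₀ (Real.exp_pos _), mul_comm]
    refine h3.trans (mul_le_mul_of_nonneg_right ?_ (Real.exp_pos _).le)
    have : 0 ≤ b * Real.exp 1 := by positivity
    linarith

theorem norm_ray_eq_exp {k : ℂ} (hk : k ≠ 0) (x : ℝ) :
    ‖ray k x‖ = Real.exp (Real.log ‖k‖ + x) := by
  rw [norm_ray, Real.exp_add, Real.exp_log (norm_pos_iff.2 hk)]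

theorem exists_norm_laplaceF_ray_le {m : ℂ} (hm : 0 < m.re) :
    ∃ C, 0 ≤ C ∧ ∀ (k : ℂ) (x : ℝ), 0 ≤ k.re →
      (‖ray k x‖ ≤ 1 → ‖laplaceF (m - 1 / 2) (m - 1 / 2) (ray k x)‖ ≤ C) ∧
      (k ≠ 0 → 0 ≤ Real.log ‖k‖ + x → ‖laplaceF (m - 1 / 2) (m - 1 / 2) (ray k x)‖
        ≤ C * Real.exp ((m.re - 1 / 2) * (Real.log ‖k‖ + x))) := by
  have hre : (m - 1 / 2).re = m.re - 1 / 2 := by simp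
  obtain ⟨C₁, h₁, H₁⟩ := exists_norm_laplaceF_self_le (a := m - 1 / 2) (by rw [hre]; linarith)
  obtain ⟨C₂, h₂, H₂⟩ := exists_norm_laplaceF_le (a := m - 1 / 2) (by rw [hre]; linarith)
    (m - 1 / 2)
  refine ⟨C₁ + C₂, by positivity, fun k x hk => ⟨fun hz => ?_, fun hk0 hξ => ?_⟩⟩
  · exact (H₁ _ (ray_re_nonneg hk x) hz).trans (by linarith)
  · have hz : 1 ≤ ‖ray k x‖ := by rw [norm_ray_eq_exp hk0]; exact Real.one_le_exp hξ
    refine (H₂ _ (ray_re_nonneg hk x) hz).trans ?_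
    rw [norm_ray_eq_exp hk0, ← Real.exp_mul, hre, mul_comm (Real.log ‖k‖ + x)]
    exact mul_le_mul_of_nonneg_right (by linarith) (Real.exp_pos _).le

theorem norm_solU (m k : ℂ) (x : ℝ) :
    ‖solU m k x‖ = Real.exp (m.re * x) * ‖besselP m 0 (ray k x)‖ := by
  rw [solU, norm_mul, Complex.norm_exp, Complex.re_mul_ofReal]

theorem norm_cexp_neg_mul_sub_ray (m k : ℂ) (x : ℝ) :
    ‖Complex.exp (-m * x - ray k x)‖ = Real.exp (-m.re * x - (ray k x).re) := by
  rw [Complex.norm_exp, Complex.sub_re, Complex.re_mul_ofReal, Complex.neg_re]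

/-- The Green kernel decays exponentially off the diagonal, uniformly in the closed half-plane
`Re k ≥ 0`. -/
theorem exists_norm_solU_mul_norm_solV_le {m : ℂ} (hm : 0 < m.re) :
    ∃ C, ∀ k : ℂ, 0 ≤ k.re → ∀ x y : ℝ, x ≤ y →
      ‖solU m k x‖ * ‖solV m k y‖ ≤ C * Real.exp (-(min m.re (1 / 2)) * (y - x)) := by
  obtain ⟨C₁, h₁, H₁⟩ := exists_norm_besselP_ray_le hm
  obtain ⟨C₂, h₂, H₂⟩ := exists_norm_laplaceF_ray_le hm
  refine ⟨C₁ * C₂, fun k hk x y hxy => ?_⟩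
  set μ := m.re
  set δ := min μ (1 / 2) with hδ
  have hδμ : δ ≤ μ := min_le_left _ _
  have hδ2 : δ ≤ 1 / 2 := min_le_right _ _
  rw [norm_solU, solV, norm_mul, norm_cexp_neg_mul_sub_ray]
  -- it remains to compare exponents
  have key : ∀ p f : ℝ, ‖besselP m 0 (ray k x)‖ ≤ C₁ * Real.exp p →
      ‖laplaceF (m - 1 / 2) (m - 1 / 2) (ray k y)‖ ≤ C₂ * Real.exp f →
      μ * x + p + (-μ * y - (ray k y).re) + f ≤ -δ * (y - x) →
      Real.exp (μ * x) * ‖besselP m 0 (ray k x)‖ * (Real.exp (-μ * y - (ray k y).re)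
        * ‖laplaceF (m - 1 / 2) (m - 1 / 2) (ray k y)‖) ≤ C₁ * C₂ * Real.exp (-δ * (y - x)) := by
    intro p f hp hf hle
    calc _ ≤ Real.exp (μ * x) * (C₁ * Real.exp p) * (Real.exp (-μ * y - (ray k y).re)
          * (C₂ * Real.exp f)) := by gcongr
      _ = C₁ * C₂ * Real.exp (μ * x + p + (-μ * y - (ray k y).re) + f) := by
          rw [Real.exp_add, Real.exp_add, Real.exp_add]; ring
      _ ≤ _ := by gcongr
  have hry := ray_re_nonneg hk y
  have hsmall : ‖ray k y‖ ≤ 1 → ‖ray k x‖ ≤ 1 := fun h => by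
    refine le_trans ?_ h
    rw [norm_ray, norm_ray]; gcongr
  by_cases hy1 : ‖ray k y‖ ≤ 1
  · refine key 0 0 (by simpa using (H₁ k x hk).1 (hsmall hy1)) (by simpa using (H₂ k y hk).1 hy1) ?_
    nlinarith
  · have hk0 : k ≠ 0 := by
      rintro rfl
      exact hy1 (by simp [ray_zero])
    have hη : 0 ≤ Real.log ‖k‖ + y := by
      rw [norm_ray_eq_exp hk0, Real.exp_le_one_iff] at hy1; linarith
    rcases le_total (Real.log ‖k‖ + x) 0 with hξ | hξ
    · have hx1 : ‖ray k x‖ ≤ 1 := by rw [norm_ray_eq_exp hk0]; exact Real.exp_le_one_iff.2 hξ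
      refine key 0 _ (by simpa using (H₁ k x hk).1 hx1) ((H₂ k y hk).2 hk0 hη) ?_
      nlinarith [mul_nonneg (sub_nonneg.2 hδμ) (neg_nonneg.2 hξ),
        mul_nonneg (sub_nonneg.2 hδ2) hη]
    · have hrxy : (ray k x).re ≤ (ray k y).re := by
        rw [ray_re, ray_re]; gcongr
      refine key _ _ ((H₁ k x hk).2 hk0 hξ) ((H₂ k y hk).2 hk0 hη) ?_
      nlinarith [mul_nonneg (sub_nonneg.2 hδ2) (sub_nonneg.2 hxy)]

/-- A constant, independent of `k`, in the exponential bound of the Green kernel. -/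
def greenConst (m : ℂ) (hm : 0 < m.re) : ℝ := (exists_norm_solU_mul_norm_solV_le hm).choose

theorem memLp_two_of_norm_le_exp {f : ℝ → ℂ} {s : Set ℝ} {D δ : ℝ} (hs : MeasurableSet s)
    (hf : Continuous f) (h : ∀ x ∈ s, ‖f x‖ ≤ D * Real.exp (δ * x))
    (hi : IntegrableOn (fun x => Real.exp (2 * δ * x)) s volume) :
    MemLp f 2 (volume.restrict s) := by
  have he : MemLp (fun x : ℝ => Real.exp (δ * x)) 2 (volume.restrict s) := by
    rw [memLp_two_iff_integrable_sq (Continuous.aestronglyMeasurable (by fun_prop))]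
    refine hi.congr (ae_of_all _ fun x => ?_)
    simp only
    rw [← Real.exp_nat_mul]
    congr 1; push_cast; ring
  refine he.of_le_mul (c := D) hf.aestronglyMeasurable
    ((ae_restrict_iff' hs).2 (ae_of_all _ fun x hx => ?_))
  rw [Real.norm_of_nonneg (Real.exp_pos _).le]
  exact h x hx

theorem exists_norm_solV_le {m k : ℂ} (hm : 0 < m.re) (hk : 0 ≤ k.re) (x : ℝ) :
    ∃ D, ∀ y, x ≤ y → ‖solV m k y‖ ≤ D * Real.exp (-(min m.re (1 / 2)) * y) := by
  -- `U` does not vanish near `-∞`, so the bound of the kernel bounds `V`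
  have h1 : Tendsto (fun y => besselP m 0 (ray k y)) atBot (𝓝 (besselP m 0 0)) :=
    ((continuous_besselP hm 0).tendsto 0).comp (tendsto_ray_atBot k)
  obtain ⟨x₀, hx₀, hx₀x⟩ := ((h1.eventually_ne (besselP_zero_zero_ne_zero hm)).and
    (eventually_le_atBot x)).exists
  have hU : 0 < ‖solU m k x₀‖ := norm_pos_iff.2 (mul_ne_zero (Complex.exp_ne_zero _) hx₀)
  obtain ⟨C, hC⟩ := exists_norm_solU_mul_norm_solV_le hm
  refine ⟨C / ‖solU m k x₀‖ * Real.exp ((min m.re (1 / 2)) * x₀), fun y hy => ?_⟩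
  have := hC k hk x₀ y (hx₀x.trans hy)
  rw [mul_assoc, ← Real.exp_add, div_mul_eq_mul_div, le_div_iff₀ hU, mul_comm]
  refine this.trans (le_of_eq ?_)
  congr 2; ring

theorem continuous_expPot (k : ℂ) : Continuous (expPot k) := by unfold expPot; fun_prop

/-- The Green pair of `-∂² + k² e^{2x}` at `-m²`, for all `Re k ≥ 0`. -/
theorem greenPair {m k : ℂ} (hm : 0 < m.re) (hk : 0 ≤ k.re) :
    GreenPair (expPot k) (solU m k) (solU' m k) (solV m k) (solV' m k) m (solW m)
      (greenConst m hm) (min m.re (1 / 2)) := by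
  obtain ⟨b, hb0, hb⟩ := exists_norm_besselP_le hm
  have hδ : 0 < min m.re (1 / 2) := lt_min hm (by norm_num)
  have cU : Continuous (solU m k) :=
    continuous_iff_continuousAt.2 fun x => (hasDerivAt_solU hm k x).continuousAt
  have cV : Continuous (solV m k) :=
    continuous_iff_continuousAt.2 fun x => (hasDerivAt_solV hm hk x).continuousAt
  have hP : ∀ (j : ℕ) (x y : ℝ), y ≤ x →
      ‖besselP m j (ray k y)‖ ≤ b * Real.exp (‖k‖ * Real.exp x) := fun j x y hy => by
    refine (hb j _).trans ?_
    rw [norm_ray]; gcongr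
  refine ⟨continuous_expPot k, hasDerivAt_solU hm k, hasDerivAt_solU' hm k, hasDerivAt_solV hm hk,
    hasDerivAt_solV' hm hk, wronskian_sol hm hk, solW_ne_zero hm, hδ,
    (exists_norm_solU_mul_norm_solV_le hm).choose_spec k hk, fun x => ?_, fun x => ?_, ?_⟩
  · refine memLp_two_of_norm_le_exp (D := b * Real.exp (‖k‖ * Real.exp x)) (δ := m.re)
      measurableSet_Iic cU (fun y hy => ?_) (integrableOn_exp_mul_Iic (by linarith) x)
    rw [norm_solU, mul_comm]
    exact mul_le_mul_of_nonneg_right (hP 0 x y hy) (Real.exp_pos _).le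
  · obtain ⟨D, hD⟩ := exists_norm_solV_le hm hk x
    exact memLp_two_of_norm_le_exp measurableSet_Ioi cV (fun y hy => hD y (le_of_lt hy))
      (integrableOn_exp_mul_Ioi (by linarith) x)
  · refine ⟨(1 + ‖m‖ + ‖k‖) * (b * Real.exp (‖k‖ * Real.exp 0)), ?_⟩
    filter_upwards [eventually_le_atBot (0 : ℝ)] with x hx
    have p0 := hP 0 0 x hx
    have p1 := hP 1 0 x hx
    have he : Real.exp (m.re * x) ≤ 1 := Real.exp_le_one_iff.2 (by nlinarith)
    have hz : ‖ray k x‖ ≤ ‖k‖ := by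
      rw [norm_ray]
      exact mul_le_of_le_one_right (norm_nonneg _) (Real.exp_le_one_iff.2 hx)
    set M := b * Real.exp (‖k‖ * Real.exp 0) with hM
    have hM0 : 0 ≤ M := by positivity
    constructor
    · rw [norm_solU]
      have := mul_le_mul he p0 (norm_nonneg _) zero_le_one
      nlinarith [norm_nonneg m, norm_nonneg k]
    · rw [solU', norm_mul, Complex.norm_exp, Complex.re_mul_ofReal]
      refine (mul_le_of_le_one_left (norm_nonneg _) he).trans ((norm_add_le _ _).trans ?_)
      rw [norm_mul, norm_mul]
      have q0 := mul_le_mul_of_nonneg_left p0 (norm_nonneg m)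
      have q1 := mul_le_mul hz p1 (norm_nonneg _) (norm_nonneg k)
      nlinarith

/-! ### Boundary conditions at `+∞` -/

theorem exists_norm_solV_le_const {m k : ℂ} (hm : 0 < m.re) (hk : 0 ≤ k.re) :
    ∃ D, ∀ y, 0 ≤ y → ‖solV m k y‖ ≤ D := by
  obtain ⟨D, hD⟩ := exists_norm_solV_le hm hk 0
  have hδ : 0 < min m.re (1 / 2) := lt_min hm (by norm_num)
  refine ⟨|D|, fun y hy => (hD y hy).trans ?_⟩
  have : Real.exp (-(min m.re (1 / 2)) * y) ≤ 1 := Real.exp_le_one_iff.2 (by nlinarith)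
  calc _ ≤ |D| * Real.exp (-(min m.re (1 / 2)) * y) :=
        mul_le_mul_of_nonneg_right (le_abs_self _) (Real.exp_pos _).le
    _ ≤ _ := mul_le_of_le_one_right (abs_nonneg _) this

theorem eventually_one_le_norm_ray {k : ℂ} (hk : k ≠ 0) : ∀ᶠ x in atTop, 1 ≤ ‖ray k x‖ := by
  filter_upwards [eventually_ge_atTop (-Real.log ‖k‖)] with x hx
  rw [norm_ray_eq_exp hk]
  exact Real.one_le_exp (by linarith)

/-- For `Re k > 0` and for `k = 0`, both `V` and `V'` are bounded at `+∞`. -/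
theorem eventually_norm_solV_le {m k : ℂ} (hm : 0 < m.re) (hk : 0 < k.re ∨ k = 0) :
    ∃ K, ∀ᶠ x in atTop, ‖solV m k x‖ ≤ K ∧ ‖solV' m k x‖ ≤ K := by
  have hk' : 0 ≤ k.re := by
    rcases hk with h | rfl
    · exact h.le
    · simp
  obtain ⟨D, hD⟩ := exists_norm_solV_le_const hm hk'
  suffices h : ∃ K, ∀ᶠ x in atTop, ‖solV' m k x‖ ≤ K by
    obtain ⟨K, hK⟩ := h
    refine ⟨max D K, ?_⟩
    filter_upwards [eventually_ge_atTop 0, hK] with x hx hx'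
    exact ⟨(hD x hx).trans (le_max_left _ _), hx'.trans (le_max_right _ _)⟩
  rcases hk with hk | rfl
  · have hk0 : k ≠ 0 := fun h => by rw [h] at hk; simp at hk
    set a := m - 1 / 2 with ha
    have hare : a.re = m.re - 1 / 2 := by simp [ha]
    obtain ⟨C₁, h₁, H₁⟩ := exists_norm_laplaceF_le (a := a) (by rw [hare]; linarith) a
    obtain ⟨C₂, h₂, H₂⟩ := exists_norm_laplaceF_le (a := a) (by rw [hare]; linarith) (a - 1)
    set p : ℝ := |a.re| + 1 with hp
    set E := (‖m‖ + 1) * C₁ + ‖a‖ * C₂ with hE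
    have hE0 : 0 ≤ E := by positivity
    have hdec : Tendsto (fun x : ℝ => E * ‖k‖ ^ p * (Real.exp x ^ p
        * Real.exp (-k.re * Real.exp x))) atTop (𝓝 (E * ‖k‖ ^ p * 0)) :=
      ((tendsto_rpow_mul_exp_neg_mul_atTop_nhds_zero p k.re hk).comp
        Real.tendsto_exp_atTop).const_mul _
    rw [mul_zero] at hdec
    refine ⟨1, ?_⟩
    filter_upwards [eventually_one_le_norm_ray hk0, eventually_ge_atTop 0,
      hdec.eventually_lt_const one_pos] with x hz hx hlt
    refine le_trans ?_ hlt.le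
    have f1 := H₁ _ (ray_re_nonneg hk' x) hz
    have f2 := H₂ _ (ray_re_nonneg hk' x) hz
    set r := ‖ray k x‖ with hr
    have hr0 : 0 < r := by linarith
    have g1 : ‖(-m - ray k x) * laplaceF a a (ray k x)‖ ≤ (‖m‖ + 1) * C₁ * r ^ p := by
      rw [norm_mul]
      have q1 : ‖-m - ray k x‖ ≤ (‖m‖ + 1) * r := by
        refine (norm_sub_le _ _).trans ?_
        rw [norm_neg]
        nlinarith [norm_nonneg m]
      have q2 : r ^ p = r * r ^ |a.re| := by
        rw [hp, Real.rpow_add hr0, Real.rpow_one, mul_comm]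
      have q3 : r ^ a.re ≤ r ^ |a.re| := Real.rpow_le_rpow_of_exponent_le hz (le_abs_self _)
      calc _ ≤ ((‖m‖ + 1) * r) * (C₁ * r ^ a.re) := by gcongr
        _ ≤ ((‖m‖ + 1) * r) * (C₁ * r ^ |a.re|) := by gcongr
        _ = _ := by rw [q2]; ring
    have g2 : ‖a * ray k x * laplaceF a (a - 1) (ray k x)‖ ≤ ‖a‖ * C₂ * r ^ p := by
      rw [norm_mul, norm_mul]
      have q2 : r * r ^ (a - 1).re = r ^ a.re := by
        rw [Complex.sub_re, Complex.one_re, Real.rpow_sub_one hr0.ne']; field_simp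
      have q3 : r ^ a.re ≤ r ^ p :=
        Real.rpow_le_rpow_of_exponent_le hz ((le_abs_self _).trans (by linarith))
      calc _ ≤ ‖a‖ * r * (C₂ * r ^ (a - 1).re) := by gcongr
        _ = ‖a‖ * C₂ * (r * r ^ (a - 1).re) := by ring
        _ ≤ _ := by rw [q2]; gcongr
    rw [solV', ← ha, norm_mul, norm_cexp_neg_mul_sub_ray, ray_re]
    have g3 : Real.exp (-m.re * x - k.re * Real.exp x) ≤ Real.exp (-k.re * Real.exp x) := by
      gcongr; nlinarith
    have g4 := (norm_add_le _ _).trans (add_le_add g1 g2)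
    calc _ ≤ Real.exp (-k.re * Real.exp x) * ((‖m‖ + 1) * C₁ * r ^ p + ‖a‖ * C₂ * r ^ p) := by
          gcongr
      _ = _ := by
          rw [hr, norm_ray, Real.mul_rpow (norm_nonneg _) (Real.exp_pos _).le]
          ring
  · refine ⟨‖m‖ * D, ?_⟩
    filter_upwards [eventually_ge_atTop 0] with x hx
    have : solV' m 0 x = -m * solV m 0 x := by
      simp only [solV', solV, ray_zero, mul_zero, zero_mul, sub_zero, add_zero]; ring
    rw [this, norm_mul, norm_neg]
    exact mul_le_mul_of_nonneg_left (hD x hx) (norm_nonneg _)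

theorem ray_cpow {k : ℂ} (hk : k ≠ 0) (x : ℝ) (a : ℂ) :
    ray k x ^ a = k ^ a * Complex.exp (a * x) := by
  rw [Complex.cpow_def_of_ne_zero (ray_ne_zero hk x), Complex.cpow_def_of_ne_zero hk, ray,
    Complex.log_mul_ofReal _ (Real.exp_pos x) _ hk, Real.log_exp, ← Complex.exp_add]
  congr 1; ring

/-- For imaginary `k ≠ 0`, the boundary condition set by `V` is the one set by a multiple of
`e^{-x/2} e^{-z}`, `z = k eˣ`, the leading term of `V` at `+∞`. -/
theorem bcRealization_solV_of_re_eq_zero {m k c₁ : ℂ} (hm : 0 < m.re) (hk : k.re = 0) (hk0 : k ≠ 0)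
    (hc₁ : c₁ ≠ 0) : bcRealization (expPot k) (solV m k)
      = bcRealization (expPot k) fun x => c₁ * Complex.exp (-(x / 2 : ℂ) - ray k x) := by
  set a := m - 1 / 2 with ha
  have hare : a.re = m.re - 1 / 2 := by simp [ha]
  set Γ := Complex.Gamma (a + 1) with hΓ
  have hΓ0 : Γ ≠ 0 := Complex.Gamma_ne_zero_of_re_pos (by
    rw [Complex.add_re, Complex.one_re, hare]; linarith)
  have hka : k ^ a ≠ 0 := by rw [Complex.cpow_ne_zero_iff]; exact Or.inl hk0
  set h : ℝ → ℂ := fun x => Complex.exp (-(x / 2 : ℂ) - ray k x) with hh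
  have dh : ∀ x, HasDerivAt h (h x * (-(1 / 2) - ray k x)) x := fun x => by
    have h1 : HasDerivAt (fun x : ℝ => -((x : ℂ) / 2)) (-((1 : ℂ) / 2)) x :=
      (((hasDerivAt_id x).ofReal_comp).div_const 2).neg
    exact (h1.sub (hasDerivAt_ray k x)).cexp
  have hrez : ∀ x, (ray k x).re = 0 := fun x => by rw [ray_re, hk, zero_mul]
  obtain ⟨C₁, h₁, H₁⟩ := exists_norm_laplaceF_sub_le (a := a) (by rw [hare]; linarith) a
  obtain ⟨C₂, h₂, H₂⟩ := exists_norm_laplaceF_sub_le (a := a) (by rw [hare]; linarith) (a - 1)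
  have e0 : ∀ x, Γ * k ^ a * h x = Complex.exp (-m * x - ray k x) * (Γ * ray k x ^ a) := by
    intro x
    have : h x = Complex.exp (-m * x - ray k x) * Complex.exp (a * x) := by
      simp only [hh]
      rw [← Complex.exp_add, ha]; congr 1; ring
    rw [this, ray_cpow hk0]; ring
  have e1 : ∀ x, solV m k x - Γ * k ^ a / c₁ * (c₁ * h x)
      = Complex.exp (-m * x - ray k x) * (laplaceF a a (ray k x) - Γ * ray k x ^ a) := by
    intro x
    have : Γ * k ^ a / c₁ * (c₁ * h x) = Γ * k ^ a * h x := by field_simp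
    rw [this, e0, solV]; ring
  have e2 : ∀ x, solV' m k x - Γ * k ^ a / c₁ * (c₁ * (h x * (-(1 / 2) - ray k x)))
      = Complex.exp (-m * x - ray k x) * ((-m - ray k x) * (laplaceF a a (ray k x)
        - Γ * ray k x ^ a) + a * ray k x * (laplaceF a (a - 1) (ray k x)
        - Γ * ray k x ^ (a - 1))) := by
    intro x
    have h3 : Γ * k ^ a / c₁ * (c₁ * (h x * (-(1 / 2) - ray k x)))
        = Γ * k ^ a * h x * (-(1 / 2) - ray k x) := by field_simp
    have h4 : ray k x ^ a = ray k x ^ (a - 1) * ray k x := by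
      conv_lhs => rw [show a = a - 1 + 1 by ring,
        Complex.cpow_add _ _ (ray_ne_zero hk0 x), Complex.cpow_one]
    rw [h3, e0, solV', ← ha, h4]
    simp only [ha]
    ring
  have hdom : ∀ x, 0 ≤ x → 1 ≤ ‖ray k x‖ →
      Real.exp (-m.re * x - (ray k x).re) * ‖ray k x‖ ^ a.re ≤ ‖k‖ ^ a.re := by
    intro x hx _
    rw [hrez, sub_zero, norm_ray, Real.mul_rpow (norm_nonneg _) (Real.exp_pos _).le, ← Real.exp_mul]
    have : Real.exp (-m.re * x) * Real.exp (x * a.re) ≤ 1 := by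
      rw [← Real.exp_add]
      exact Real.exp_le_one_iff.2 (by rw [hare]; nlinarith)
    calc _ = ‖k‖ ^ a.re * (Real.exp (-m.re * x) * Real.exp (x * a.re)) := by ring
      _ ≤ _ := mul_le_of_le_one_right (by positivity) this
  refine (greenPair hm hk.ge).bcRealization_congr (H := fun x => c₁ * h x)
    (H' := fun x => c₁ * (h x * (-(1 / 2) - ray k x))) (c := Γ * k ^ a / c₁) (d := 1 / 4)
    (K := ((‖m‖ + 1) * C₁ + ‖a‖ * C₂) * ‖k‖ ^ a.re)
    (div_ne_zero (mul_ne_zero hΓ0 hka) hc₁) (fun x => (dh x).const_mul c₁) (fun x => ?_) ?_ ?_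
  · refine (((dh x).mul ((hasDerivAt_ray k x).const_sub (-(1 / 2)))).const_mul c₁).congr_deriv ?_
    rw [expPot_eq_ray_sq]; ring
  · have ch : Continuous h := continuous_iff_continuousAt.2 fun x => (dh x).continuousAt
    refine memLp_two_of_norm_le_exp (D := ‖c₁‖) (δ := -(1 / 2)) measurableSet_Ioi (by fun_prop)
      (fun x _ => ?_) (integrableOn_exp_mul_Ioi (by norm_num) 0)
    rw [norm_mul, hh]
    simp only [Complex.norm_exp, Complex.sub_re, hrez]
    refine le_of_eq ?_
    congr 2
    simp; ring
  · filter_upwards [eventually_ge_atTop 0, eventually_one_le_norm_ray hk0] with x hx hz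
    have f1 := H₁ _ (ray_re_nonneg hk.ge x) hz
    have f2 := H₂ _ (ray_re_nonneg hk.ge x) hz
    have hd := hdom x hx hz
    rw [e1, e2]
    set r := ‖ray k x‖ with hr
    have hr0 : 0 < r := by linarith
    have q1 : r * r ^ (a.re - 1) = r ^ a.re := by rw [Real.rpow_sub_one hr0.ne']; field_simp
    have q0 : r ^ (a.re - 1) ≤ r ^ a.re := Real.rpow_le_rpow_of_exponent_le hz (by linarith)
    have q2 : r ^ ((a - 1).re - 1) ≤ r ^ (a.re - 1) :=
      Real.rpow_le_rpow_of_exponent_le hz (by simp)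
    set X := Real.exp (-m.re * x - (ray k x).re) with hX
    have hX0 : 0 < X := Real.exp_pos _
    have hra : 0 ≤ r ^ a.re := by positivity
    have f1' : ‖laplaceF a a (ray k x) - Γ * ray k x ^ a‖ ≤ C₁ * r ^ a.re :=
      f1.trans (by gcongr)
    constructor
    · rw [norm_mul, norm_cexp_neg_mul_sub_ray, ← hX]
      calc _ ≤ X * (C₁ * r ^ a.re) := by gcongr
        _ = C₁ * (X * r ^ a.re) := by ring
        _ ≤ C₁ * ‖k‖ ^ a.re := by gcongr
        _ ≤ _ := by
            refine mul_le_mul_of_nonneg_right ?_ (by positivity)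
            have := mul_nonneg (norm_nonneg m) h₁
            have := mul_nonneg (norm_nonneg a) h₂
            linarith
    · rw [norm_mul, norm_cexp_neg_mul_sub_ray, ← hX]
      have g1 : ‖(-m - ray k x) * (laplaceF a a (ray k x) - Γ * ray k x ^ a)‖
          ≤ (‖m‖ + 1) * C₁ * r ^ a.re := by
        rw [norm_mul]
        have q3 : ‖-m - ray k x‖ ≤ (‖m‖ + 1) * r := by
          refine (norm_sub_le _ _).trans ?_
          rw [norm_neg]
          nlinarith [norm_nonneg m]
        calc _ ≤ ((‖m‖ + 1) * r) * (C₁ * r ^ (a.re - 1)) := by gcongr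
          _ = (‖m‖ + 1) * C₁ * (r * r ^ (a.re - 1)) := by ring
          _ = _ := by rw [q1]
      have g2 : ‖a * ray k x * (laplaceF a (a - 1) (ray k x) - Γ * ray k x ^ (a - 1))‖
          ≤ ‖a‖ * C₂ * r ^ a.re := by
        rw [norm_mul, norm_mul]
        calc _ ≤ ‖a‖ * r * (C₂ * r ^ ((a - 1).re - 1)) := by gcongr
          _ ≤ ‖a‖ * r * (C₂ * r ^ (a.re - 1)) := by gcongr
          _ = ‖a‖ * C₂ * (r * r ^ (a.re - 1)) := by ring
          _ = _ := by rw [q1]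
      calc _ ≤ X * ((‖m‖ + 1) * C₁ * r ^ a.re + ‖a‖ * C₂ * r ^ a.re) := by
            gcongr; exact (norm_add_le _ _).trans (add_le_add g1 g2)
        _ = ((‖m‖ + 1) * C₁ + ‖a‖ * C₂) * (X * r ^ a.re) := by ring
        _ ≤ _ := by gcongr

theorem sqrt_two_div_pi_mul_exp {ℓ : ℝ} (hℓ : 0 < ℓ) (x : ℝ) :
    ((√(2 / (Real.pi * (ℓ * Real.exp x))) : ℝ) : ℂ)
      = (√(2 / (Real.pi * ℓ)) : ℝ) * Complex.exp (-(x / 2 : ℂ)) := by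
  have : √(2 / (Real.pi * (ℓ * Real.exp x))) = √(2 / (Real.pi * ℓ)) * Real.exp (-(x / 2)) := by
    have h1 : 2 / (Real.pi * (ℓ * Real.exp x)) = 2 / (Real.pi * ℓ) * Real.exp (-(x / 2)) ^ 2 := by
      rw [← Real.exp_nat_mul]
      have : ((2 : ℕ) : ℝ) * -(x / 2) = -x := by push_cast; ring
      rw [this, Real.exp_neg]
      field_simp
    rw [h1, Real.sqrt_mul (by positivity), Real.sqrt_sq (Real.exp_pos _).le]
  rw [this]
  push_cast
  rfl

/-- At `k = iℓ`, the leading term of `V` is a multiple of `H⁻_{1/2}(ℓ eˣ)`. -/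
theorem MInfty_eq {m : ℂ} (hm : 0 < m.re) {ℓ : ℝ} (hℓ : 0 < ℓ) :
    MInfty ℓ = bcRealization (expPot (Complex.I * ℓ)) (solV m (Complex.I * ℓ)) := by
  have hl : (ℓ : ℂ) ≠ 0 := Complex.ofReal_ne_zero.2 hℓ.ne'
  have hs : ((√(2 / (Real.pi * ℓ)) : ℝ) : ℂ) ≠ 0 := Complex.ofReal_ne_zero.2 (by positivity)
  rw [bcRealization_solV_of_re_eq_zero (c₁ := Complex.I * (√(2 / (Real.pi * ℓ)) : ℝ)) hm (by simp)
    (mul_ne_zero Complex.I_ne_zero hl) (mul_ne_zero Complex.I_ne_zero hs), MInfty]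
  congr 1
  funext x
  rw [hankelHalfMinus, sqrt_two_div_pi_mul_exp hℓ, ray, sub_eq_add_neg, Complex.exp_add]
  push_cast
  ring_nf

theorem expPot_neg (k : ℂ) : expPot (-k) = expPot k := by
  funext x; simp [expPot]

/-- At `k = -iℓ`, the leading term of `V` is a multiple of `H⁺_{1/2}(ℓ eˣ)`. -/
theorem MZero_eq {m : ℂ} (hm : 0 < m.re) {ℓ : ℝ} (hℓ : 0 < ℓ) :
    MZero ℓ = bcRealization (expPot (-(Complex.I * ℓ))) (solV m (-(Complex.I * ℓ))) := by
  have hl : (ℓ : ℂ) ≠ 0 := Complex.ofReal_ne_zero.2 hℓ.ne'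
  have hs : ((√(2 / (Real.pi * ℓ)) : ℝ) : ℂ) ≠ 0 := Complex.ofReal_ne_zero.2 (by positivity)
  rw [bcRealization_solV_of_re_eq_zero (c₁ := -Complex.I * (√(2 / (Real.pi * ℓ)) : ℝ)) hm (by simp)
    (neg_ne_zero.2 (mul_ne_zero Complex.I_ne_zero hl))
    (mul_ne_zero (neg_ne_zero.2 Complex.I_ne_zero) hs), MZero, expPot_neg]
  congr 1
  funext x
  rw [hankelHalfPlus, sqrt_two_div_pi_mul_exp hℓ, ray, sub_eq_add_neg, Complex.exp_add]
  push_cast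
  ring_nf

theorem extendedM_of_re_pos {k : ℂ} (hk : 0 < k.re) : extendedM k = M k := if_pos hk

theorem extendedM_zero : extendedM 0 = freeOp := by simp [extendedM]

theorem extendedM_I_mul {ℓ : ℝ} (hℓ : 0 < ℓ) : extendedM (Complex.I * ℓ) = MInfty ℓ := by
  simp [extendedM, hℓ]

theorem extendedM_neg_I_mul {ℓ : ℝ} (hℓ : 0 < ℓ) : extendedM (-(Complex.I * ℓ)) = MZero ℓ := by
  simp [extendedM, hℓ, hℓ.le]

/-- On the whole closed half-plane, `M_k` is the realization with the boundary condition set by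
`V`. -/
theorem extendedM_eq_bcRealization {m k : ℂ} (hm : 0 < m.re) (hk : 0 ≤ k.re) :
    extendedM k = bcRealization (expPot k) (solV m k) := by
  by_cases hmax : 0 < k.re ∨ k = 0
  · obtain ⟨K, hK⟩ := eventually_norm_solV_le hm hmax
    rw [(greenPair hm hk).bcRealization_eq_maxRealization hK]
    rcases hmax with h | rfl
    · rw [extendedM_of_re_pos h, M]
    · rw [extendedM_zero, freeOp]
      congr 1; funext x; simp [expPot]
  · push Not at hmax
    have hre : k.re = 0 := le_antisymm hmax.1 hk
    have him : k.im ≠ 0 := fun h => hmax.2 (Complex.ext hre h)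
    rcases him.lt_or_gt with h | h
    · have e : k = -(Complex.I * ((-k.im : ℝ) : ℂ)) := Complex.ext (by simp [hre]) (by simp)
      rw [e, extendedM_neg_I_mul (by linarith), MZero_eq hm (by linarith)]
    · have e : k = Complex.I * (k.im : ℂ) := Complex.ext (by simp [hre]) (by simp)
      rw [e, extendedM_I_mul h, MInfty_eq hm h]

theorem isResolventAt_extendedM {m k : ℂ} (hm : 0 < m.re) (hk : 0 ≤ k.re) :
    IsResolventAt (extendedM k) (-m ^ 2) (greenPair hm hk).op := by
  rw [extendedM_eq_bcRealization hm hk]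
  exact (greenPair hm hk).isResolventAt_op

/-! ### Continuity in the parameter -/

theorem continuous_solU_param {m : ℂ} (hm : 0 < m.re) (x : ℝ) : Continuous fun k => solU m k x := by
  have := continuous_besselP hm 0
  unfold solU ray
  fun_prop

theorem continuousOn_solV_param {m : ℂ} (hm : 0 < m.re) (x : ℝ) :
    ContinuousOn (fun k => solV m k x) {k : ℂ | 0 ≤ k.re} := by
  have hr : Continuous fun k => ray k x := by unfold ray; fun_prop
  have h1 : ContinuousOn (fun k => laplaceF (m - 1 / 2) (m - 1 / 2) (ray k x))
      {k : ℂ | 0 ≤ k.re} :=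
    (continuousOn_laplaceF_self (by simpa using hm)).comp hr.continuousOn
      fun k hk => ray_re_nonneg hk x
  have h2 : Continuous fun k => Complex.exp (-m * x - ray k x) := by fun_prop
  exact h2.continuousOn.mul h1

theorem tendsto_greenFun {m k₀ : ℂ} (hm : 0 < m.re) (hk₀ : 0 ≤ k₀.re) (f : L2) (x : ℝ) :
    Tendsto (fun k => greenFun (solU m k) (solV m k) (solW m) f x) (𝓝[{k : ℂ | 0 ≤ k.re}] k₀)
      (𝓝 (greenFun (solU m k₀) (solV m k₀) (solW m) f x)) := by
  have hδ : 0 < min m.re (1 / 2) := lt_min hm (by norm_num)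
  have hU : ∀ y, Tendsto (fun k => solU m k y) (𝓝[{k : ℂ | 0 ≤ k.re}] k₀) (𝓝 (solU m k₀ y)) :=
    fun y => ((continuous_solU_param hm y).tendsto k₀).mono_left nhdsWithin_le_nhds
  have hV : ∀ y, Tendsto (fun k => solV m k y) (𝓝[{k : ℂ | 0 ≤ k.re}] k₀) (𝓝 (solV m k₀ y)) :=
    fun y => continuousOn_solV_param hm y k₀ hk₀
  have hi := (integrable_expAvg hδ f x).const_mul (greenConst m hm)
  simp only [greenFun, ← integral_const_mul]
  refine Tendsto.const_mul _ (Tendsto.add ?_ ?_)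
  · refine tendsto_integral_filter_of_dominated_convergence _ ?_ ?_ hi.integrableOn
      (ae_of_all _ fun y => (hV x).mul ((hU y).mul_const _))
    · filter_upwards [self_mem_nhdsWithin] with k hk
      exact (((greenPair hm hk).integrableOn_U_mul (Lp.memLp f) x).const_mul _).1
    · filter_upwards [self_mem_nhdsWithin] with k hk
      refine (ae_restrict_iff' measurableSet_Iic).2 (ae_of_all _ fun y hy => ?_)
      have := (greenPair hm hk).norm_mul_le y x hy
      rw [norm_mul, norm_mul, ← mul_assoc, ← mul_assoc, mul_comm ‖solV m k x‖,
        abs_of_nonneg (sub_nonneg.2 hy)]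
      exact mul_le_mul_of_nonneg_right this (norm_nonneg _)
  · refine tendsto_integral_filter_of_dominated_convergence _ ?_ ?_ hi.integrableOn
      (ae_of_all _ fun y => (hU x).mul ((hV y).mul_const _))
    · filter_upwards [self_mem_nhdsWithin] with k hk
      exact (((greenPair hm hk).integrableOn_V_mul (Lp.memLp f) x).const_mul _).1
    · filter_upwards [self_mem_nhdsWithin] with k hk
      refine (ae_restrict_iff' measurableSet_Ioi).2 (ae_of_all _ fun y hy => ?_)
      have hy' : x ≤ y := le_of_lt hy
      have := (greenPair hm hk).norm_mul_le x y hy'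
      rw [norm_mul, norm_mul, ← mul_assoc, ← mul_assoc, abs_sub_comm,
        abs_of_nonneg (sub_nonneg.2 hy')]
      exact mul_le_mul_of_nonneg_right this (norm_nonneg _)

theorem inner_resolvent_extendedM {m k : ℂ} (hm : 0 < m.re) (hk : 0 ≤ k.re) (f g : L2) :
    inner ℂ g (resolvent (extendedM k) (-m ^ 2) f)
      = ∫ x, inner ℂ (g x) (greenFun (solU m k) (solV m k) (solW m) f x) := by
  rw [resolvent_eq (isResolventAt_extendedM hm hk), L2.inner_def]
  refine integral_congr_ae ?_
  filter_upwards [((greenPair hm hk).isRep_op f).2] with x hx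
  rw [hx]

/-- Weak continuity of the resolvent on the closed half-plane, by dominated convergence twice: for
the Green function at a point and for the matrix elements. -/
theorem weakTendsto_resolvent_extendedM {m k₀ : ℂ} (hm : 0 < m.re) (hk₀ : 0 ≤ k₀.re) :
    WeakTendsto (fun k : ℂ => resolvent (extendedM k) (-m ^ 2)) (𝓝[{k : ℂ | 0 ≤ k.re}] k₀)
      (resolvent (extendedM k₀) (-m ^ 2)) := by
  have hδ : 0 < min m.re (1 / 2) := lt_min hm (by norm_num)
  refine ContinuousLinearMapWOT.tendsto_iff_forall_inner_apply_tendsto.2 fun f g => ?_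
  simp only [ContinuousLinearMapWOT.ofCLM_apply]
  rw [inner_resolvent_extendedM hm hk₀]
  have hev : ∀ᶠ k in 𝓝[{k : ℂ | 0 ≤ k.re}] k₀,
      ∫ x, inner ℂ (g x) (greenFun (solU m k) (solV m k) (solW m) f x)
        = inner ℂ g (resolvent (extendedM k) (-m ^ 2) f) := by
    filter_upwards [self_mem_nhdsWithin] with k hk
    rw [inner_resolvent_extendedM hm hk]
  refine Tendsto.congr' hev ?_
  have hb : Integrable (fun x => ‖g x‖ * (‖(solW m)⁻¹‖ * greenConst m hm
      * expAvg (min m.re (1 / 2)) f x)) volume :=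
    (Lp.memLp g).norm.integrable_mul ((memLp_expAvg hδ f).const_mul _)
  refine tendsto_integral_filter_of_dominated_convergence _ ?_ ?_ hb
    (ae_of_all _ fun x => (tendsto_const_nhds (x := g x)).inner (tendsto_greenFun hm hk₀ f x))
  · filter_upwards [self_mem_nhdsWithin] with k hk
    exact (Lp.memLp g).1.inner ((greenPair hm hk).memLp_greenFun f).1
  · filter_upwards [self_mem_nhdsWithin] with k hk
    refine ae_of_all _ fun x => (norm_inner_le_norm _ _).trans ?_
    exact mul_le_mul_of_nonneg_left ((greenPair hm hk).norm_greenFun_le f x) (norm_nonneg _)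

theorem mem_resolventSet_extendedM {m k : ℂ} (hm : 0 < m.re) (hk : 0 ≤ k.re) :
    -m ^ 2 ∈ resolventSet (extendedM k) := ⟨_, isResolventAt_extendedM hm hk⟩

/-- Convergence along the horizontal half-line that ends at a point `k₀` of the imaginary axis. -/
theorem weakTendsto_resolvent_M {m k₀ : ℂ} (hm : 0 < m.re) (hk₀ : k₀.re = 0) :
    WeakTendsto (fun ε : ℝ => resolvent (M (ε + k₀)) (-m ^ 2)) (𝓝[>] 0)
      (resolvent (extendedM k₀) (-m ^ 2)) := by
  have h1 : Tendsto (fun ε : ℝ => (ε : ℂ) + k₀) (𝓝[>] 0) (𝓝[{k : ℂ | 0 ≤ k.re}] k₀) := by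
    refine tendsto_nhdsWithin_iff.2 ⟨?_, ?_⟩
    · have : Continuous fun ε : ℝ => (ε : ℂ) + k₀ := by fun_prop
      have := this.tendsto 0
      rw [Complex.ofReal_zero, zero_add] at this
      exact this.mono_left nhdsWithin_le_nhds
    · filter_upwards [self_mem_nhdsWithin] with ε hε
      have : (0 : ℝ) < ε := hε
      simp [hk₀, this.le]
  refine ((weakTendsto_resolvent_extendedM hm hk₀.ge).comp h1).congr' ?_
  filter_upwards [self_mem_nhdsWithin] with ε hε
  have : (0 : ℝ) < ε := hε
  simp only [Function.comp_apply]
  rw [extendedM_of_re_pos (by simpa [hk₀] using this)]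

theorem mem_resolventSet_M {m k : ℂ} (hm : 0 < m.re) (hk : 0 < k.re) :
    -m ^ 2 ∈ resolventSet (M k) := by
  rw [← extendedM_of_re_pos hk]
  exact mem_resolventSet_extendedM hm hk.le

end ExpPotential

end

theorem mainTheorem5 :
    (∀ m : ℂ, 0 < m.re →
      -m ^ 2 ∈ ExpPotential.resolventSet ExpPotential.freeOp ∧
      (∀ ε : ℝ, 0 < ε → -m ^ 2 ∈ ExpPotential.resolventSet (ExpPotential.M ε)) ∧
      ExpPotential.WeakTendsto
        (fun ε : ℝ => ExpPotential.resolvent (ExpPotential.M ε) (-m ^ 2)) (𝓝[>] 0)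
        (ExpPotential.resolvent ExpPotential.freeOp (-m ^ 2))) ∧
    (∀ (ℓ : ℝ) (m : ℂ), 0 < ℓ → 0 < m.re →
      (-m ^ 2 ∈ ExpPotential.resolventSet (ExpPotential.MInfty ℓ) ∧
        (∀ ε : ℝ, 0 < ε →
          -m ^ 2 ∈ ExpPotential.resolventSet (ExpPotential.M (ε + Complex.I * ℓ))) ∧
        ExpPotential.WeakTendsto
          (fun ε : ℝ => ExpPotential.resolvent (ExpPotential.M (ε + Complex.I * ℓ)) (-m ^ 2))
          (𝓝[>] 0) (ExpPotential.resolvent (ExpPotential.MInfty ℓ) (-m ^ 2))) ∧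
      (-m ^ 2 ∈ ExpPotential.resolventSet (ExpPotential.MZero ℓ) ∧
        (∀ ε : ℝ, 0 < ε →
          -m ^ 2 ∈ ExpPotential.resolventSet (ExpPotential.M (ε - Complex.I * ℓ))) ∧
        ExpPotential.WeakTendsto
          (fun ε : ℝ => ExpPotential.resolvent (ExpPotential.M (ε - Complex.I * ℓ)) (-m ^ 2))
          (𝓝[>] 0) (ExpPotential.resolvent (ExpPotential.MZero ℓ) (-m ^ 2)))) ∧
    (∀ m : ℂ, 0 < m.re →
      (∀ k : ℂ, 0 ≤ k.re → -m ^ 2 ∈ ExpPotential.resolventSet (ExpPotential.extendedM k)) ∧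
      ∀ k₀ : ℂ, 0 ≤ k₀.re →
        ExpPotential.WeakTendsto
          (fun k : ℂ => ExpPotential.resolvent (ExpPotential.extendedM k) (-m ^ 2))
          (𝓝[{k : ℂ | 0 ≤ k.re}] k₀)
          (ExpPotential.resolvent (ExpPotential.extendedM k₀) (-m ^ 2))) := by
  refine ⟨fun m hm => ⟨?_, fun ε hε => ?_, ?_⟩, fun ℓ m hℓ hm =>
    ⟨⟨?_, fun ε hε => ?_, ?_⟩, ?_, fun ε hε => ?_, ?_⟩, fun m hm =>
    ⟨fun k hk => ExpPotential.mem_resolventSet_extendedM hm hk,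
      fun k₀ hk₀ => ExpPotential.weakTendsto_resolvent_extendedM hm hk₀⟩⟩
  · rw [← ExpPotential.extendedM_zero]
    exact ExpPotential.mem_resolventSet_extendedM hm (by simp)
  · exact ExpPotential.mem_resolventSet_M hm (by simpa using hε)
  · have := ExpPotential.weakTendsto_resolvent_M (k₀ := 0) hm (by simp)
    simpa only [add_zero, ExpPotential.extendedM_zero] using this
  · rw [← ExpPotential.extendedM_I_mul hℓ]
    exact ExpPotential.mem_resolventSet_extendedM hm (by simp)
  · exact ExpPotential.mem_resolventSet_M hm (by simpa using hε)
  · rw [← ExpPotential.extendedM_I_mul hℓ]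
    exact ExpPotential.weakTendsto_resolvent_M hm (by simp)
  · rw [← ExpPotential.extendedM_neg_I_mul hℓ]
    exact ExpPotential.mem_resolventSet_extendedM hm (by simp)
  · exact ExpPotential.mem_resolventSet_M hm (by simpa using hε)
  · rw [← ExpPotential.extendedM_neg_I_mul hℓ]
    simp only [sub_eq_add_neg]
    exact ExpPotential.weakTendsto_resolvent_M hm (by simp)
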